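/- **Diagrams.** A scalar diagram of the fragment $\mathrm{ZH}_\pi$ consists of finitely many generators connected by wires, with no open wires: each wire joins two legs (possibly of one generator) or is a closed loop. The generators, each with any number of legs, are given by their tensors with indices $b_1,\dots,b_m\in\{0,1\}$ on the legs: the Z-spider with phase $\theta\in\{0,\pi\}$, with tensor $[b_1=\dots=b_m=0]+e^{i\theta}[b_1=\dots=b_m=1]$; the X-spider with phase $\theta\in\{0,\pi\}$, with tensor $[\,b_1+\dots+b_m\equiv\theta/\pi \bmod 2\,]$; the H-box with label $a\in\{-1,0\}$, with tensor $a$ if $b_1=\dots=b_m=1$ and $1$ otherwise; and the legless H-box with label $a\in\mathbb{Q}(e^{i\pi/4})$, with value $a$. The value of a diagram $D$ is $\sum_{x}\prod_{g}T_g(x)$, where $x$ ranges over the assignments of bits to the wires, $g$ over the generators, and $T_g(x)$ is the entry of the tensor of $g$ at the indices given by $x$. $\mathrm{Eval}\text{-}\mathrm{ZH}_\pi$ is the problem of computing the value of a given scalar diagram $D$. Elements of $\mathbb{Q}(e^{i\pi/4})$ are represented by four integers and a positive denominator in binary, i.e. as $(a_0+a_1\omega+a_2\omega^2+a_3\omega^3)/d$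 with $\omega=e^{i\pi/4}$; numbers and names of wires and variables are written in unary. Polynomial time refers to the length of the input as a bit string, which is polynomial in the number of generators and wires of $D$ and the number of bits of its parameters. **Formulas.** For a CNF formula $f$ in $n$ variables, $\#f$ is the number of its satisfying assignments in $\{0,1\}^n$; $f$ is a 3-CNF formula if every clause has at most three literals; #SAT is the problem of computing $\#f$ (in binary), and #3SAT its restriction to 3-CNF formulas. An instance of $\#\mathrm{SAT}_\pm$ is a CNF formula $f$ with a phase $\theta_i\in\{0,\pi\}$ for each variable $x_i$; its value is $\sum_{x:\,f(x)=1}\prod_i e^{i\theta_i x_i}$. $\mathbf{FP}^{\#\mathbf P}$ is the class of functions computable in polynomial time by a deterministic Turing machine with an oracle for #SAT. **Theorem.** 1. There is a polynomial-time counting reduction from $\mathrm{Eval}\text{-}\mathrm{ZH}_\pi$ to #3SAT: a deterministic Turing machine computes in polynomial time from a scalar diagram $D$ a scalar $c\in\mathbb{Q}(e^{i\pi/4})$ and two 3-CNF formulas $f_1,f_2$ such that the value of $D$ is $c\,(\#f_1-\#f_2)$. 2. Hence $\mathrm{Eval}\text{-}\mathrm{ZH}_\pi$ is in $\mathbf{FP}^{\#\mathbf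 P}$: an exact representation of the value of $D$ as an element of $\mathbb{Q}(e^{i\pi/4})$ is computable from $D$ in polynomial time by a deterministic Turing machine with an oracle for #SAT. 3. $\mathrm{Eval}\text{-}\mathrm{ZH}_\pi$ is equivalent to $\#\mathrm{SAT}_\pm$: from a scalar diagram $D$ one can compute in polynomial time a scalar $c\in\mathbb{Q}(e^{i\pi/4})$ and an instance of $\#\mathrm{SAT}_\pm$ with value $N$ such that the value of $D$ is $cN$; and from an instance of $\#\mathrm{SAT}_\pm$ with value $N$ one can compute in polynomial time a scalar diagram of the fragment with value $N$. -/

import Mathlib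

namespace ZHCount

/-! ### Bit-string encodings

All codes are self-delimiting.  Sizes and indices (numbers of variables or wires, names of variables
or wires) are written in unary, integers in binary (least significant bit first). -/

/-- A code whose words can be recognised as prefixes; in particular it is injective. -/
def SelfDelim {α : Type} (e : α → List Bool) : Prop :=
  ∀ x y s t, e x ++ s = e y ++ t → x = y ∧ s = t

/-- `n` in unary. -/
def encUnary (n : ℕ) : List Bool := List.replicate n true ++ [false]

/-- A list: each entry is announced by `true`, the end by `false`. -/
def encList {α : Type} (e : α → List Bool) : List α → List Bool
  | [] => [false]
  | x :: l => true :: (e x ++ encList e l)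

/-- `n` in binary. -/
def encNat (n : ℕ) : List Bool := encList (fun b => [b]) n.bits

/-- An integer: a sign bit and the absolute value in binary. -/
def encInt (z : ℤ) : List Bool := decide (z < 0) :: encNat z.natAbs

/-- A pair. -/
def encPair {α β : Type} (ea : α → List Bool) (eb : β → List Bool) (p : α × β) : List Bool :=
  ea p.1 ++ eb p.2

theorem SelfDelim.injective {α : Type} {e : α → List Bool} (h : SelfDelim e) :
    Function.Injective e :=
  fun x y hxy => (h x y [] [] (by rw [hxy])).1

theorem selfDelim_unary : SelfDelim encUnary := by
  intro x
  induction x with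
  | zero =>
    intro y s t h
    cases y with
    | zero => simpa [encUnary] using h
    | succ y => simp [encUnary, List.replicate_succ] at h
  | succ x ih =>
    intro y s t h
    cases y with
    | zero => simp [encUnary, List.replicate_succ] at h
    | succ y =>
      have := ih y s t (by simpa [encUnary, List.replicate_succ] using h)
      exact ⟨by rw [this.1], this.2⟩

theorem selfDelim_bool : SelfDelim (fun b : Bool => [b]) := by
  intro x y s t h
  simpa using h

theorem selfDelim_list {α : Type} {e : α → List Bool} (he : SelfDelim e) :
    SelfDelim (encList e) := by
  intro x
  induction x with
  | nil =>
    intro y s t h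
    cases y with
    | nil => simpa [encList] using h
    | cons b y => simp [encList] at h
  | cons a x ih =>
    intro y s t h
    cases y with
    | nil => simp [encList] at h
    | cons b y =>
      simp only [encList, List.cons_append, List.cons.injEq, true_and, List.append_assoc] at h
      obtain ⟨rfl, h2⟩ := he _ _ _ _ h
      obtain ⟨rfl, rfl⟩ := ih _ _ _ h2
      exact ⟨rfl, rfl⟩

theorem bits_injective : Function.Injective Nat.bits := by
  have key : ∀ n : ℕ, n.bits.foldr Nat.bit 0 = n := by
    intro n
    induction n using Nat.binaryRec' with
    | zero => simp
    | bit b n hn ih => rw [Nat.bits_append_bit n b hn, List.foldr_cons, ih]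
  intro x y h
  rw [← key x, h, key y]

theorem selfDelim_nat : SelfDelim encNat := by
  intro x y s t h
  obtain ⟨h1, h2⟩ := selfDelim_list selfDelim_bool _ _ _ _ h
  exact ⟨bits_injective h1, h2⟩

theorem selfDelim_int : SelfDelim encInt := by
  intro x y s t h
  simp only [encInt, List.cons_append, List.cons.injEq, decide_eq_decide] at h
  obtain ⟨h1, h2⟩ := selfDelim_nat _ _ _ _ h.2
  exact ⟨by omega, h2⟩

theorem selfDelim_pair {α β : Type} {ea : α → List Bool} {eb : β → List Bool}
    (ha : SelfDelim ea) (hb : SelfDelim eb) : SelfDelim (encPair ea eb) := by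
  rintro ⟨x1, x2⟩ ⟨y1, y2⟩ s t h
  simp only [encPair, List.append_assoc] at h
  obtain ⟨rfl, h2⟩ := ha _ _ _ _ h
  obtain ⟨rfl, rfl⟩ := hb _ _ _ _ h2
  exact ⟨rfl, rfl⟩

/-- An element of `Fin n`, in unary. -/
def encFin {n : ℕ} (i : Fin n) : List Bool := encUnary i

theorem selfDelim_fin {n : ℕ} : SelfDelim (encFin (n := n)) := by
  intro x y s t h
  obtain ⟨h1, h2⟩ := selfDelim_unary _ _ _ _ h
  exact ⟨Fin.ext h1, h2⟩

/-! ### Exactly represented scalars -/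

/-- A representation of an element of the field `ℚ(ω)`, `ω = e^{iπ/4}`, by four integers and a common
denominator.  The field contains all rationals, `i` and `√2`. -/
structure Scalar where
  a₀ : ℤ
  a₁ : ℤ
  a₂ : ℤ
  a₃ : ℤ
  den : ℕ
  den_pos : 0 < den

/-- The complex number `(a₀ + a₁ ω + a₂ ω² + a₃ ω³) / den` with `ω = e^{iπ/4}`. -/
noncomputable def Scalar.val (q : Scalar) : ℂ :=
  let ω : ℂ := Complex.exp (Real.pi * Complex.I / 4)
  (q.a₀ + q.a₁ * ω + q.a₂ * ω ^ 2 + q.a₃ * ω ^ 3) / q.den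

/-- The code of a scalar. -/
def Scalar.encode (q : Scalar) : List Bool :=
  encInt q.a₀ ++ (encInt q.a₁ ++ (encInt q.a₂ ++ (encInt q.a₃ ++ encNat q.den)))

theorem selfDelim_scalar : SelfDelim Scalar.encode := by
  rintro ⟨a, b, c, d, e, _⟩ ⟨a', b', c', d', e', _⟩ s t h
  simp only [Scalar.encode, List.append_assoc] at h
  obtain ⟨rfl, h1⟩ := selfDelim_int _ _ _ _ h
  obtain ⟨rfl, h2⟩ := selfDelim_int _ _ _ _ h1
  obtain ⟨rfl, h3⟩ := selfDelim_int _ _ _ _ h2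
  obtain ⟨rfl, h4⟩ := selfDelim_int _ _ _ _ h3
  obtain ⟨rfl, h5⟩ := selfDelim_nat _ _ _ _ h4
  exact ⟨rfl, h5⟩

/-! ### Boolean formulas in conjunctive normal form -/

/-- A CNF formula in the variables `x_i`, `i < numVars`.  The literal `(i, true)` is `x_i` and
`(i, false)` is `¬ x_i`. -/
structure CNF where
  numVars : ℕ
  clauses : List (List (Fin numVars × Bool))

namespace CNF

/-- `x` satisfies `φ`: every clause contains a true literal. -/
def Sat (φ : CNF) (x : Fin φ.numVars → Bool) : Prop :=
  ∀ C ∈ φ.clauses, ∃ l ∈ C, x l.1 = l.2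

instance (φ : CNF) (x : Fin φ.numVars → Bool) : Decidable (φ.Sat x) :=
  inferInstanceAs (Decidable (∀ C ∈ φ.clauses, ∃ l ∈ C, x l.1 = l.2))

/-- The number of satisfying assignments. -/
def count (φ : CNF) : ℕ := (Finset.univ.filter fun x => φ.Sat x).card

/-- All clauses have at most three literals. -/
def Is3CNF (φ : CNF) : Prop := ∀ C ∈ φ.clauses, C.length ≤ 3

/-- The code of a formula. -/
def encode (φ : CNF) : List Bool :=
  encUnary φ.numVars ++ encList (encList (encPair encFin fun b => [b])) φ.clauses

theorem selfDelim_encode : SelfDelim encode := by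
  rintro ⟨n, c⟩ ⟨n', c'⟩ s t h
  simp only [encode, List.append_assoc] at h
  obtain ⟨rfl, h1⟩ := selfDelim_unary _ _ _ _ h
  obtain ⟨rfl, h2⟩ := selfDelim_list
    (selfDelim_list (selfDelim_pair selfDelim_fin selfDelim_bool)) _ _ _ _ h1
  exact ⟨rfl, h2⟩

end CNF

/-- A CNF formula whose variables are labelled by phases: `true` stands for the phase `π`, `false`
for the phase `0`. -/
structure PhasedCNF where
  formula : CNF
  phase : Fin formula.numVars → Bool

/-- The signed count: the sum over all satisfying assignments `x` of `∏ᵢ e^{i θᵢ xᵢ}`, where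
`θᵢ ∈ {0, π}` is the phase of the `i`-th variable. -/
def PhasedCNF.count (φ : PhasedCNF) : ℤ :=
  ∑ x ∈ Finset.univ.filter (fun x => φ.formula.Sat x),
    ∏ i, if φ.phase i && x i then (-1 : ℤ) else 1

/-- The code of a formula with phases. -/
def PhasedCNF.encode (φ : PhasedCNF) : List Bool :=
  φ.formula.encode ++ encList (fun b => [b]) (List.ofFn φ.phase)

theorem PhasedCNF.selfDelim_encode : SelfDelim PhasedCNF.encode := by
  rintro ⟨f, p⟩ ⟨f', p'⟩ s t h
  simp only [PhasedCNF.encode, List.append_assoc] at h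
  obtain ⟨rfl, h0⟩ := CNF.selfDelim_encode _ _ _ _ h
  obtain ⟨h1, h2⟩ := selfDelim_list selfDelim_bool _ _ _ _ h0
  obtain rfl := List.ofFn_injective h1
  exact ⟨rfl, h2⟩

/-! ### Diagrams -/

/-- The Z-spider with phase factor `e = e^{iθ}`: the tensor is `1` if all indices are `0`, plus `e` if
all indices are `1`. -/
def zTensor (e : ℂ) (b : List Bool) : ℂ :=
  (if ∀ v ∈ b, v = false then 1 else 0) + (if ∀ v ∈ b, v = true then e else 0)

/-- The H-box with label `a`: the tensor is `a` if all indices are `1`, and `1` otherwise. -/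
def hTensor (a : ℂ) (b : List Bool) : ℂ := if ∀ v ∈ b, v = true then a else 1

/-- The phase factor of the phase `π` (`true`) or `0` (`false`). -/
def phaseFactor (p : Bool) : ℂ := if p then -1 else 1

/-- The X-spider with phase `0` or `π`: the tensor is `1` if the indices have even, respectively odd,
sum, and `0` otherwise. -/
def xTensor (p : Bool) (b : List Bool) : ℂ := if b.foldr xor p = false then 1 else 0

/-- The X-spider is the derived generator: a Z-spider with the same phase, an H-box with label `-1`
on each of its legs, and a scalar H-box with label `1/2`. -/
theorem xTensor_eq (p : Bool) (b : List Bool) :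
    xTensor p b = hTensor (1 / 2) [] *
      ∑ x : Fin b.length → Bool, zTensor (phaseFactor p) (List.ofFn x) *
        ∏ i, hTensor (-1) [x i, b.get i] := by
  have hz : ∀ (e : ℂ) (n : ℕ) (x : Fin n → Bool), zTensor e (List.ofFn x) =
      (if x = fun _ => false then 1 else 0) + (if x = fun _ => true then e else 0) := by
    intro e n x
    simp [zTensor, funext_iff, List.mem_ofFn]
  have hb : ∏ i, hTensor (-1) [true, b.get i] =
      (b.map fun v => if v = true then (-1 : ℂ) else 1).prod := by
    rw [← List.prod_ofFn]
    congr 1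
    conv_rhs => rw [← List.ofFn_get b, List.map_ofFn]
    simp [hTensor, Function.comp_def]
  have hx : ∀ (b : List Bool) (p : Bool), (if b.foldr xor p = false then (1 : ℂ) else 0) =
      1 / 2 * (1 + phaseFactor p * (b.map fun v => if v = true then (-1 : ℂ) else 1).prod) := by
    intro b p
    have key : phaseFactor p * (b.map fun v => if v = true then (-1 : ℂ) else 1).prod =
        if b.foldr xor p = false then 1 else -1 := by
      induction b with
      | nil => cases p <;> simp [phaseFactor]
      | cons v b ih =>
        rw [List.map_cons, List.prod_cons, mul_left_comm, ih, List.foldr_cons]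
        cases v <;> cases b.foldr xor p <;> simp
    rw [key]
    split_ifs <;> norm_num
  simp only [hz, add_mul, ite_mul, zero_mul, one_mul, Finset.sum_add_distrib, Finset.sum_ite_eq',
    Finset.mem_univ, if_true, hb, xTensor, hx]
  simp [hTensor]

/-- A generator of the fragment, with its legs attached to wires out of `0, …, n - 1`. -/
inductive Generator (n : ℕ) where
  /-- a Z-spider with phase `π` (`true`) or `0` (`false`) -/
  | zSpider (phase : Bool) (legs : List (Fin n))
  /-- an X-spider with phase `π` (`true`) or `0` (`false`) -/
  | xSpider (phase : Bool) (legs : List (Fin n))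
  /-- an H-box with the default label `-1` -/
  | hBox (legs : List (Fin n))
  /-- an H-box with label `0` -/
  | zeroBox (legs : List (Fin n))
  /-- an H-box without legs, with label `a` -/
  | scalarBox (a : Scalar)

namespace Generator

/-- The legs of a generator; entry `w` means that this leg is an end of the wire `w`. -/
def legs {n : ℕ} : Generator n → List (Fin n)
  | zSpider _ l => l
  | xSpider _ l => l
  | hBox l => l
  | zeroBox l => l
  | scalarBox _ => []

/-- The entry of the tensor of a generator at the indices given by an assignment to the wires. -/
noncomputable def tensor {n : ℕ} (x : Fin n → Bool) : Generator n → ℂ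
  | zSpider p l => zTensor (phaseFactor p) (l.map x)
  | xSpider p l => xTensor p (l.map x)
  | hBox l => hTensor (-1) (l.map x)
  | zeroBox l => hTensor 0 (l.map x)
  | scalarBox a => hTensor a.val []

/-- The code of a generator. -/
def encode {n : ℕ} : Generator n → List Bool
  | zSpider p l => [false, false, p] ++ encList encFin l
  | xSpider p l => [false, true, p] ++ encList encFin l
  | hBox l => [true, false, true] ++ encList encFin l
  | zeroBox l => [true, false, false] ++ encList encFin l
  | scalarBox a => [true, true] ++ a.encode

/-- The number of bits of the parameters of a generator. -/
def paramBits {n : ℕ} : Generator n → ℕ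
  | scalarBox a => a.encode.length
  | _ => 1

theorem selfDelim_encode {n : ℕ} : SelfDelim (encode (n := n)) := by
  intro x y s t h
  have hl := selfDelim_list (selfDelim_fin (n := n))
  have hs := selfDelim_scalar
  cases x <;> cases y <;> simp [encode] at h <;> grind [SelfDelim]

end Generator

/-- A scalar diagram of the fragment: finitely many generators connected by wires.  Each wire has two
ends, and these are attached to two legs (possibly of the same generator), or else the wire is a
closed loop and attached to nothing; no leg is left open. -/
structure Diagram where
  numWires : ℕ
  gens : List (Generator numWires)
  wires_closed : ∀ w : Fin numWires,
    (gens.flatMap Generator.legs).count w = 2 ∨ (gens.flatMap Generator.legs).count w = 0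

namespace Diagram

/-- The value of a scalar diagram: the contraction of its tensor network. -/
noncomputable def value (D : Diagram) : ℂ :=
  ∑ x : Fin D.numWires → Bool, (D.gens.map (Generator.tensor x)).prod

/-- The number of generators and wires. -/
def size (D : Diagram) : ℕ := D.gens.length + D.numWires

/-- The number of bits of all parameters. -/
def paramBits (D : Diagram) : ℕ := (D.gens.map Generator.paramBits).sum

/-- The code of a diagram. -/
def encode (D : Diagram) : List Bool :=
  encUnary D.numWires ++ encList Generator.encode D.gens

theorem selfDelim_encode : SelfDelim encode := by
  rintro ⟨n, g, _⟩ ⟨n', g', _⟩ s t h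
  simp only [encode, List.append_assoc] at h
  obtain ⟨rfl, h1⟩ := selfDelim_unary _ _ _ _ h
  obtain ⟨rfl, h2⟩ := selfDelim_list Generator.selfDelim_encode _ _ _ _ h1
  exact ⟨rfl, h2⟩

/-- The length of the code is polynomial in the number of generators and wires and the number of bits
of the parameters, so that running times may be measured in terms of either. -/
theorem length_encode_le (D : Diagram) :
    D.encode.length ≤ 6 * (D.size + 1) ^ 2 + D.paramBits := by
  have hfin : ∀ (n : ℕ) (l : List (Fin n)),
      (encList encFin l).length ≤ 1 + (n + 1) * l.length := by
    intro n l
    induction l with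
    | nil => simp [encList]
    | cons i l ih =>
      have := i.isLt
      simp only [encList, encFin, encUnary, List.length_cons, List.length_append,
        List.length_replicate, List.length_nil] at ih ⊢
      nlinarith
  have hgen : ∀ (n : ℕ) (g : Generator n),
      g.encode.length ≤ 4 + (n + 1) * g.legs.length + g.paramBits := by
    intro n g
    cases g with
    | scalarBox a => simp [Generator.encode, Generator.legs, Generator.paramBits]; omega
    | _ p =>
      simp only [Generator.encode, Generator.legs, Generator.paramBits, List.length_append,
        List.length_cons, List.length_nil]
      grind
  have hsum : ∀ (n : ℕ) (l : List (Generator n)), (encList Generator.encode l).length ≤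
      1 + 5 * l.length + (n + 1) * (l.flatMap Generator.legs).length
        + (l.map Generator.paramBits).sum := by
    intro n l
    induction l with
    | nil => simp [encList]
    | cons g l ih =>
      have := hgen n g
      simp only [encList, List.length_cons, List.length_append, List.flatMap_cons, List.map_cons,
        List.sum_cons] at ih ⊢
      nlinarith
  have hlegs : (D.gens.flatMap Generator.legs).length ≤ 2 * D.numWires := by
    rw [← Multiset.coe_card,
      ← Multiset.sum_count_eq_card (s := Finset.univ) (fun a _ => Finset.mem_univ a)]
    calc _ ≤ ∑ _w : Fin D.numWires, 2 := Finset.sum_le_sum fun w _ => by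
            rw [Multiset.coe_count]
            rcases D.wires_closed w with h | h <;> omega
      _ = 2 * D.numWires := by simp [mul_comm]
  have h := hsum _ D.gens
  have h2 := Nat.mul_le_mul_left (D.numWires + 1) hlegs
  simp only [encode, encUnary, List.length_append, List.length_replicate, List.length_cons,
    List.length_nil, size, paramBits]
  nlinarith [Nat.zero_le (D.gens.length * D.numWires), Nat.zero_le (D.gens.length ^ 2),
    Nat.zero_le (D.numWires ^ 2)]

end Diagram

/-! ### Polynomial time and oracles -/

/-- `f` is computed by a (multi-stack) Turing machine in time polynomial in the length of the code of
the input. -/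
def PolyTime {α β : Type} (ea : α → List Bool) (eb : β → List Bool) (f : α → β) : Prop :=
  Nonempty (Turing.TM2ComputableInPolyTime ea eb f)

/-- A deterministic multi-stack Turing machine with a query stack and an answer stack over `Bool`.
If `next l = some l'` then `l` is a query label: the oracle is called and the machine continues at
the label `l'`. -/
structure OracleTM where
  tm : Turing.FinTM2
  queryStack : tm.K
  answerStack : tm.K
  queryAlphabet : tm.Γ queryStack ≃ Bool
  answerAlphabet : tm.Γ answerStack ≃ Bool
  next : tm.Λ → Option tm.Λ

/-- One step of an oracle machine with oracle `O`.  At a query label the content `w` of the query stack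
is removed and the content of the answer stack is replaced by `O w`; at every other label the
machine makes an ordinary step. -/
def OracleTM.step (M : OracleTM) (O : List Bool → List Bool) (c : M.tm.Cfg) : Option M.tm.Cfg :=
  match c.l with
  | none => none
  | some l =>
    match M.next l with
    | none => M.tm.step c
    | some l' =>
      some
        { l := some l'
          var := c.var
          stk := Function.update (Function.update c.stk M.queryStack []) M.answerStack
            ((O ((c.stk M.queryStack).map M.queryAlphabet)).map M.answerAlphabet.symm) }

/-- `f` is computed by a deterministic Turing machine with oracle `O` in time polynomial in the length
of the code of the input. -/
def PolyTimeWithOracle {α β : Type} (O : List Bool → List Bool)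
    (ea : α → List Bool) (eb : β → List Bool) (f : α → β) : Prop :=
  ∃ (M : OracleTM) (inputAlphabet : M.tm.Γ M.tm.k₀ ≃ Bool) (outputAlphabet : M.tm.Γ M.tm.k₁ ≃ Bool)
    (time : Polynomial ℕ), ∀ a,
      Nonempty (StateTransition.EvalsToInTime (M.step O)
        (Turing.initList M.tm ((ea a).map inputAlphabet.symm))
        (some (Turing.haltList M.tm ((eb (f a)).map outputAlphabet.symm)))
        (time.eval (ea a).length))

open Classical in
/-- The counting problem for CNF formulas as a function on bit strings: the code of `φ` is mapped to
the number of satisfying assignments of `φ` in binary. -/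
noncomputable def sharpSAT (w : List Bool) : List Bool :=
  if h : ∃ φ : CNF, φ.encode = w then h.choose.count.bits else []

theorem sharpSAT_encode (φ : CNF) : sharpSAT φ.encode = φ.count.bits := by
  have h : ∃ ψ : CNF, ψ.encode = φ.encode := ⟨φ, rfl⟩
  rw [sharpSAT, dif_pos h, CNF.selfDelim_encode.injective h.choose_spec]

/-- The problem of finding the complex number `F a` for a given `a`, written exactly as an element of
`ℚ(e^{iπ/4})`, is solved in polynomial time with an oracle for the counting problem for CNF
formulas. -/
def InFPSharpP {α : Type} (ea : α → List Bool) (F : α → ℂ) : Prop :=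
  ∃ g : α → Scalar, (∀ a, (g a).val = F a) ∧ PolyTimeWithOracle sharpSAT ea Scalar.encode g

end ZHCount

namespace ZHCount

open Turing StateTransition

/-! ### A structured language for stack machines -/

/-! Fix the bits on the wires. Every tensor of the fragment can be evaluated by an automaton that
reads the legs one by one and remembers one bit: a Z-spider guesses a bit and checks that each leg
agrees with it, an X-spider accumulates the xor starting from its phase and must end in `false`, and
an H-box accumulates the conjunction of its legs. Writing down the successive states as new Boolean
variables, each constrained only together with its predecessor and one leg, turns a generator into
clauses with three literals. A sign, from the phase of a Z-spider or the label `-1`, becomes the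
phase `π` of the last state variable; the label `0` becomes a constraint that the conjunction is
false. Summed over its state variables, such a gadget has exactly the value of the tensor
(`RawGen.gadgetSum_z`, `RawGen.gadgetSum_x`, `RawGen.gadgetSum_h`). The gadgets of different
generators share only wire variables, so their sums multiply, and `Diagram.value_eq` expresses the
value as the product of the scalar boxes times a signed count. This is the reduction to `PhasedCNF`.

To remove the signs, further variables compute the parity of all variables of phase `π` and force it
to be even or odd; the signed count is the difference of the two resulting plain counts
(`Instr.signedSum_eq_sub`). Two oracle calls and exact arithmetic in the basis of powers of `ω`,
with `ω ^ 4 = -1`, then give the value itself.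

Conversely, a phased formula becomes a diagram with a Z-spider for each variable, which copies its
value and carries the phase, an X-spider for each literal, which computes its negation, and a box
with label `0` for each clause, which vanishes exactly if all literals are false
(`Occurrence.value_toDiagram`).

Polynomial running time is proved for actual machines. Programs of a small structured language over
four stacks are compiled to Turing machines (`Prog.steps_of_run`). Data are binary trees on the main
stack, and `PT` collects the functions that such programs compute in polynomial time. It is closed
under composition, pairing, case distinction and iteration along a list; the last, `PT.foldl`,
requires a polynomial bound on all intermediate results, since repeated doubling would be
exponential. Binary arithmetic, parsers and printers are built from these closure properties alone,
so that after the definition of the reductions most remaining goals are left to `fun_prop`. -/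

/-- The four stacks of the machines. -/
inductive Stk where
  | main | a | b | c
  deriving DecidableEq

instance : Fintype Stk := ⟨{.main, .a, .b, .c}, fun k => by cases k <;> decide⟩

/-- The contents of the four stacks. -/
structure Stacks where
  main : List Bool
  a : List Bool
  b : List Bool
  c : List Bool

namespace Stacks

def get (S : Stacks) : Stk → List Bool
  | .main => S.main
  | .a => S.a
  | .b => S.b
  | .c => S.c

def set (S : Stacks) (k : Stk) (l : List Bool) : Stacks :=
  match k with
  | .main => { S with main := l }
  | .a => { S with a := l }
  | .b => { S with b := l }
  | .c => { S with c := l }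

theorem get_set (S : Stacks) (k : Stk) (l : List Bool) :
    (S.set k l).get = Function.update S.get k l := by
  funext j
  cases k <;> cases j <;> rfl

end Stacks

/-- Structured programs.  `pop k p₀ p₁` pops a symbol and branches on it; `loop k halt p₀ p₁` pops
symbols from `k` and runs the branches, until `k` is empty or, if `halt` holds, `false` was popped;
`oracle` calls the oracle with query stack `b` and answer stack `c`. -/
inductive Prog where
  | skip
  | push (k : Stk) (v : Bool)
  | pop (k : Stk) (p₀ p₁ : Prog)
  | seq (p q : Prog)
  | loop (k : Stk) (halt : Bool) (p₀ p₁ : Prog)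
  | oracle

namespace Prog

/-- The program does not call the oracle. -/
def OracleFree : Prog → Prop
  | skip => True
  | push _ _ => True
  | pop _ p q => p.OracleFree ∧ q.OracleFree
  | seq p q => p.OracleFree ∧ q.OracleFree
  | loop _ _ p q => p.OracleFree ∧ q.OracleFree
  | oracle => False

/-- `Run O p S S' t`: with oracle `O` the program `p` leads from `S` to `S'` in `t` steps. -/
inductive Run (O : List Bool → List Bool) : Prog → Stacks → Stacks → ℕ → Prop
  | skip {S} : Run O .skip S S 1
  | push {k v S} : Run O (.push k v) S (S.set k (v :: S.get k)) 1
  | pop_none {k p q S} : S.get k = [] → Run O (.pop k p q) S S 1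
  | pop_false {k p q S r S' t} : S.get k = false :: r → Run O p (S.set k r) S' t →
      Run O (.pop k p q) S S' (t + 1)
  | pop_true {k p q S r S' t} : S.get k = true :: r → Run O q (S.set k r) S' t →
      Run O (.pop k p q) S S' (t + 1)
  | seq {p q S S' S'' t t'} : Run O p S S' t → Run O q S' S'' t' → Run O (.seq p q) S S'' (t' + t)
  | loop_none {k e p q S} : S.get k = [] → Run O (.loop k e p q) S S 1
  | loop_stop {k p q S r} : S.get k = false :: r → Run O (.loop k true p q) S (S.set k r) 1
  | loop_false {k p q S r S' S'' t t'} : S.get k = false :: r → Run O p (S.set k r) S' t →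
      Run O (.loop k false p q) S' S'' t' → Run O (.loop k false p q) S S'' (t' + t + 1)
  | loop_true {k e p q S r S' S'' t t'} : S.get k = true :: r → Run O q (S.set k r) S' t →
      Run O (.loop k e p q) S' S'' t' → Run O (.loop k e p q) S S'' (t' + t + 1)
  | oracle {S} : Run O .oracle S ((S.set .b []).set .c (O (S.get .b))) 1

/-! ### Compilation -/

/-- The labels of the compiled program. -/
def Lab : Prog → Type
  | skip => Unit
  | push _ _ => Unit
  | pop _ p q => Unit ⊕ (Lab p ⊕ Lab q)
  | seq p q => Lab p ⊕ Lab q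
  | loop _ _ p q => Unit ⊕ (Lab p ⊕ Lab q)
  | oracle => Unit

@[reducible]
def labFintype : ∀ p : Prog, Fintype (Lab p)
  | skip => inferInstanceAs (Fintype Unit)
  | push _ _ => inferInstanceAs (Fintype Unit)
  | pop _ p q =>
    letI := labFintype p
    letI := labFintype q
    inferInstanceAs (Fintype (Unit ⊕ (Lab p ⊕ Lab q)))
  | seq p q =>
    letI := labFintype p
    letI := labFintype q
    inferInstanceAs (Fintype (Lab p ⊕ Lab q))
  | loop _ _ p q =>
    letI := labFintype p
    letI := labFintype q
    inferInstanceAs (Fintype (Unit ⊕ (Lab p ⊕ Lab q)))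
  | oracle => inferInstanceAs (Fintype Unit)

instance (p : Prog) : Fintype (Lab p) := labFintype p

/-- The first label of the compiled program. -/
def entry : ∀ p : Prog, Lab p
  | skip => ()
  | push _ _ => ()
  | pop _ _ _ => Sum.inl ()
  | seq p _ => Sum.inl p.entry
  | loop _ _ _ _ => Sum.inl ()
  | oracle => ()

/-- Pop a symbol and jump to one of three labels. -/
def popStmt {Λ : Type} (k : Stk) (eN e₀ e₁ : Λ) : TM2.Stmt (fun _ : Stk => Bool) Λ (Option Bool) :=
  .pop k (fun _ o => o) (.branch (fun v => v.isSome)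
    (.branch (fun v => v == some true)
      (.load (fun _ => none) (.goto fun _ => e₁)) (.load (fun _ => none) (.goto fun _ => e₀)))
    (.goto fun _ => eN))

/-- The internal register holds a popped symbol only within one statement and is then reset to
`none`. Between steps a configuration is therefore described by its label and stacks alone. -/
theorem stepAux_popStmt {Λ : Type} (k : Stk) (eN e₀ e₁ : Λ) (S : Stacks) :
    TM2.stepAux (popStmt k eN e₀ e₁) none S.get =
      match S.get k with
      | [] => ⟨some eN, none, S.get⟩
      | false :: r => ⟨some e₀, none, (S.set k r).get⟩
      | true :: r => ⟨some e₁, none, (S.set k r).get⟩ := by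
  rw [popStmt]
  rcases h : S.get k with _ | ⟨_ | _, r⟩ <;> simp [h, Stacks.get_set]

/-- The statements of the compiled program, given the embedding `ι` of its labels and the label `e`
at which the machine continues. -/
def stmts {Λ : Type} : ∀ p : Prog, (Lab p → Λ) → Λ → Lab p →
    TM2.Stmt (fun _ : Stk => Bool) Λ (Option Bool)
  | skip, _, e, _ => .goto fun _ => e
  | push k v, _, e, _ => .push k (fun _ => v) (.goto fun _ => e)
  | pop k p q, ι, e, .inl _ =>
    popStmt k e (ι (.inr (.inl p.entry))) (ι (.inr (.inr q.entry)))
  | pop _ p _, ι, e, .inr (.inl l) => stmts p (fun l => ι (.inr (.inl l))) e l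
  | pop _ _ q, ι, e, .inr (.inr l) => stmts q (fun l => ι (.inr (.inr l))) e l
  | seq p q, ι, _, .inl l => stmts p (fun l => ι (.inl l)) (ι (.inr q.entry)) l
  | seq _ q, ι, e, .inr l => stmts q (fun l => ι (.inr l)) e l
  | loop k s p q, ι, e, .inl _ =>
    popStmt k e (if s then e else ι (.inr (.inl p.entry))) (ι (.inr (.inr q.entry)))
  | loop _ _ p _, ι, _, .inr (.inl l) => stmts p (fun l => ι (.inr (.inl l))) (ι (.inl ())) l
  | loop _ _ _ q, ι, _, .inr (.inr l) => stmts q (fun l => ι (.inr (.inr l))) (ι (.inl ())) l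
  | oracle, _, e, _ => .goto fun _ => e

/-- The query labels of the compiled program. -/
def queries {Λ : Type} : ∀ p : Prog, (Lab p → Λ) → Λ → Lab p → Option Λ
  | skip, _, _, _ => none
  | push _ _, _, _, _ => none
  | pop _ _ _, _, _, .inl _ => none
  | pop _ p _, ι, e, .inr (.inl l) => queries p (fun l => ι (.inr (.inl l))) e l
  | pop _ _ q, ι, e, .inr (.inr l) => queries q (fun l => ι (.inr (.inr l))) e l
  | seq p q, ι, _, .inl l => queries p (fun l => ι (.inl l)) (ι (.inr q.entry)) l
  | seq _ q, ι, e, .inr l => queries q (fun l => ι (.inr l)) e l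
  | loop _ _ _ _, _, _, .inl _ => none
  | loop _ _ p _, ι, _, .inr (.inl l) => queries p (fun l => ι (.inr (.inl l))) (ι (.inl ())) l
  | loop _ _ _ q, ι, _, .inr (.inr l) => queries q (fun l => ι (.inr (.inr l))) (ι (.inl ())) l
  | oracle, _, e, _ => some e

theorem queries_eq_none {Λ : Type} (p : Prog) (h : p.OracleFree) (ι : Lab p → Λ) (e : Λ)
    (l : Lab p) : queries p ι e l = none := by
  induction p generalizing e with
  | skip => rfl
  | push => rfl
  | pop k p q ihp ihq =>
    rcases l with _ | l | l
    · rfl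
    · exact ihp h.1 _ _ _
    · exact ihq h.2 _ _ _
  | seq p q ihp ihq =>
    rcases l with l | l
    · exact ihp h.1 _ _ _
    · exact ihq h.2 _ _ _
  | loop k s p q ihp ihq =>
    rcases l with _ | l | l
    · rfl
    · exact ihp h.1 _ _ _
    · exact ihq h.2 _ _ _
  | oracle => exact h.elim

/-- The machine that runs `p` and halts. -/
def toMachine (p : Prog) : OracleTM where
  tm :=
    { K := Stk
      k₀ := .main
      k₁ := .main
      Γ := fun _ => Bool
      Λ := Option (Lab p)
      main := some p.entry
      σ := Option Bool
      initialState := none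
      Γk₀Fin := inferInstanceAs (Fintype Bool)
      m := fun l => match l with
        | some l => stmts p some none l
        | none => .halt }
  queryStack := .b
  answerStack := .c
  queryAlphabet := Equiv.refl Bool
  answerAlphabet := Equiv.refl Bool
  next := fun l => match l with
    | some l => queries p some none l
    | none => none

/-- `f` leads from `x` to `y` in `t` steps. -/
def Steps {C : Type} (f : C → Option C) (t : ℕ) (x y : C) : Prop :=
  (flip bind f)^[t] (some x) = some y

theorem Steps.trans {C : Type} {f : C → Option C} {t t' : ℕ} {x y z : C}
    (h : Steps f t x y) (h' : Steps f t' y z) : Steps f (t' + t) x z := by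
  rw [Steps, Function.iterate_add_apply, h, h']

theorem Steps.single {C : Type} {f : C → Option C} {x y : C} (h : f x = some y) :
    Steps f 1 x y := by
  simpa [Steps, flip] using h

/-- The configuration of the compiled machine. -/
def cfg (p : Prog) (l : Option (Option (Lab p))) (S : Stacks) : p.toMachine.tm.Cfg :=
  { l := l, var := (none : Option Bool), stk := S.get }

/-- Induction on the run. The machine is that of a surrounding program `r`, and the embedding `ι`
and the exit label `e` vary, because a subprogram runs inside the larger machine and exits to
wherever its context continues. -/
theorem steps_of_run_aux (r : Prog) (O : List Bool → List Bool) {p : Prog} {S S' : Stacks} {t : ℕ}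
    (h : Run O p S S' t) : ∀ (ι : Lab p → Option (Lab r)) (e : Option (Lab r)),
    (∀ l, r.toMachine.tm.m (ι l) = stmts p ι e l) →
    (∀ l, r.toMachine.next (ι l) = queries p ι e l) →
    Steps (r.toMachine.step O) t (cfg r (some (ι p.entry)) S) (cfg r (some e) S') := by
  have key : ∀ (l : Option (Lab r)) (S : Stacks) (st : r.toMachine.tm.Stmt)
      (C : r.toMachine.tm.Cfg),
      r.toMachine.tm.m l = st → r.toMachine.next l = none →
      (TM2.stepAux (K := Stk) (Γ := fun _ => Bool) st (none : Option Bool) S.get :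
        TM2.Cfg (fun _ : Stk => Bool) (Option (Lab r)) (Option Bool)) = C →
      Steps (r.toMachine.step O) 1 (cfg r (some l) S) C := by
    intro l S st C h1 h2 h3
    apply Steps.single
    simp only [OracleTM.step, cfg, h2]
    rw [← h3, ← h1]
    rfl
  induction h with
  | skip => exact fun ι e hm hn => key _ _ _ _ (hm ()) (hn ()) rfl
  | push =>
    intro ι e hm hn
    refine key _ _ _ _ (hm ()) (hn ()) ?_
    simp [stmts, cfg, Stacks.get_set]
    rfl
  | pop_none h0 =>
    intro ι e hm hn
    refine key _ _ _ _ (hm (.inl ())) (hn (.inl ())) ?_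
    rw [stmts, stepAux_popStmt, h0]
    rfl
  | pop_false h0 _ ih =>
    intro ι e hm hn
    refine (key _ _ _ _ (hm (.inl ())) (hn (.inl ())) ?_).trans
      (ih _ e (fun l => hm (.inr (.inl l))) (fun l => hn (.inr (.inl l))))
    rw [stmts, stepAux_popStmt, h0]
    rfl
  | pop_true h0 _ ih =>
    intro ι e hm hn
    refine (key _ _ _ _ (hm (.inl ())) (hn (.inl ())) ?_).trans
      (ih _ e (fun l => hm (.inr (.inr l))) (fun l => hn (.inr (.inr l))))
    rw [stmts, stepAux_popStmt, h0]
    rfl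
  | seq _ _ ih ih' =>
    intro ι e hm hn
    exact (ih _ _ (fun l => hm (.inl l)) (fun l => hn (.inl l))).trans
      (ih' _ _ (fun l => hm (.inr l)) (fun l => hn (.inr l)))
  | loop_none h0 =>
    intro ι e hm hn
    refine key _ _ _ _ (hm (.inl ())) (hn (.inl ())) ?_
    rw [stmts, stepAux_popStmt, h0]
    rfl
  | loop_stop h0 =>
    intro ι e hm hn
    refine key _ _ _ _ (hm (.inl ())) (hn (.inl ())) ?_
    rw [stmts, stepAux_popStmt, h0]
    rfl
  | loop_false h0 _ _ ih ih' =>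
    intro ι e hm hn
    -- The test and the body, `t + 1` steps, lead back to the label of the loop; the remaining
    -- rounds take `t'` steps.
    rw [add_assoc]
    refine Steps.trans ((key _ _ _ _ (hm (.inl ())) (hn (.inl ())) ?_).trans
      (ih _ _ (fun l => hm (.inr (.inl l))) (fun l => hn (.inr (.inl l))))) (ih' ι e hm hn)
    rw [stmts, stepAux_popStmt, h0]
    rfl
  | loop_true h0 _ _ ih ih' =>
    intro ι e hm hn
    rw [add_assoc]
    refine Steps.trans ((key _ _ _ _ (hm (.inl ())) (hn (.inl ())) ?_).trans
      (ih _ _ (fun l => hm (.inr (.inr l))) (fun l => hn (.inr (.inr l))))) (ih' ι e hm hn)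
    rw [stmts, stepAux_popStmt, h0]
    rfl
  | @oracle S =>
    intro ι e hm hn
    apply Steps.single
    have hq : r.toMachine.next (ι (entry oracle)) = some e := hn ()
    simp only [OracleTM.step, cfg, hq, Stacks.get_set]
    have h1 : List.map r.toMachine.queryAlphabet (S.get .b) = S.get .b := List.map_id _
    have h2 : List.map r.toMachine.answerAlphabet.symm (O (S.get .b)) = O (S.get .b) :=
      List.map_id _
    congr 2
    exact (congrArg (fun x => Function.update (Function.update S.get Stk.b []) Stk.c
      (List.map r.toMachine.answerAlphabet.symm (O x))) h1).trans
      (congrArg (Function.update (Function.update S.get Stk.b []) Stk.c) h2)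

/-- A program that transforms the main stack is executed by its machine. -/
theorem steps_of_run (p : Prog) (O : List Bool → List Bool) {w w' : List Bool} {t : ℕ}
    (h : Run O p ⟨w, [], [], []⟩ ⟨w', [], [], []⟩ t) :
    Steps (p.toMachine.step O) (t + 1) (initList p.toMachine.tm w)
      (haltList p.toMachine.tm w') := by
  have h1 := steps_of_run_aux p O h some none (fun _ => rfl) (fun _ => rfl)
  have hi : initList p.toMachine.tm w = cfg p (some (some p.entry)) ⟨w, [], [], []⟩ := by
    refine congrArg (TM2.Cfg.mk _ _) (funext fun k => ?_)
    cases k <;> rfl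
  have hh : haltList p.toMachine.tm w' = cfg p none ⟨w', [], [], []⟩ := by
    refine congrArg (TM2.Cfg.mk _ _) (funext fun k => ?_)
    cases k <;> rfl
  -- The additional step is the `halt` statement at the label `none`, to which the compiled program
  -- exits.
  rw [hi, hh, add_comm]
  exact h1.trans (Steps.single rfl)

/-- Without query labels the oracle is never consulted. Hence one compiler serves ordinary machines
and oracle machines. -/
theorem step_of_oracleFree (p : Prog) (h : p.OracleFree) (O : List Bool → List Bool) :
    p.toMachine.step O = p.toMachine.tm.step := by
  funext c
  rcases c with ⟨_ | l, v, S⟩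
  · rfl
  · have : p.toMachine.next l = none := by
      cases l with
      | none => rfl
      | some l => exact queries_eq_none p h _ _ _
    simp only [OracleTM.step, this]

end Prog

/-! ### From programs to polynomial-time machines -/

/-- A polynomial-time program without oracle calls gives a polynomial-time machine. -/
theorem polyTime_of_run {α β : Type} {ea : α → List Bool} {eb : β → List Bool} {f : α → β}
    (p : Prog) (hp : p.OracleFree) (P : Polynomial ℕ)
    (h : ∀ x, ∃ t ≤ P.eval (ea x).length,
      p.Run sharpSAT ⟨ea x, [], [], []⟩ ⟨eb (f x), [], [], []⟩ t) : PolyTime ea eb f := by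
  refine ⟨{ tm := p.toMachine.tm, inputAlphabet := Equiv.refl Bool,
            outputAlphabet := Equiv.refl Bool, time := P + 1, outputsFun := fun x => ?_ }⟩
  choose t ht hr using h
  refine ⟨⟨t x + 1, ?_⟩, ?_⟩
  · have := Prog.steps_of_run p sharpSAT (hr x)
    rw [p.step_of_oracleFree hp] at this
    have h1 : List.map (Equiv.refl Bool).invFun (ea x) = ea x := List.map_id _
    have h2 : List.map (Equiv.refl Bool).invFun (eb (f x)) = eb (f x) := List.map_id _
    exact (congrArg (fun l => (flip bind p.toMachine.tm.step)^[t x + 1]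
      (some (initList p.toMachine.tm l))) h1).trans
      (Eq.trans this (congrArg (fun l => some (haltList p.toMachine.tm l)) h2.symm))
  · simpa using ht x

/-- A polynomial-time program gives a polynomial-time oracle machine. -/
theorem polyTimeWithOracle_of_run {α β : Type} {ea : α → List Bool} {eb : β → List Bool} {f : α → β}
    (p : Prog) (P : Polynomial ℕ)
    (h : ∀ x, ∃ t ≤ P.eval (ea x).length,
      p.Run sharpSAT ⟨ea x, [], [], []⟩ ⟨eb (f x), [], [], []⟩ t) :
    PolyTimeWithOracle sharpSAT ea eb f := by
  refine ⟨p.toMachine, Equiv.refl Bool, Equiv.refl Bool, P + 1, fun x => ?_⟩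
  choose t ht hr using h
  refine ⟨⟨t x + 1, ?_⟩, ?_⟩
  · have := Prog.steps_of_run p sharpSAT (hr x)
    have h1 : List.map (Equiv.refl Bool).symm (ea x) = ea x := List.map_id _
    have h2 : List.map (Equiv.refl Bool).symm (eb (f x)) = eb (f x) := List.map_id _
    exact (congrArg (fun l => (flip bind (p.toMachine.step sharpSAT))^[t x + 1]
      (some (initList p.toMachine.tm l))) h1).trans
      (Eq.trans this (congrArg (fun l => some (haltList p.toMachine.tm l)) h2.symm))
  · simpa using ht x

end ZHCount

namespace ZHCount

/-! ### Binary trees on stacks -/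

/-- Binary trees, the data of the programs below. -/
inductive BTree where
  | nil
  | cons (s t : BTree)

/-- The prefix code of a tree. -/
def BTree.code : BTree → List Bool
  | nil => [false]
  | cons s t => true :: (s.code ++ t.code)

theorem BTree.code_length_pos (t : BTree) : 1 ≤ t.code.length := by
  cases t <;> simp [code]

namespace Prog

variable {O : List Bool → List Bool}

/-- `p` leads from `S` to `S'` in at most `t` steps. -/
def RunLE (O : List Bool → List Bool) (p : Prog) (S S' : Stacks) (t : ℕ) : Prop :=
  ∃ t' ≤ t, Run O p S S' t'

theorem RunLE.mono {p : Prog} {S S' : Stacks} {t t' : ℕ} (h : RunLE O p S S' t) (ht : t ≤ t') :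
    RunLE O p S S' t' := by
  obtain ⟨u, hu, h⟩ := h
  exact ⟨u, hu.trans ht, h⟩

theorem RunLE.seq {p q : Prog} {S S' S'' : Stacks} {t t' : ℕ} (h : RunLE O p S S' t)
    (h' : RunLE O q S' S'' t') : RunLE O (.seq p q) S S'' (t + t') := by
  obtain ⟨u, hu, h⟩ := h
  obtain ⟨u', hu', h'⟩ := h'
  exact ⟨u' + u, by omega, .seq h h'⟩

theorem Run.le {p : Prog} {S S' : Stacks} {t : ℕ} (h : Run O p S S' t) : RunLE O p S S' t :=
  ⟨t, le_rfl, h⟩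

theorem RunLE.push (k : Stk) (v : Bool) (S : Stacks) :
    RunLE O (.push k v) S (S.set k (v :: S.get k)) 1 := Run.push.le

theorem RunLE.skip (S : Stacks) : RunLE O .skip S S 1 := Run.skip.le

theorem RunLE.pop_false {k : Stk} {p q : Prog} {S S' : Stacks} {r : List Bool} {t : ℕ}
    (h : S.get k = false :: r) (hp : RunLE O p (S.set k r) S' t) :
    RunLE O (.pop k p q) S S' (t + 1) := by
  obtain ⟨u, hu, hp⟩ := hp
  exact ⟨u + 1, by omega, .pop_false h hp⟩

theorem RunLE.pop_true {k : Stk} {p q : Prog} {S S' : Stacks} {r : List Bool} {t : ℕ}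
    (h : S.get k = true :: r) (hq : RunLE O q (S.set k r) S' t) :
    RunLE O (.pop k p q) S S' (t + 1) := by
  obtain ⟨u, hu, hq⟩ := hq
  exact ⟨u + 1, by omega, .pop_true h hq⟩

theorem RunLE.loop_true {k : Stk} {e : Bool} {p q : Prog} {S S' S'' : Stacks} {r : List Bool}
    {t t' : ℕ} (h : S.get k = true :: r) (hq : RunLE O q (S.set k r) S' t)
    (hl : RunLE O (.loop k e p q) S' S'' t') : RunLE O (.loop k e p q) S S'' (t' + t + 1) := by
  obtain ⟨u, hu, hq⟩ := hq
  obtain ⟨u', hu', hl⟩ := hl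
  exact ⟨u' + u + 1, by omega, .loop_true h hq hl⟩

theorem RunLE.loop_false {k : Stk} {p q : Prog} {S S' S'' : Stacks} {r : List Bool}
    {t t' : ℕ} (h : S.get k = false :: r) (hq : RunLE O p (S.set k r) S' t)
    (hl : RunLE O (.loop k false p q) S' S'' t') :
    RunLE O (.loop k false p q) S S'' (t' + t + 1) := by
  obtain ⟨u, hu, hq⟩ := hq
  obtain ⟨u', hu', hl⟩ := hl
  exact ⟨u' + u + 1, by omega, .loop_false h hq hl⟩

/-- Stacks with empty auxiliary stacks. -/
def st (w : List Bool) : Stacks := ⟨w, [], [], []⟩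

/-- Move the content of a stack onto another one, reversing it. -/
def pour (k k' : Stk) : Prog := .loop k false (.push k' false) (.push k' true)

theorem run_pour {k k' : Stk} (h : k ≠ k') (S : Stacks) :
    RunLE O (pour k k') S ((S.set k []).set k' ((S.get k).reverse ++ S.get k'))
      (2 * (S.get k).length + 1) := by
  generalize hl : S.get k = l
  induction l generalizing S with
  | nil =>
    have hS : (S.set k []).set k' (List.reverse [] ++ S.get k') = S := by
      obtain ⟨m, a, b, c⟩ := S
      cases k <;> cases k' <;> simp_all [Stacks.get, Stacks.set]
    rw [hS]
    exact (Run.loop_none hl).le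
  | cons v l ih =>
    have := ih ((S.set k l).set k' (v :: (S.set k l).get k'))
      (by cases k <;> cases k' <;> simp_all [Stacks.get, Stacks.set])
    have hS : ((((S.set k l).set k' (v :: (S.set k l).get k')).set k []).set k'
        (l.reverse ++ ((S.set k l).set k' (v :: (S.set k l).get k')).get k')) =
        (S.set k []).set k' ((v :: l).reverse ++ S.get k') := by
      cases k <;> cases k' <;> simp_all [Stacks.get, Stacks.set]
    rw [hS] at this
    cases v
    · exact (RunLE.loop_false hl (RunLE.push _ _ _) this).mono (by simp; omega)
    · exact (RunLE.loop_true hl (RunLE.push _ _ _) this).mono (by simp; omega)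

/-- The loop of `grab`. -/
def grabLoop (k : Stk) : Prog :=
  .loop .c false .skip (.pop .main (.push k false)
    (.seq (.push k true) (.seq (.push .c true) (.push .c true))))

/-- The stack `c` counts in unary the trees still to be read: a leaf settles one of them, and an
inner node replaces one by two. This finds the end of a prefix code without recursion. The statement
takes the remaining run as a hypothesis, so that the two subtrees can be chained in the induction. A
symbol costs at most five steps. -/
theorem run_grabLoop {k : Stk} (hk : k = .a ∨ k = .b) (s : BTree) : ∀ (S S' : Stacks)
    (r x : List Bool) (t : ℕ), S.main = s.code ++ r → S.c = true :: x →
    RunLE O (grabLoop k) { S.set k (s.code.reverse ++ S.get k) with main := r, c := x } S' t →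
    RunLE O (grabLoop k) S S' (t + 5 * s.code.length) := by
  induction s with
  | nil =>
    intro S S' r x t hm hc h
    obtain ⟨m, a, b, c⟩ := S
    dsimp only at hm hc
    subst hm hc
    rcases hk with rfl | rfl
    · exact (RunLE.loop_true (k := .c) (t := 2) rfl (.pop_false (k := .main) rfl (.push _ _ _))
        h).mono (by simp [BTree.code])
    · exact (RunLE.loop_true (k := .c) (t := 2) rfl (.pop_false (k := .main) rfl (.push _ _ _))
        h).mono (by simp [BTree.code])
  | cons s1 s2 ih1 ih2 =>
    intro S S' r x t hm hc h
    obtain ⟨m, a, b, c⟩ := S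
    dsimp only at hm hc
    subst hm hc
    rcases hk with rfl | rfl
    · have h1 := ih1 ⟨s1.code ++ (s2.code ++ r), true :: a, b, true :: true :: x⟩ S'
        (s2.code ++ r) (true :: x) (t + 5 * s2.code.length) rfl rfl
        (ih2 _ S' r x t rfl rfl (by simpa [Stacks.set, Stacks.get, BTree.code] using h))
      refine (RunLE.loop_true (k := .c) (t := 4) rfl (.pop_true (k := .main)
        (r := s1.code ++ (s2.code ++ r)) ?_
        ((RunLE.push _ _ _).seq ((RunLE.push _ _ _).seq (RunLE.push _ _ _)))) h1).mono
        (by simp [BTree.code]; omega)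
      simp [Stacks.get, Stacks.set, BTree.code]
    · have h1 := ih1 ⟨s1.code ++ (s2.code ++ r), a, true :: b, true :: true :: x⟩ S'
        (s2.code ++ r) (true :: x) (t + 5 * s2.code.length) rfl rfl
        (ih2 _ S' r x t rfl rfl (by simpa [Stacks.set, Stacks.get, BTree.code] using h))
      refine (RunLE.loop_true (k := .c) (t := 4) rfl (.pop_true (k := .main)
        (r := s1.code ++ (s2.code ++ r)) ?_
        ((RunLE.push _ _ _).seq ((RunLE.push _ _ _).seq (RunLE.push _ _ _)))) h1).mono
        (by simp [BTree.code]; omega)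
      simp [Stacks.get, Stacks.set, BTree.code]

/-- Move a tree from the main stack to `k`, reversing its code. -/
def grab (k : Stk) : Prog := .seq (.push .c true) (grabLoop k)

theorem run_grab_a (s : BTree) (r a b : List Bool) :
    RunLE O (grab .a) ⟨s.code ++ r, a, b, []⟩ ⟨r, s.code.reverse ++ a, b, []⟩
      (5 * s.code.length + 2) :=
  ((RunLE.push _ _ _).seq (run_grabLoop (.inl rfl) s ⟨s.code ++ r, a, b, [true]⟩ _ r [] 1 rfl rfl
    (Run.loop_none rfl).le)).mono (by omega)

theorem run_grab_b (s : BTree) (r a b : List Bool) :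
    RunLE O (grab .b) ⟨s.code ++ r, a, b, []⟩ ⟨r, a, s.code.reverse ++ b, []⟩
      (5 * s.code.length + 2) :=
  ((RunLE.push _ _ _).seq (run_grabLoop (.inr rfl) s ⟨s.code ++ r, a, b, [true]⟩ _ r [] 1 rfl rfl
    (Run.loop_none rfl).le)).mono (by omega)

theorem run_pour_a_main (m x b c : List Bool) :
    RunLE O (pour .a .main) ⟨m, x.reverse, b, c⟩ ⟨x ++ m, [], b, c⟩ (2 * x.length + 1) := by
  simpa [Stacks.set, Stacks.get] using run_pour (O := O) (k := .a) (k' := .main) (by decide)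
    ⟨m, x.reverse, b, c⟩

theorem run_pour_b_main (m a x c : List Bool) :
    RunLE O (pour .b .main) ⟨m, a, x.reverse, c⟩ ⟨x ++ m, a, [], c⟩ (2 * x.length + 1) := by
  simpa [Stacks.set, Stacks.get] using run_pour (O := O) (k := .b) (k' := .main) (by decide)
    ⟨m, a, x.reverse, c⟩

/-- Exchange the two topmost trees. -/
def swap : Prog := .seq (grab .a) (.seq (grab .b) (.seq (pour .a .main) (pour .b .main)))

theorem run_swap (s t : BTree) (r : List Bool) :
    RunLE O swap (st (s.code ++ (t.code ++ r))) (st (t.code ++ (s.code ++ r)))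
      (7 * (s.code.length + t.code.length) + 6) := by
  refine ((run_grab_a s (t.code ++ r) [] []).seq ((run_grab_b t r _ []).seq (RunLE.seq
    (S' := ⟨s.code ++ r, [], t.code.reverse, []⟩) (t := 2 * s.code.length + 1)
    (t' := 2 * t.code.length + 1) ?_ ?_))).mono (by omega)
  · simpa using run_pour_a_main (O := O) r s.code t.code.reverse []
  · exact run_pour_b_main (s.code ++ r) [] t.code []

/-- Empty the stack `a`. -/
def clear : Prog := .loop .a false .skip .skip

theorem run_clear (l m b c : List Bool) :
    RunLE O clear ⟨m, l, b, c⟩ ⟨m, [], b, c⟩ (2 * l.length + 1) := by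
  induction l with
  | nil => exact (Run.loop_none rfl).le
  | cons v l ih =>
    cases v
    · exact (RunLE.loop_false rfl (RunLE.skip _) ih).mono (by simp; omega)
    · exact (RunLE.loop_true rfl (RunLE.skip _) ih).mono (by simp; omega)

/-- Remove the topmost tree. -/
def drop : Prog := .seq (grab .a) clear

theorem run_drop (s : BTree) (r : List Bool) :
    RunLE O drop (st (s.code ++ r)) (st r) (7 * s.code.length + 3) :=
  ((run_grab_a s r [] []).seq (run_clear _ _ _ _)).mono (by simp; omega)

/-- The loop of `dup`. -/
def dupLoop : Prog := .loop .a false (.seq (.push .main false) (.push .b false))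
  (.seq (.push .main true) (.push .b true))

theorem run_dupLoop (l m b : List Bool) :
    RunLE O dupLoop ⟨m, l, b, []⟩ ⟨l.reverse ++ m, [], l.reverse ++ b, []⟩ (3 * l.length + 1) := by
  induction l generalizing m b with
  | nil => exact (Run.loop_none rfl).le
  | cons v l ih =>
    have := ih (v :: m) (v :: b)
    simp only [List.reverse_cons, List.append_assoc, List.cons_append, List.nil_append]
    cases v
    · exact (RunLE.loop_false rfl ((RunLE.push _ _ _).seq (RunLE.push _ _ _)) this).mono
        (by simp; omega)
    · exact (RunLE.loop_true rfl ((RunLE.push _ _ _).seq (RunLE.push _ _ _)) this).mono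
        (by simp; omega)

/-- Duplicate the topmost tree. -/
def dup : Prog := .seq (grab .a) (.seq dupLoop (.seq (pour .b .a) (pour .a .main)))

theorem run_dup (s : BTree) (r : List Bool) :
    RunLE O dup (st (s.code ++ r)) (st (s.code ++ (s.code ++ r))) (12 * s.code.length + 5) := by
  refine ((run_grab_a s r [] []).seq ((run_dupLoop _ _ _).seq
    (RunLE.seq (t := 2 * s.code.length + 1)
      (S' := ⟨s.code ++ r, s.code.reverse, [], []⟩) ?_
      (run_pour_a_main (s.code ++ r) s.code [] [])))).mono (by simp; omega)
  simpa [Stacks.set, Stacks.get] using run_pour (O := O) (k := .b) (k' := .a) (by decide)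
    ⟨s.code ++ r, [], s.code, []⟩

/-- Push a word onto the main stack. -/
def pushAll : List Bool → Prog
  | [] => .skip
  | v :: l => .seq (pushAll l) (.push .main v)

theorem run_pushAll (l r : List Bool) :
    RunLE O (pushAll l) (st r) (st (l ++ r)) (l.length + 1) := by
  induction l with
  | nil => exact RunLE.skip _
  | cons v l ih => exact (ih.seq (RunLE.push _ _ _)).mono (by simp)

/-- One round of `fold`. -/
def foldStep (p : Prog) : Prog :=
  .seq (grab .a) (.seq (grab .b) (.seq (pour .a .main) (.seq (.push .main true) (.seq (grab .a)
    (.seq (pour .b .main) (.seq (pour .a .main) (.seq p swap)))))))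

/-- The program `p` expects the pair of head and state on top and empty auxiliary stacks. So the
tail is not kept aside while `p` runs but moved beneath the pair, and the final exchange brings it
back on top of the new state. -/
theorem run_foldStep (p : Prog) (h t s s' : BTree) (T : ℕ) (r : List Bool)
    (hp : ∀ r, RunLE O p (st ((BTree.cons h s).code ++ r)) (st (s'.code ++ r)) T) :
    RunLE O (foldStep p) (st (h.code ++ (t.code ++ (s.code ++ r)))) (st (t.code ++ (s'.code ++ r)))
      (T + 14 * (h.code.length + t.code.length + s.code.length + s'.code.length) + 30) := by
  have h3 : RunLE O (pour .a .main) ⟨s.code ++ r, h.code.reverse ++ [], t.code.reverse ++ [], []⟩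
      ⟨h.code ++ (s.code ++ r), [], t.code.reverse, []⟩ (2 * h.code.length + 1) := by
    simpa using run_pour_a_main (O := O) (s.code ++ r) h.code t.code.reverse []
  have h5 := run_grab_a (O := O) (.cons h s) r [] t.code.reverse
  have h6 := run_pour_b_main (O := O) r ((BTree.cons h s).code.reverse ++ []) t.code []
  have h7 := run_pour_a_main (O := O) (t.code ++ r) (BTree.cons h s).code [] []
  rw [List.append_nil] at h5 h6
  refine ((run_grab_a h _ [] []).seq ((run_grab_b t _ _ []).seq (h3.seq
    ((RunLE.push _ _ _).seq (RunLE.seq (t := 5 * (BTree.cons h s).code.length + 2) ?_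
    (h6.seq (h7.seq ((hp (t.code ++ r)).seq (run_swap _ _ _))))))))).mono ?_
  · simpa [Stacks.set, Stacks.get, BTree.code] using h5
  · simp [BTree.code]
    omega

/-- Fold over the list on top of the main stack. -/
def fold (p : Prog) : Prog := .loop .main true .skip (foldStep p)

/-! ### Words as trees -/

/-- A bit as a tree. -/
def bitTree : Bool → BTree
  | false => .nil
  | true => .cons .nil .nil

/-- A word as a tree. -/
def wordTree : List Bool → BTree
  | [] => .nil
  | v :: l => .cons (bitTree v) (wordTree l)

/-- Turn the tree on top of the main stack into a word, reversed, on the stack `a`. -/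
def unpack : Prog := .loop .main true .skip (.pop .main (.push .a false)
  (.pop .main (.pop .main (.push .a true) .skip) .skip))

theorem run_unpack (l r a b c : List Bool) :
    RunLE O unpack ⟨(wordTree l).code ++ r, a, b, c⟩ ⟨r, l.reverse ++ a, b, c⟩
      (5 * l.length + 1) := by
  induction l generalizing a with
  | nil => exact (Run.loop_stop rfl).le
  | cons v l ih =>
    have := ih (v :: a)
    simp only [List.reverse_cons, List.append_assoc, List.cons_append, List.nil_append]
    cases v
    · exact (RunLE.loop_true rfl (.pop_false rfl (RunLE.push _ _ _)) this).mono (by simp; omega)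
    · exact (RunLE.loop_true rfl (.pop_true rfl (.pop_false rfl (.pop_false rfl
        (RunLE.push _ _ _)))) this).mono (by simp; omega)

/-- The loop of `pack`. -/
def packLoop : Prog := .loop .a false (.seq (.push .main false) (.push .main true))
  (.seq (.push .main false) (.seq (.push .main false) (.seq (.push .main true)
    (.push .main true))))

theorem run_packLoop (l l' r b c : List Bool) :
    RunLE O packLoop ⟨(wordTree l').code ++ r, l, b, c⟩
      ⟨(wordTree (l.reverse ++ l')).code ++ r, [], b, c⟩ (5 * l.length + 1) := by
  induction l generalizing l' with
  | nil => exact (Run.loop_none rfl).le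
  | cons v l ih =>
    have := ih (v :: l')
    simp only [List.reverse_cons, List.append_assoc, List.cons_append, List.nil_append]
    cases v
    · exact (RunLE.loop_false rfl ((RunLE.push _ _ _).seq (RunLE.push _ _ _)) this).mono
        (by simp; omega)
    · exact (RunLE.loop_true rfl ((RunLE.push _ _ _).seq ((RunLE.push _ _ _).seq
        ((RunLE.push _ _ _).seq (RunLE.push _ _ _)))) this).mono (by simp; omega)

/-- Turn the word on the stack `a`, reversed, into a tree on the main stack. -/
def pack : Prog := .seq (.push .main false) packLoop

theorem run_pack (l r b c : List Bool) :
    RunLE O pack ⟨r, l.reverse, b, c⟩ ⟨(wordTree l).code ++ r, [], b, c⟩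
      (5 * l.length + 2) := by
  have := run_packLoop (O := O) l.reverse [] r b c
  rw [List.reverse_reverse, List.append_nil] at this
  exact ((RunLE.push _ _ _).seq this).mono (by simp; omega)

/-- Turn the input into a tree. -/
def readInput : Prog := .seq (pour .main .a) pack

theorem run_readInput (w : List Bool) :
    RunLE O readInput (st w) (st (wordTree w).code) (7 * w.length + 3) := by
  have h := run_pour (O := O) (k := .main) (k' := .a) (by decide) (st w)
  have h2 := run_pack (O := O) w [] [] []
  rw [List.append_nil] at h2
  refine (RunLE.seq (S' := ⟨[], w.reverse, [], []⟩) (t := 2 * w.length + 1) ?_ h2).mono (by omega)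
  simpa [st, Stacks.set, Stacks.get] using h

/-- Turn a tree into the output. -/
def writeOutput : Prog := .seq unpack (pour .a .main)

theorem run_writeOutput (w : List Bool) :
    RunLE O writeOutput (st (wordTree w).code) (st w) (7 * w.length + 2) := by
  have h := run_unpack (O := O) w [] [] [] []
  have h2 := run_pour_a_main (O := O) [] w [] []
  simp only [List.append_nil] at h h2
  exact (RunLE.seq h h2).mono (by omega)

/-- Apply the oracle to the word that is coded by the tree on top of the main stack. -/
def callOracle : Prog := .seq unpack (.seq (pour .a .b) (.seq .oracle (.seq (pour .c .a) pack)))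

theorem run_callOracle (w r : List Bool) :
    RunLE O callOracle (st ((wordTree w).code ++ r)) (st ((wordTree (O w)).code ++ r))
      (7 * w.length + 7 * (O w).length + 6) := by
  have h1 := run_unpack (O := O) w r [] [] []
  have h2 := run_pour (O := O) (k := .a) (k' := .b) (by decide) ⟨r, w.reverse ++ [], [], []⟩
  have h4 := run_pour (O := O) (k := .c) (k' := .a) (by decide) ⟨r, [], [], O w⟩
  have h5 := run_pack (O := O) (O w) r [] []
  simp only [Stacks.set, Stacks.get, List.append_nil, List.reverse_reverse,
    List.length_reverse] at h2 h4 h1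
  exact (h1.seq (h2.seq ((Run.oracle (O := O)).le.seq (h4.seq h5)))).mono (by omega)

end Prog

end ZHCount

namespace ZHCount

/-! ### Polynomial-time functions between coded types -/

/-- A type whose elements are represented by trees. -/
class Code (α : Type) where
  enc : α → BTree

/-- The length of the code of `x`. -/
def csize {α : Type} [Code α] (x : α) : ℕ := (Code.enc x).code.length

instance : Code Unit := ⟨fun _ => .nil⟩
instance : Code Bool := ⟨Prog.bitTree⟩
instance {α β : Type} [Code α] [Code β] : Code (α × β) :=
  ⟨fun p => .cons (Code.enc p.1) (Code.enc p.2)⟩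

/-- The tree of a list. -/
def encTreeList {α : Type} [Code α] : List α → BTree
  | [] => .nil
  | x :: l => .cons (Code.enc x) (encTreeList l)

instance {α : Type} [Code α] : Code (List α) := ⟨encTreeList⟩

/-- Natural numbers are represented in unary. -/
def encTreeNat : ℕ → BTree
  | 0 => .nil
  | n + 1 => .cons .nil (encTreeNat n)

instance : Code ℕ := ⟨encTreeNat⟩

section Size

variable {α β : Type} [Code α] [Code β]

theorem csize_pos (x : α) : 1 ≤ csize x := BTree.code_length_pos _

theorem csize_prod (p : α × β) : csize p = csize p.1 + csize p.2 + 1 := by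
  simp [csize, Code.enc, BTree.code]

theorem csize_nil : csize ([] : List α) = 1 := rfl

theorem csize_cons (x : α) (l : List α) : csize (x :: l) = csize x + csize l + 1 := by
  simp [csize, Code.enc, BTree.code, encTreeList]

theorem csize_append (l l' : List α) : csize (l ++ l') + 1 = csize l + csize l' := by
  induction l with
  | nil => simp [csize_nil, add_comm]
  | cons x l ih => simp only [List.cons_append, csize_cons]; omega

theorem csize_reverse (l : List α) : csize l.reverse = csize l := by
  induction l with
  | nil => rfl
  | cons x l ih =>
    have := csize_append l.reverse [x]
    simp only [List.reverse_cons, csize_cons, csize_nil] at this ⊢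
    omega

theorem csize_le_of_prefix {l l' : List α} (h : l <+: l') : csize l ≤ csize l' := by
  obtain ⟨r, rfl⟩ := h
  have := csize_append l r
  have := csize_pos r
  omega

theorem length_lt_csize (l : List α) : 2 * l.length < csize l := by
  induction l with
  | nil => simp [csize_nil]
  | cons x l ih =>
    have := csize_pos x
    simp only [csize_cons, List.length_cons]
    omega

theorem csize_lt_of_mem {x : α} {l : List α} (h : x ∈ l) : csize x < csize l := by
  induction l with
  | nil => simp at h
  | cons y l ih =>
    rw [csize_cons]
    rcases List.mem_cons.1 h with rfl | h
    · omega
    · have := ih h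
      omega

theorem csize_le_of_forall {l : List α} {B : ℕ} (h : ∀ x ∈ l, csize x ≤ B) :
    csize l ≤ l.length * (B + 1) + 1 := by
  induction l with
  | nil => simp [csize_nil]
  | cons x l ih =>
    have h1 := h x (by simp)
    have h2 := ih fun y hy => h y (by simp [hy])
    rw [csize_cons, List.length_cons, Nat.succ_mul]
    omega

theorem csize_nat (n : ℕ) : csize n = 2 * n + 1 := by
  induction n with
  | zero => rfl
  | succ n ih =>
    have : csize (n + 1) = csize n + 2 := by simp [csize, Code.enc, encTreeNat, BTree.code]
    omega

theorem csize_bool_le (v : Bool) : csize v ≤ 3 := by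
  cases v <;> decide

end Size

theorem eval_mono (P : Polynomial ℕ) {m n : ℕ} (h : m ≤ n) : P.eval m ≤ P.eval n := by
  simp only [Polynomial.eval_eq_sum_range]
  exact Finset.sum_le_sum fun i _ => Nat.mul_le_mul_left _ (Nat.pow_le_pow_left h i)

open Prog Polynomial

/-- `f` is computed on codes by a program in polynomial time; if `o` holds, the program may call the
oracle. -/
@[fun_prop]
def PT (o : Bool) {α β : Type} [Code α] [Code β] (f : α → β) : Prop :=
  ∃ p : Prog, (o = false → p.OracleFree) ∧ ∃ P : Polynomial ℕ, ∀ x,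
    csize (f x) ≤ P.eval (csize x) ∧ ∀ r, RunLE sharpSAT p (st ((Code.enc x).code ++ r))
      (st ((Code.enc (f x)).code ++ r)) (P.eval (csize x))

/-! ### Closure properties of polynomial-time functions -/

namespace PT

variable {o : Bool} {α β γ δ : Type} [Code α] [Code β] [Code γ] [Code δ]

theorem intro {f : α → β} (p : Prog) (hp : o = false → p.OracleFree) (P Q : Polynomial ℕ)
    (hP : ∀ x, csize (f x) ≤ P.eval (csize x))
    (hQ : ∀ x r, RunLE sharpSAT p (st ((Code.enc x).code ++ r))
      (st ((Code.enc (f x)).code ++ r)) (Q.eval (csize x))) : PT o f :=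
  ⟨p, hp, P + Q, fun x => ⟨by have := hP x; rw [eval_add]; omega,
    fun r => (hQ x r).mono (by rw [eval_add]; omega)⟩⟩

theorem congr {f g : α → β} (hf : PT o f) (h : ∀ x, g x = f x) : PT o g := by
  rwa [funext h]

/-- A change of type that leaves the tree unchanged needs no computation. -/
theorem of_enc {f : α → β} (h : ∀ x, Code.enc (f x) = Code.enc x) : PT o f := by
  refine intro .skip (fun _ => trivial) X 1 (fun x => ?_) fun x r => ?_
  · simp [csize, h]
  · rw [h, eval_one]
    exact RunLE.skip _

@[fun_prop]
theorem id : PT o (fun x : α => x) := of_enc fun _ => rfl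

@[fun_prop]
-- The running time of the second program is measured in the size of the intermediate result; this
-- is why `PT` includes a bound on the size of the value.
theorem comp {g : β → γ} {f : α → β} (hg : PT o g) (hf : PT o f) : PT o (fun x => g (f x)) := by
  obtain ⟨p, hp, P, hP⟩ := hf
  obtain ⟨q, hq, Q, hQ⟩ := hg
  refine intro (.seq p q) (fun h => ⟨hp h, hq h⟩) (Q.comp P) (P + Q.comp P) (fun x => ?_)
    fun x r => ?_
  · rw [eval_comp]
    exact ((hQ _).1).trans (eval_mono Q (hP x).1)
  · refine (((hP x).2 r).seq ((hQ (f x)).2 r)).mono ?_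
    rw [eval_add, eval_comp]
    exact Nat.add_le_add_left (eval_mono Q (hP x).1) _

@[fun_prop]
theorem const (b : β) : PT o (fun _ : α => b) := by
  have hfree : ∀ l, (pushAll l).OracleFree := by
    intro l
    induction l with
    | nil => trivial
    | cons v l ih => exact ⟨ih, trivial⟩
  refine intro (.seq drop (pushAll (Code.enc b).code)) (fun _ => ⟨by simp [drop, grab, grabLoop,
    clear, OracleFree], hfree _⟩) (C (csize b)) (7 * X + 4 + C (csize b))
    (fun x => ?_) fun x r => ?_
  · simp
  · refine ((run_drop _ r).seq (run_pushAll _ r)).mono ?_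
    simp [csize]
    omega

theorem fst_aux : PT o (fun p : α × β => p.1) := by
  refine intro (.pop .main .skip (.seq swap drop)) (fun _ => by simp [swap, pour, drop, grab,
    grabLoop, clear, OracleFree]) X (14 * X + 12) (fun x => ?_) fun x r => ?_
  · simp [csize_prod]
    omega
  · refine (RunLE.pop_true (r := (Code.enc x.1).code ++ ((Code.enc x.2).code ++ r)) ?_
      ((run_swap _ _ _).seq (run_drop _ _))).mono ?_
    · simp [st, Stacks.get, Code.enc, BTree.code]
    · have := csize_prod x
      simp [csize] at this ⊢
      omega

theorem snd_aux : PT o (fun p : α × β => p.2) := by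
  refine intro (.pop .main .skip drop) (fun _ => by simp [drop, grab,
    grabLoop, clear, OracleFree]) X (7 * X + 4) (fun x => ?_) fun x r => ?_
  · simp [csize_prod]
    omega
  · refine (RunLE.pop_true (r := (Code.enc x.1).code ++ ((Code.enc x.2).code ++ r)) ?_
      (run_drop _ _)).mono ?_
    · simp [st, Stacks.get, Code.enc, BTree.code]
    · have := csize_prod x
      simp [csize] at this ⊢
      omega

@[fun_prop]
theorem fst {f : α → β × γ} (hf : PT o f) : PT o (fun x => (f x).1) := comp fst_aux hf

@[fun_prop]
theorem snd {f : α → β × γ} (hf : PT o f) : PT o (fun x => (f x).2) := comp snd_aux hf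

@[fun_prop]
theorem pair {f : α → β} {g : α → γ} (hf : PT o f) (hg : PT o g) :
    PT o (fun x => (f x, g x)) := by
  obtain ⟨p, hp, P, hP⟩ := hf
  obtain ⟨q, hq, Q, hQ⟩ := hg
  -- Computing `g` first leaves its value beneath that of `f`; the final `true` is the symbol of the
  -- inner node that joins them.
  refine intro (.seq dup (.seq q (.seq swap (.seq p (.push .main true))))) (fun h => ?_) (P + Q + 1)
    (12 * X + 5 + Q + (7 * (X + Q) + 6) + P + 1) (fun x => ?_) fun x r => ?_
  · simp [dup, dupLoop, grab, grabLoop, pour, swap, OracleFree, hp h, hq h]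
  · have h1 := (hP x).1
    have h2 := (hQ x).1
    simp [csize_prod]
    omega
  · have h1 := (hP x).1
    have h2 := (hQ x).1
    refine ((run_dup _ r).seq (((hQ x).2 _).seq ((run_swap _ _ _).seq
      (((hP x).2 _).seq ?_)))).mono (t := 12 * csize x + 5 + (Q.eval (csize x) +
      (7 * (csize (g x) + csize x) + 6 + (P.eval (csize x) + 1)))) ?_
    · simpa [Code.enc, BTree.code, st, Stacks.set, Stacks.get] using RunLE.push .main true
        (st ((Code.enc (f x)).code ++ ((Code.enc (g x)).code ++ r)))
    · simp
      omega

/-- Case distinction on a list. -/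
theorem listCases {l : γ → List α} {f : γ → δ} {g : γ × α × List α → δ} (hl : PT o l) (hf : PT o f)
    (hg : PT o g) : PT o (fun x => match l x with
      | [] => f x
      | h :: t => g (x, h, t)) := by
  -- When the top symbols of the pair and of a nonempty list have been popped, head, tail and `x`
  -- lie on the stack in this order. Two symbols `true` make them a tree of this bracketing.
  have hg' : PT o (fun p : (α × List α) × γ => g (p.2, p.1)) := by fun_prop
  have hl' : PT o (fun x => (l x, x)) := by fun_prop
  obtain ⟨p, hp, P, hP⟩ := hf
  obtain ⟨q, hq, Q, hQ⟩ := hg'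
  obtain ⟨u, hu, U, hU⟩ := hl'
  refine intro (.seq u (.pop .main .skip (.pop .main p (.seq (.push .main true)
    (.seq (.push .main true) q))))) (fun h => ?_) (P + Q.comp U) (U + (P + Q.comp U + 4))
    (fun x => ?_) fun x r => ?_
  · simp [OracleFree, hp h, hq h, hu h]
  · rcases h : l x with _ | ⟨a, t⟩
    · have := (hP x).1
      simp
      omega
    · have := (hQ ((a, t), x)).1
      have h2 := eval_mono Q (hU x).1
      simp only [h] at h2
      simp only [csize_prod, csize_cons, eval_add, eval_comp] at this h2 ⊢
      omega
  · refine (((hU x).2 r).seq (RunLE.pop_true (t := (P + Q.comp U + 3).eval (csize x))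
      (r := (Code.enc (l x)).code ++ ((Code.enc x).code ++ r)) ?_ ?_)).mono ?_
    · simp [st, Stacks.get, Code.enc, BTree.code]
    · rcases h : l x with _ | ⟨a, t⟩
      · exact (RunLE.pop_false rfl ((hP x).2 r)).mono (by simp; omega)
      · have h2 := eval_mono Q (hU x).1
        simp only [h] at h2
        have h3 := (hQ ((a, t), x)).2 r
        refine (RunLE.pop_true (r := (Code.enc a).code ++ ((Code.enc t).code ++
          ((Code.enc x).code ++ r))) ?_ ((RunLE.push _ _ _).seq ((RunLE.push _ _ _).seq
          (t' := Q.eval (csize ((a, t), x))) ?_))).mono ?_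
        · simp [st, Stacks.get, Code.enc, BTree.code, Stacks.set, encTreeList]
        · simpa [st, Stacks.get, Code.enc, BTree.code, Stacks.set] using h3
        · simp only [csize_prod, csize_cons, eval_add, eval_comp] at h2 ⊢
          simp
          omega
    · simp only [eval_add, eval_ofNat]
      omega

/-- The Booleans have the same trees as the lists `[]` and `[()]`, so this is a case distinction on
a list. -/
theorem cond {c : γ → Bool} {f g : γ → δ} (hc : PT o c) (hf : PT o f) (hg : PT o g) :
    PT o (fun x => if c x = true then f x else g x) := by
  have hc' : PT o (fun x => if c x = true then [()] else []) :=
    comp (g := fun v : Bool => if v = true then [()] else [])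
      (of_enc fun v => by cases v <;> rfl) hc
  refine (listCases hc' hg (g := fun p => f p.1) (by fun_prop)).congr fun x => ?_
  rcases h : c x <;> simp

theorem ite {c : γ → Prop} [DecidablePred c] {f g : γ → δ} (hc : PT o fun x => decide (c x))
    (hf : PT o f) (hg : PT o g) : PT o (fun x => if c x then f x else g x) :=
  (cond hc hf hg).congr fun x => by simp

@[fun_prop]
theorem cons {f : γ → α} {l : γ → List α} (hf : PT o f) (hl : PT o l) :
    PT o (fun x => f x :: l x) :=
  comp (g := fun p : α × List α => p.1 :: p.2) (of_enc fun _ => rfl) (pair hf hl)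

/-- The intermediate states are the folds over the prefixes of the list, so `B` bounds each of them.
Head and tail together have size at most `L`, and a round moves these and two states; this gives the
overhead `28 * (L + B) + 31`. -/
theorem run_fold {f : α × β → β} {p : Prog} {P : Polynomial ℕ}
    (hP : ∀ x r, RunLE sharpSAT p (st ((Code.enc x).code ++ r))
      (st ((Code.enc (f x)).code ++ r)) (P.eval (csize x))) (L B : ℕ) (l : List α) (s : β)
    (r : List Bool) (hL : csize l ≤ L)
    (hB : ∀ l', l' <+: l → csize (l'.foldl (fun s a => f (a, s)) s) ≤ B) :
    RunLE sharpSAT (fold p) (st ((Code.enc l).code ++ ((Code.enc s).code ++ r)))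
      (st ((Code.enc (l.foldl (fun s a => f (a, s)) s)).code ++ r))
      (l.length * (P.eval (L + B + 1) + 28 * (L + B) + 31) + 1) := by
  induction l generalizing s with
  | nil => exact (Run.loop_stop rfl).le.mono (by simp)
  | cons a l ih =>
    rw [csize_cons] at hL
    have hs := hB [] (by simp)
    have hs' := hB [a] (by simp)
    simp only [List.foldl_nil, List.foldl_cons] at hs hs'
    have h1 := run_foldStep (O := sharpSAT) p (Code.enc a) (Code.enc l) (Code.enc s)
      (Code.enc (f (a, s))) (P.eval (csize (a, s))) r (fun r => hP (a, s) r)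
    have h2 := ih (f (a, s)) (by omega) fun l' h =>
      hB (a :: l') ((List.prefix_cons_inj a).2 h)
    refine (RunLE.loop_true ?_ h1 h2).mono ?_
    · simp [st, Stacks.get, Code.enc, BTree.code, encTreeList]
    · have h3 : P.eval (csize (a, s)) ≤ P.eval (L + B + 1) :=
        eval_mono P (by simp only [csize_prod]; omega)
      rw [List.length_cons, Nat.succ_mul l.length]
      simp only [csize] at *
      omega

/-- Iteration along a list, if the sizes of all intermediate results are bounded. -/
theorem foldl {l : γ → List α} {i : γ → β} {s : γ → β → α → β} (hl : PT o l) (hi : PT o i)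
    (hs : PT o (fun p : γ × β × α => s p.1 p.2.1 p.2.2)) (Q : Polynomial ℕ)
    (hQ : ∀ x l', l' <+: l x → csize (l'.foldl (s x) (i x)) ≤ Q.eval (csize x)) :
    PT o (fun x => (l x).foldl (s x) (i x)) := by
  have hl' : PT o (fun x => (l x, (x, i x))) := by fun_prop
  -- The program of a round sees only the current entry and the state, so the parameter `x` is
  -- carried along in the state.
  have hs' : PT o (fun p : α × (γ × β) => (p.2.1, s p.2.1 p.2.2 p.1)) :=
    pair (by fun_prop) (comp hs (f := fun p : α × (γ × β) => (p.2.1, p.2.2, p.1)) (by fun_prop))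
  have hfold : ∀ x (l : List α) b, l.foldl (fun (q : γ × β) a => (q.1, s q.1 q.2 a)) (x, b) =
      (x, l.foldl (s x) b) := by
    intro x l
    induction l with
    | nil => exact fun _ => rfl
    | cons a l ih => exact fun b => ih _
  have key : PT o (fun x => (x, (l x).foldl (s x) (i x))) := by
    obtain ⟨u, hu, U, hU⟩ := hl'
    obtain ⟨p, hp, P, hP⟩ := hs'
    refine intro (.seq u (.pop .main .skip (fold p))) (fun h => ?_) (X + Q + 1)
      (U + (U * (P.comp (U + (X + Q + 1) + 1) + 28 * (U + (X + Q + 1)) + 31) + 2))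
      (fun x => ?_) fun x r => ?_
    · simp [OracleFree, hu h, hp h, fold, foldStep, grab, grabLoop, pour, swap]
    · have := hQ x _ (List.prefix_rfl)
      simp [csize_prod]
      omega
    · have hsz := (hU x).1
      simp only [csize_prod] at hsz
      have h1 := run_fold (fun x r => (hP x).2 r) (U.eval (csize x)) ((X + Q + 1).eval (csize x))
        (l x) (x, i x) r (by omega) (fun l' h => by
          have := hQ x l' h
          rw [hfold]
          simp [csize_prod]
          omega)
      rw [hfold] at h1
      refine (((hU x).2 r).seq (RunLE.pop_true ?_ h1)).mono ?_
      · simp [st, Stacks.get, Code.enc, BTree.code]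
      · have h3 : (l x).length ≤ U.eval (csize x) := by
          have := length_lt_csize (l x)
          omega
        have h4 := Nat.mul_le_mul_right (P.eval (U.eval (csize x) + (X + Q + 1).eval (csize x) + 1)
          + 28 * (U.eval (csize x) + (X + Q + 1).eval (csize x)) + 31) h3
        simp only [eval_add, eval_mul, eval_comp, eval_X, eval_one, eval_ofNat] at h4 ⊢
        omega
  exact snd key

end PT

end ZHCount

namespace ZHCount

open Prog Polynomial

namespace PT

variable {o : Bool} {α β γ δ : Type} [Code α] [Code β] [Code γ] [Code δ]

/-- A polynomial-time function has polynomially bounded values. -/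
theorem exists_bound {f : α → β} (hf : PT o f) :
    ∃ P : Polynomial ℕ, ∀ x, csize (f x) ≤ P.eval (csize x) := by
  obtain ⟨_, _, P, hP⟩ := hf
  exact ⟨P, fun x => (hP x).1⟩

/-! ### Booleans -/

@[fun_prop]
theorem comp_bool (g : Bool → β) {f : γ → Bool} (hf : PT o f) : PT o (fun x => g (f x)) :=
  (cond hf (const (g true)) (const (g false))).congr fun x => by cases f x <;> rfl

theorem comp_bool₂ (g : Bool → Bool → β) {f f' : γ → Bool} (hf : PT o f) (hf' : PT o f') :
    PT o (fun x => g (f x) (f' x)) :=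
  (cond hf (comp_bool (g true) hf') (comp_bool (g false) hf')).congr fun x => by
    cases f x <;> rfl

theorem comp_bool₃ (g : Bool → Bool → Bool → β) {f f' f'' : γ → Bool} (hf : PT o f)
    (hf' : PT o f') (hf'' : PT o f'') : PT o (fun x => g (f x) (f' x) (f'' x)) :=
  (cond hf (comp_bool₂ (g true) hf' hf'') (comp_bool₂ (g false) hf' hf'')).congr fun x => by
    cases f x <;> rfl

@[fun_prop]
theorem and {f g : γ → Bool} (hf : PT o f) (hg : PT o g) : PT o (fun x => f x && g x) :=
  comp_bool₂ _ hf hg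

@[fun_prop]
theorem not {f : γ → Bool} (hf : PT o f) : PT o (fun x => !f x) := comp_bool _ hf

/-! ### Lists -/

@[fun_prop]
theorem tail {l : γ → List α} (hl : PT o l) : PT o (fun x => (l x).tail) :=
  (listCases hl (const []) (g := fun p => p.2.2) (by fun_prop)).congr fun x => by
    cases l x <;> rfl

@[fun_prop]
theorem headD {l : γ → List α} {d : γ → α} (hl : PT o l) (hd : PT o d) :
    PT o (fun x => (l x).headD (d x)) :=
  (listCases hl hd (g := fun p => p.2.1) (by fun_prop)).congr fun x => by
    cases l x <;> rfl

@[fun_prop]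
theorem isEmpty {l : γ → List α} (hl : PT o l) : PT o (fun x => (l x).isEmpty) :=
  (listCases hl (const true) (const false)).congr fun x => by
    cases l x <;> rfl

theorem foldl_cons_eq {α : Type} (l l' : List α) :
    l.foldl (fun acc a => a :: acc) l' = l.reverse ++ l' := by
  induction l generalizing l' with
  | nil => rfl
  | cons a l ih => simp [ih]

@[fun_prop]
theorem reverse {l : γ → List α} (hl : PT o l) : PT o (fun x => (l x).reverse) := by
  obtain ⟨P, hP⟩ := hl.exists_bound
  refine (foldl hl (const []) (s := fun _ acc a => a :: acc) (by fun_prop) P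
    fun x l' h => ?_).congr fun x => ?_
  · rw [foldl_cons_eq, List.append_nil, csize_reverse]
    exact (csize_le_of_prefix h).trans (hP x)
  · rw [foldl_cons_eq, List.append_nil]

@[fun_prop]
theorem append {l l' : γ → List α} (hl : PT o l) (hl' : PT o l') :
    PT o (fun x => l x ++ l' x) := by
  obtain ⟨P, hP⟩ := hl.exists_bound
  obtain ⟨P', hP'⟩ := hl'.exists_bound
  refine (foldl (reverse hl) hl' (s := fun _ acc a => a :: acc) (by fun_prop) (P + P')
    fun x r h => ?_).congr fun x => ?_
  · have h1 := csize_le_of_prefix h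
    have h2 := csize_append r.reverse (l' x)
    have h3 := hP x
    have h4 := hP' x
    rw [foldl_cons_eq, eval_add]
    rw [csize_reverse] at h1 h2
    omega
  · rw [foldl_cons_eq, List.reverse_reverse]

theorem map {l : γ → List α} {g : γ → α → β} (hl : PT o l)
    (hg : PT o (fun p : γ × α => g p.1 p.2)) : PT o (fun x => (l x).map (g x)) := by
  obtain ⟨P, hP⟩ := hl.exists_bound
  obtain ⟨Q, hQ⟩ := hg.exists_bound
  have key : ∀ x (l : List α) acc, l.foldl (fun acc a => g x a :: acc) acc =
      (l.map (g x)).reverse ++ acc := by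
    intro x l
    induction l with
    | nil => exact fun _ => rfl
    | cons a l ih => exact fun acc => by simp [ih]
  refine (reverse (foldl hl (const []) (s := fun x acc a => g x a :: acc) ?_
    (P * (Q.comp (X + P + 1) + 1) + 1) fun x l' h => ?_)).congr fun x => ?_
  · exact cons (comp hg (f := fun p : γ × List β × α => (p.1, p.2.2)) (by fun_prop)) (by fun_prop)
  · rw [key, List.append_nil, csize_reverse]
    have h1 : ∀ y ∈ l'.map (g x), csize y ≤ (Q.comp (X + P + 1)).eval (csize x) := by
      intro y hy
      obtain ⟨a, ha, rfl⟩ := List.mem_map.1 hy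
      refine (hQ (x, a)).trans ?_
      rw [eval_comp]
      refine eval_mono Q ?_
      have := csize_lt_of_mem (h.subset ha)
      have := hP x
      simp only [csize_prod, eval_add, eval_X, eval_one]
      omega
    refine (csize_le_of_forall h1).trans ?_
    have h2 : l'.length ≤ P.eval (csize x) := by
      have := h.length_le
      have := length_lt_csize (l x)
      have := hP x
      omega
    simp only [List.length_map, eval_add, eval_mul, eval_one]
    exact Nat.add_le_add_right (Nat.mul_le_mul_right _ h2) 1
  · rw [key, List.append_nil, List.reverse_reverse]

theorem csize_flatten_le (l : List (List α)) : csize l.flatten ≤ csize l := by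
  induction l with
  | nil => simp [csize_nil]
  | cons a l ih =>
    have := csize_append a l.flatten
    rw [List.flatten_cons, csize_cons]
    omega

@[fun_prop]
theorem flatten {l : γ → List (List α)} (hl : PT o l) : PT o (fun x => (l x).flatten) := by
  obtain ⟨P, hP⟩ := hl.exists_bound
  have key : ∀ (l : List (List α)) acc, l.foldl (fun acc a => a.reverse ++ acc) acc =
      l.flatten.reverse ++ acc := by
    intro l
    induction l with
    | nil => exact fun _ => rfl
    | cons a l ih => exact fun acc => by simp [ih]
  refine (reverse (foldl hl (const []) (s := fun _ acc a => a.reverse ++ acc) (by fun_prop)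
    P fun x l' h => ?_)).congr fun x => ?_
  · rw [key, List.append_nil, csize_reverse]
    exact (csize_flatten_le l').trans ((csize_le_of_prefix h).trans (hP x))
  · rw [key, List.append_nil, List.reverse_reverse]

theorem flatMap {l : γ → List α} {g : γ → α → List β} (hl : PT o l)
    (hg : PT o (fun p : γ × α => g p.1 p.2)) : PT o (fun x => (l x).flatMap (g x)) :=
  (flatten (map hl hg)).congr fun _ => List.flatMap_def ..

theorem filter {l : γ → List α} {g : γ → α → Bool} (hl : PT o l)
    (hg : PT o (fun p : γ × α => g p.1 p.2)) : PT o (fun x => (l x).filter (g x)) := by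
  refine (flatMap hl (g := fun x a => if g x a = true then [a] else [])
    (cond hg (by fun_prop) (by fun_prop))).congr fun x => ?_
  induction l x with
  | nil => rfl
  | cons a l ih =>
    rw [List.filter_cons, List.flatMap_cons, ← ih]
    cases g x a <;> rfl

/-! ### Natural numbers in unary -/

theorem enc_replicate (n : ℕ) : Code.enc (List.replicate n ()) = Code.enc n := by
  induction n with
  | zero => rfl
  | succ n ih => exact congrArg (BTree.cons .nil) ih

@[fun_prop]
theorem replicate_unit {n : γ → ℕ} (hn : PT o n) : PT o (fun x => List.replicate (n x) ()) :=
  comp (g := fun n : ℕ => List.replicate n ()) (of_enc enc_replicate) hn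

@[fun_prop]
theorem length {l : γ → List α} (hl : PT o l) : PT o (fun x => (l x).length) := by
  have h := map (g := fun _ _ => ()) hl (const ())
  refine (comp (g := fun l : List Unit => l.length) (of_enc fun l => ?_) h).congr fun x => by simp
  rw [← enc_replicate]
  congr 1
  exact (List.eq_replicate_iff.2 ⟨rfl, fun _ _ => rfl⟩).symm

@[fun_prop]
theorem add {m n : γ → ℕ} (hm : PT o m) (hn : PT o n) : PT o (fun x => m x + n x) :=
  (length (append (replicate_unit hm) (replicate_unit hn))).congr fun x => by simp

theorem repeatD {a : γ → α} {n : γ → ℕ} (hn : PT o n) (ha : PT o a) :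
    PT o (fun x => List.replicate (n x) (a x)) :=
  (map (replicate_unit hn) (g := fun x _ => a x) (by fun_prop)).congr fun _ => by simp

@[fun_prop]
theorem sub {m n : γ → ℕ} (hm : PT o m) (hn : PT o n) : PT o (fun x => m x - n x) := by
  obtain ⟨P, hP⟩ := hm.exists_bound
  have key : ∀ (l : List Unit) k, l.foldl (fun k _ => k - 1) k = k - l.length := by
    intro l
    induction l with
    | nil => exact fun _ => rfl
    | cons a l ih => exact fun k => by rw [List.foldl_cons, ih, List.length_cons]; omega
  have hpred : PT o (fun n : ℕ => n - 1) :=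
    (length (tail (replicate_unit id))).congr fun x => by simp
  refine (foldl (replicate_unit hn) hm (s := fun _ k _ => k - 1)
    (comp hpred (by fun_prop)) P fun x l' h => ?_).congr fun x => ?_
  · have := hP x
    simp only [csize_nat, key] at this ⊢
    omega
  · simp [key]

theorem decide_eq_zero {n : γ → ℕ} (hn : PT o n) : PT o (fun x => decide (n x = 0)) :=
  (isEmpty (replicate_unit hn)).congr fun x => by cases n x <;> simp [List.replicate_succ]

theorem decide_eq {m n : γ → ℕ} (hm : PT o m) (hn : PT o n) :
    PT o (fun x => decide (m x = n x)) :=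
  -- With truncated subtraction, two numbers are equal exactly if both differences vanish.
  (decide_eq_zero (add (sub hm hn) (sub hn hm))).congr fun x => by
    congr 1
    exact propext (by omega)

/-- Number the entries of a list. -/
@[fun_prop]
theorem zipIdx {l : γ → List α} {n : γ → ℕ} (hl : PT o l) (hn : PT o n) :
    PT o (fun x => (l x).zipIdx (n x)) := by
  obtain ⟨P, hP⟩ := hl.exists_bound
  obtain ⟨Q, hQ⟩ := hn.exists_bound
  have key : ∀ (l : List α) (acc : List (α × ℕ)) n, l.foldl (fun (s : ℕ × List (α × ℕ)) a =>
      (s.1 + 1, (a, s.1) :: s.2)) (n, acc) = (n + l.length, (l.zipIdx n).reverse ++ acc) := by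
    intro l
    induction l with
    | nil => exact fun _ _ => rfl
    | cons a l ih =>
      intro acc n
      simp [ih, List.zipIdx_cons]
      omega
  refine (reverse (snd (foldl hl (pair hn (const ([] : List (α × ℕ))))
    (s := fun _ (s : ℕ × List (α × ℕ)) a => (s.1 + 1, (a, s.1) :: s.2)) (by fun_prop)
    (2 * (Q + P) + 1 + (P * (P + 2 * (Q + P) + 1 + 1 + 1) + 1) + 1)
    fun x l' h => ?_))).congr fun x => ?_
  · have h1 := csize_le_of_prefix h
    have h2 := hP x
    have h3 := hQ x
    have h4 := length_lt_csize l'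
    rw [csize_nat] at h3
    rw [key, List.append_nil, csize_prod, csize_reverse, csize_nat]
    have h5 : ∀ y ∈ l'.zipIdx (n x), csize y ≤ (P + 2 * (Q + P) + 1 + 1).eval (csize x) := by
      rintro ⟨a, k⟩ hy
      have h6 := csize_lt_of_mem (List.fst_mem_of_mem_zipIdx hy)
      have h7 := List.snd_lt_add_of_mem_zipIdx hy
      simp only at h6 h7
      simp only [csize_prod, csize_nat, eval_add, eval_mul, eval_one, eval_ofNat]
      omega
    have h6 := csize_le_of_forall h5
    have h7 : l'.length ≤ P.eval (csize x) := by omega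
    have h8 := Nat.mul_le_mul_right ((P + 2 * (Q + P) + 1 + 1).eval (csize x) + 1) h7
    simp only [List.length_zipIdx, eval_add, eval_mul, eval_one, eval_ofNat] at h6 h8 ⊢
    omega
  · rw [key]
    simp

@[fun_prop]
theorem range {n : γ → ℕ} (hn : PT o n) : PT o (fun x => List.range (n x)) :=
  (map (zipIdx (replicate_unit hn) (const 0)) (g := fun _ (p : Unit × ℕ) => p.2)
    (by fun_prop)).congr fun x => by
      rw [show (fun p : Unit × ℕ => p.2) = Prod.snd from rfl, List.zipIdx_map_snd,
        List.length_replicate, List.range_eq_range']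

end PT

/-! ### Words -/

theorem enc_word (w : List Bool) : Code.enc w = wordTree w := by
  induction w with
  | nil => rfl
  | cons v w ih => exact congrArg (BTree.cons (bitTree v)) ih

theorem csize_word_le (w : List Bool) : csize w ≤ 4 * w.length + 1 := by
  have := csize_le_of_forall (l := w) (B := 3) fun v _ => csize_bool_le v
  omega

/-- The bridge from trees to machine inputs: the word is turned into a tree, `g` is applied, and the
result is written back. Only the values of `g` on codes matter, so parsers may return anything on
malformed words. -/
theorem PT.exists_word_program {o : Bool} {α β : Type} {ea : α → List Bool} {eb : β → List Bool}
    {f : α → β} {g : List Bool → List Bool} (hg : PT o g) (h : ∀ x, g (ea x) = eb (f x)) :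
    ∃ p : Prog, (o = false → p.OracleFree) ∧ ∃ P : Polynomial ℕ,
      ∀ x, ∃ t ≤ P.eval (ea x).length,
      p.Run sharpSAT ⟨ea x, [], [], []⟩ ⟨eb (f x), [], [], []⟩ t := by
  obtain ⟨p, hp, P, hP⟩ := hg
  refine ⟨.seq readInput (.seq p writeOutput), fun h => ?_, 7 * X + 3 + (P.comp (4 * X + 1) +
    (7 * P.comp (4 * X + 1) + 2)), fun x => ?_⟩
  · simp [OracleFree, hp h, readInput, writeOutput, pour, pack, packLoop, unpack]
  · have h1 := eval_mono P (csize_word_le (ea x))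
    have h2 := (hP (ea x)).2 []
    have h3 := (hP (ea x)).1
    rw [h] at h2 h3
    have h4 := length_lt_csize (eb (f x))
    simp only [enc_word, List.append_nil] at h2
    refine ((run_readInput (ea x)).seq (h2.seq (run_writeOutput (eb (f x))))).mono ?_
    simp only [eval_add, eval_mul, eval_comp, eval_X, eval_ofNat, eval_one]
    omega

theorem PT.polyTime {α β : Type} {ea : α → List Bool} {eb : β → List Bool} {f : α → β}
    {g : List Bool → List Bool} (hg : PT false g) (h : ∀ x, g (ea x) = eb (f x)) :
    PolyTime ea eb f := by
  obtain ⟨p, hp, P, hP⟩ := hg.exists_word_program h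
  exact polyTime_of_run p (hp rfl) P hP

theorem PT.polyTimeWithOracle {o : Bool} {α β : Type} {ea : α → List Bool} {eb : β → List Bool}
    {f : α → β} {g : List Bool → List Bool} (hg : PT o g) (h : ∀ x, g (ea x) = eb (f x)) :
    PolyTimeWithOracle sharpSAT ea eb f := by
  obtain ⟨p, _, P, hP⟩ := hg.exists_word_program h
  exact polyTimeWithOracle_of_run p P hP

theorem CNF.count_le (φ : CNF) : φ.count ≤ 2 ^ φ.numVars := by
  refine (Finset.card_le_univ _).trans ?_
  simp

/-- There are at most `2 ^ n` satisfying assignments for `n` variables, and `n` is written in unary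
at the beginning of the query. Hence an answer is never longer than its query, which keeps oracle
calls polynomially bounded. -/
theorem length_sharpSAT_le (w : List Bool) : (sharpSAT w).length ≤ w.length := by
  rw [sharpSAT]
  split
  · next h =>
    have h1 := h.choose_spec
    set φ := h.choose
    have h2 : φ.numVars + 1 ≤ w.length := by
      rw [← h1]
      simp [CNF.encode, encUnary]
    rw [Nat.size_eq_bits_len, Nat.size_le]
    exact φ.count_le.trans_lt (Nat.pow_lt_pow_right (by norm_num) (by omega))
  · simp

theorem PT.sharpSAT : PT true sharpSAT := by
  refine PT.intro callOracle (fun h => by simp at h) (4 * X + 1) (14 * X + 6)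
    (fun w => ?_) fun w r => ?_
  · have h1 := csize_word_le (ZHCount.sharpSAT w)
    have h2 := length_sharpSAT_le w
    have h3 := length_lt_csize w
    simp
    omega
  · rw [enc_word, enc_word]
    refine (run_callOracle w r).mono ?_
    have h2 := length_sharpSAT_le w
    have h3 := length_lt_csize w
    simp
    omega

end ZHCount

namespace ZHCount

open Prog Polynomial

/-! ### Binary arithmetic -/

/-- The number with given binary digits, least significant digit first. -/
def ofBits : List Bool → ℕ
  | [] => 0
  | b :: l => 2 * ofBits l + b.toNat

theorem ofBits_bits (n : ℕ) : ofBits n.bits = n := by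
  induction n using Nat.binaryRec' with
  | zero => simp [ofBits]
  | bit b n hn ih => rw [Nat.bits_append_bit n b hn, ofBits, ih, Nat.bit_val]

theorem ofBits_lt (l : List Bool) : ofBits l < 2 ^ l.length := by
  induction l with
  | nil => simp [ofBits]
  | cons b l ih =>
    have := b.toNat_le
    rw [ofBits, List.length_cons, pow_succ]
    omega

theorem ofBits_append (l m : List Bool) : ofBits (l ++ m) = ofBits l + 2 ^ l.length * ofBits m := by
  induction l with
  | nil => simp [ofBits]
  | cons b l ih =>
    simp only [List.cons_append, ofBits, ih, List.length_cons, pow_succ]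
    ring

/-- Natural numbers in binary. -/
@[ext]
structure Bin where
  val : ℕ

instance : Code Bin := ⟨fun n => Code.enc n.val.bits⟩
instance : Add Bin := ⟨fun m n => ⟨m.val + n.val⟩⟩
instance : Sub Bin := ⟨fun m n => ⟨m.val - n.val⟩⟩
instance : Mul Bin := ⟨fun m n => ⟨m.val * n.val⟩⟩

theorem Bin.val_add (m n : Bin) : (m + n).val = m.val + n.val := rfl
theorem Bin.val_sub (m n : Bin) : (m - n).val = m.val - n.val := rfl
theorem Bin.val_mul (m n : Bin) : (m * n).val = m.val * n.val := rfl

theorem csize_bin_le (n : Bin) : csize n ≤ 4 * n.val.size + 1 := by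
  rw [← Nat.size_eq_bits_len]
  exact csize_word_le _

theorem size_lt_csize_bin (n : Bin) : 2 * n.val.size < csize n := by
  rw [← Nat.size_eq_bits_len]
  exact length_lt_csize n.val.bits

theorem csize_bin_le_of_lt {n : Bin} {k : ℕ} (h : n.val < 2 ^ k) : csize n ≤ 4 * k + 1 := by
  have h1 := csize_bin_le n
  have h2 := Nat.size_le.2 h
  omega

/-- Run an automaton with one bit of memory over two binary numbers in parallel. -/
def transduce (d : Bool → Bool → Bool → Bool × Bool) : Bool → List (Bool × Bool) → Bool × List Bool
  | c, [] => (c, [])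
  | c, p :: l =>
    ((transduce d (d c p.1 p.2).1 l).1, (d c p.1 p.2).2 :: (transduce d (d c p.1 p.2).1 l).2)

theorem length_transduce (d : Bool → Bool → Bool → Bool × Bool)
    (c : Bool) (l : List (Bool × Bool)) :
    (transduce d c l).2.length = l.length := by
  induction l generalizing c with
  | nil => rfl
  | cons p l ih => simp [transduce, ih]

/-- Pair the digits of two binary numbers, filling up with zeros. -/
def zipBits : List Bool → List Bool → List (Bool × Bool)
  | [], _ => []
  | x :: l, m => (x, m.headD false) :: zipBits l m.tail

theorem zipBits_fst (l m : List Bool) : (zipBits l m).map Prod.fst = l := by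
  induction l generalizing m with
  | nil => rfl
  | cons x l ih => simp [zipBits, ih]

theorem zipBits_snd (l m : List Bool) (h : m.length ≤ l.length) :
    ofBits ((zipBits l m).map Prod.snd) = ofBits m := by
  induction l generalizing m with
  | nil =>
    have : m = [] := by simpa using h
    rw [this]
    rfl
  | cons x l ih =>
    have := ih m.tail (by simp at h ⊢; omega)
    cases m with
    | nil => simp_all [zipBits, ofBits]
    | cons y m => simp_all [zipBits, ofBits]

/-- The digits of two numbers in parallel. -/
def binPairs (m n : Bin) : List (Bool × Bool) :=
  zipBits (m.val.bits ++ n.val.bits.map fun _ => false) n.val.bits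

theorem binPairs_fst (m n : Bin) : ofBits ((binPairs m n).map Prod.fst) = m.val := by
  have h : ∀ l : List Bool, ofBits (l.map fun _ => false) = 0 := by
    intro l
    induction l with
    | nil => rfl
    | cons _ l ih => simp_all [ofBits]
  rw [binPairs, zipBits_fst, ofBits_append, h, ofBits_bits, mul_zero, add_zero]

/-- The zeros appended to the digits of `m` make the first word long enough that no digit of `n` is
lost. -/
theorem binPairs_snd (m n : Bin) : ofBits ((binPairs m n).map Prod.snd) = n.val := by
  rw [binPairs, zipBits_snd _ _ (by simp), ofBits_bits]

/-- A full adder. -/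
def adder (c x y : Bool) : Bool × Bool := ((x && y) || (c && (x ^^ y)), c ^^ x ^^ y)

/-- A full subtractor. -/
def subtractor (c x y : Bool) : Bool × Bool := ((!x && (y || c)) || (y && c), c ^^ x ^^ y)

/-- The identity `h2` of a single full adder, weighted by powers of two, telescopes: each outgoing
carry is the incoming one of the next digit. -/
theorem transduce_adder (c : Bool) (l : List (Bool × Bool)) :
    ofBits (transduce adder c l).2 + 2 ^ l.length * (transduce adder c l).1.toNat =
      ofBits (l.map Prod.fst) + ofBits (l.map Prod.snd) + c.toNat := by
  induction l generalizing c with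
  | nil => simp [transduce, ofBits]
  | cons p l ih =>
    have := ih (adder c p.1 p.2).1
    obtain ⟨x, y⟩ := p
    simp only [transduce, ofBits, List.length_cons, List.map_cons, pow_succ] at this ⊢
    have h2 : 2 * (adder c x y).1.toNat + (adder c x y).2.toNat = c.toNat + x.toNat + y.toNat := by
      cases c <;> cases x <;> cases y <;> rfl
    linarith

/-- The same telescoping for borrows. Starting without a borrow, the final borrow is set exactly if
the first number is smaller. -/
theorem transduce_subtractor (c : Bool) (l : List (Bool × Bool)) :
    ofBits (transduce subtractor c l).2 + ofBits (l.map Prod.snd) + c.toNat =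
      ofBits (l.map Prod.fst) + 2 ^ l.length * (transduce subtractor c l).1.toNat := by
  induction l generalizing c with
  | nil => simp [transduce, ofBits]
  | cons p l ih =>
    have := ih (subtractor c p.1 p.2).1
    obtain ⟨x, y⟩ := p
    simp only [transduce, ofBits, List.length_cons, List.map_cons, pow_succ] at this ⊢
    have h2 : (subtractor c x y).2.toNat + y.toNat + c.toNat =
        x.toNat + 2 * (subtractor c x y).1.toNat := by
      cases c <;> cases x <;> cases y <;> rfl
    linarith

namespace PT

variable {o : Bool} {α β γ δ : Type} [Code α] [Code β] [Code γ] [Code δ]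

theorem recode {f : γ → α} {g : γ → β} (hf : PT o f) (h : ∀ x, Code.enc (g x) = Code.enc (f x)) :
    PT o g := by
  obtain ⟨p, hp, P, hP⟩ := hf
  refine ⟨p, hp, P, fun x => ?_⟩
  have := hP x
  simp only [csize, ← h] at this
  exact this

@[fun_prop]
theorem bits {f : γ → Bin} (hf : PT o f) : PT o (fun x => (f x).val.bits) :=
  comp (g := fun n : Bin => n.val.bits) (of_enc fun _ => rfl) hf

/-- The digits given by `Nat.bits` have no leading zeros, so a zero in front of the empty word must
be suppressed. Folding this rule over a word normalises it. -/
theorem bits_two_mul_add (n : ℕ) (b : Bool) : (2 * n + b.toNat).bits =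
    if n.bits.isEmpty && !b then [] else b :: n.bits := by
  cases b
  · by_cases hn : n = 0
    · simp [hn]
    · have h : n.bits ≠ [] := fun h => hn (by rw [← ofBits_bits n, h]; rfl)
      simp [Nat.bit0_bits n hn, h]
  · simp [Nat.bit1_bits]

@[fun_prop]
theorem ofBits {l : γ → List Bool} (hl : PT o l) : PT o (fun x => Bin.mk (ofBits (l x))) := by
  obtain ⟨P, hP⟩ := hl.exists_bound
  have key : ∀ l : List Bool, l.foldr (fun b acc => if acc.isEmpty && !b then [] else b :: acc) [] =
      (ZHCount.ofBits l).bits := by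
    intro l
    induction l with
    | nil => simp [ZHCount.ofBits]
    | cons b l ih => rw [List.foldr_cons, ih, ZHCount.ofBits, bits_two_mul_add]
  have hlen : ∀ l : List Bool, (ZHCount.ofBits l).bits.length ≤ l.length := fun l => by
    rw [Nat.size_eq_bits_len]
    exact Nat.size_le.2 (ofBits_lt l)
  have h : PT o (fun x => (ZHCount.ofBits (l x)).bits) := by
    refine (foldl (reverse hl) (const [])
      (s := fun _ acc b => if acc.isEmpty && !b then [] else b :: acc)
      (cond (by fun_prop) (by fun_prop) (by fun_prop)) (4 * P + 1) fun x l' h => ?_).congr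
      fun x => ?_
    · have h1 := key l'.reverse
      rw [List.foldr_reverse] at h1
      have h2 := hlen l'.reverse
      have h3 := csize_word_le (ZHCount.ofBits l'.reverse).bits
      have h4 := h.length_le
      have h5 := length_lt_csize (l x)
      have h6 := hP x
      rw [← h1] at h2 h3
      simp only [List.length_reverse] at h2 h4
      simp only [eval_add, eval_mul, eval_one, eval_ofNat]
      refine h3.trans ?_
      omega
    · have h1 := key (l x)
      rw [← h1, List.foldl_reverse]
  exact recode h fun _ => rfl

@[fun_prop]
theorem zipBits {l m : γ → List Bool} (hl : PT o l) (hm : PT o m) :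
    PT o (fun x => zipBits (l x) (m x)) := by
  obtain ⟨P, hP⟩ := hl.exists_bound
  obtain ⟨Q, hQ⟩ := hm.exists_bound
  have key : ∀ (l m : List Bool) acc, l.foldl
      (fun (s : List Bool × List (Bool × Bool)) b => (s.1.tail, (b, s.1.headD false) :: s.2))
      (m, acc) = (m.drop l.length, (ZHCount.zipBits l m).reverse ++ acc) := by
    intro l
    induction l with
    | nil => exact fun _ _ => rfl
    | cons b l ih =>
      intro m acc
      rw [List.foldl_cons, ih]
      simp [ZHCount.zipBits]
  have hlen : ∀ l m, (ZHCount.zipBits l m).length = l.length := fun l => by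
    induction l with
    | nil => exact fun _ => rfl
    | cons b l ih => exact fun m => by simp [ZHCount.zipBits, ih]
  refine (reverse (snd (foldl hl (pair hm (const ([] : List (Bool × Bool))))
    (s := fun _ s b => (s.1.tail, (b, s.1.headD false) :: s.2)) (by fun_prop)
    (4 * Q + 1 + (P * 8 + 1) + 1) fun x l' h => ?_))).congr fun x => ?_
  · rw [key, List.append_nil, csize_prod, csize_reverse]
    have h1 := csize_word_le ((m x).drop l'.length)
    have h2 := csize_le_of_forall (l := ZHCount.zipBits l' (m x)) (B := 7) fun p _ => by
      have h1 := csize_bool_le p.1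
      have h2 := csize_bool_le p.2
      rw [csize_prod]
      omega
    have h3 := length_lt_csize (m x)
    have h4 := hP x
    have h5 := hQ x
    have h6 := length_lt_csize (l x)
    have h7 := h.length_le
    simp only [hlen, List.length_drop, eval_add, eval_mul, eval_one, eval_ofNat] at *
    omega
  · rw [key, List.append_nil, List.reverse_reverse]

@[fun_prop]
theorem transduce (d : Bool → Bool → Bool → Bool × Bool) (c : Bool) {l : γ → List (Bool × Bool)}
    (hl : PT o l) : PT o (fun x => transduce d c (l x)) := by
  obtain ⟨P, hP⟩ := hl.exists_bound
  have key : ∀ (l : List (Bool × Bool)) c acc, l.foldl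
      (fun (s : Bool × List Bool) p => ((d s.1 p.1 p.2).1, (d s.1 p.1 p.2).2 :: s.2)) (c, acc) =
      ((ZHCount.transduce d c l).1, (ZHCount.transduce d c l).2.reverse ++ acc) := by
    intro l
    induction l with
    | nil => exact fun _ _ => rfl
    | cons p l ih =>
      intro c acc
      rw [List.foldl_cons, ih]
      simp [ZHCount.transduce]
  have h := foldl hl (const (c, ([] : List Bool)))
    (s := fun _ s p => ((d s.1 p.1 p.2).1, (d s.1 p.1 p.2).2 :: s.2))
    (pair (comp_bool₃ (fun c x y => (d c x y).1) (by fun_prop) (by fun_prop) (by fun_prop))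
      (cons (comp_bool₃ (fun c x y => (d c x y).2) (by fun_prop) (by fun_prop) (by fun_prop))
        (by fun_prop))) (4 * P + 5) fun x l' h => by
      rw [key, List.append_nil, csize_prod, csize_reverse]
      have h1 := csize_word_le (ZHCount.transduce d c l').2
      have h2 := csize_bool_le (ZHCount.transduce d c l').1
      have h3 := length_transduce d c l'
      have h4 := hP x
      have h5 := length_lt_csize (l x)
      have h6 := h.length_le
      simp only [eval_add, eval_mul, eval_ofNat]
      omega
  exact (pair (fst h) (reverse (snd h))).congr fun x => by simp [key]

@[fun_prop]
theorem binPairs {m n : γ → Bin} (hm : PT o m) (hn : PT o n) :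
    PT o (fun x => binPairs (m x) (n x)) :=
  zipBits (append (bits hm) (map (g := fun _ _ => false) (bits hn) (const _))) (bits hn)

@[fun_prop]
theorem bin_add {m n : γ → Bin} (hm : PT o m) (hn : PT o n) : PT o (fun x => m x + n x) := by
  refine (ofBits (l := fun x => (ZHCount.transduce adder false (ZHCount.binPairs (m x) (n x))).2 ++
    [(ZHCount.transduce adder false (ZHCount.binPairs (m x) (n x))).1]) (by fun_prop)).congr
    fun x => ?_
  have h := transduce_adder false (ZHCount.binPairs (m x) (n x))
  rw [binPairs_fst, binPairs_snd] at h
  ext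
  rw [ofBits_append, length_transduce, Bin.val_add]
  simp only [ZHCount.ofBits] at h ⊢
  simpa using h.symm

@[fun_prop]
theorem bin_sub {m n : γ → Bin} (hm : PT o m) (hn : PT o n) : PT o (fun x => m x - n x) := by
  -- A final borrow means `m < n`, in which case the truncated difference is `0`.
  refine (ofBits (l := fun x =>
    if (ZHCount.transduce subtractor false (ZHCount.binPairs (m x) (n x))).1 = true then []
      else (ZHCount.transduce subtractor false (ZHCount.binPairs (m x) (n x))).2)
    (cond (by fun_prop) (by fun_prop) (by fun_prop))).congr fun x => ?_
  have h := transduce_subtractor false (ZHCount.binPairs (m x) (n x))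
  have h2 := ofBits_lt (ZHCount.transduce subtractor false (ZHCount.binPairs (m x) (n x))).2
  rw [binPairs_fst, binPairs_snd] at h
  rw [length_transduce] at h2
  ext
  rw [Bin.val_sub]
  rcases hc : (ZHCount.transduce subtractor false (ZHCount.binPairs (m x) (n x))).1
  · simp [hc] at h ⊢
    omega
  · simp [hc, ZHCount.ofBits] at h ⊢
    omega

theorem bin_decide_eq_zero {m : γ → Bin} (hm : PT o m) : PT o (fun x => decide ((m x).val = 0)) :=
  (isEmpty (bits hm)).congr fun x => by
    rcases h : (m x).val.bits with _ | ⟨b, l⟩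
    · have := ofBits_bits (m x).val
      rw [h] at this
      simp [← this, ZHCount.ofBits]
    · have : (m x).val ≠ 0 := fun h0 => by simp [h0] at h
      simp [this]

theorem bin_decide_lt {m n : γ → Bin} (hm : PT o m) (hn : PT o n) :
    PT o (fun x => decide ((m x).val < (n x).val)) :=
  (not (bin_decide_eq_zero (bin_sub hn hm))).congr fun x => by
    rw [Bin.val_sub, ← decide_not]
    congr 1
    exact propext (by omega)

@[fun_prop]
theorem bin_mul {m n : γ → Bin} (hm : PT o m) (hn : PT o n) : PT o (fun x => m x * n x) := by
  obtain ⟨P, hP⟩ := hm.exists_bound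
  obtain ⟨Q, hQ⟩ := hn.exists_bound
  -- Horner's scheme on the digits of the first factor: double, and add the second factor if the
  -- digit is `1`. Partial results have at most as many digits as both factors together, so the
  -- iteration stays polynomial.
  have key : ∀ (n : Bin) (l : List Bool), l.foldr
      (fun b acc => if b = true then acc + acc + n else acc + acc) ⟨0⟩ =
      (⟨ZHCount.ofBits l * n.val⟩ : Bin) := by
    intro n l
    induction l with
    | nil => simp [ZHCount.ofBits]
    | cons b l ih =>
      rw [List.foldr_cons, ih]
      ext
      cases b <;> simp [ZHCount.ofBits, Bin.val_add] <;> ring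
  refine (foldl (reverse (bits hm)) (const (⟨0⟩ : Bin))
    (s := fun x acc b => if b = true then acc + acc + n x else acc + acc)
    (cond (by fun_prop) (bin_add (by fun_prop) (comp hn (by fun_prop))) (by fun_prop))
    (4 * (P + Q) + 1) fun x l' h => ?_).congr fun x => ?_
  · have h1 := key (n x) l'.reverse
    rw [List.foldr_reverse] at h1
    rw [h1]
    have h2 := (n x).val.lt_size_self
    have h3 := ofBits_lt l'.reverse
    have h4 := h.length_le
    have h5 := size_lt_csize_bin (m x)
    have h6 := size_lt_csize_bin (n x)
    have h7 := hP x
    have h8 := hQ x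
    rw [List.length_reverse, Nat.size_eq_bits_len] at h4
    refine (csize_bin_le_of_lt (k := l'.length + (n x).val.size) ?_).trans ?_
    · rw [pow_add]
      rw [List.length_reverse] at h3
      exact Nat.mul_lt_mul'' h3 h2
    · simp only [eval_add, eval_mul, eval_one, eval_ofNat]
      omega
  · have h1 := key (n x) (m x).val.bits
    rw [List.foldl_reverse, h1, ofBits_bits]
    rfl

end PT

/-! ### Integers -/

instance : Code ℤ := ⟨fun z => Code.enc (decide (z < 0), Bin.mk z.natAbs)⟩

theorem csize_int_le {z : ℤ} {k : ℕ} (h : z.natAbs < 2 ^ k) : csize z ≤ 4 * k + 5 := by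
  have h1 := csize_bin_le_of_lt (n := ⟨z.natAbs⟩) h
  have h2 := csize_bool_le (decide (z < 0))
  have h3 := csize_prod (decide (z < 0), Bin.mk z.natAbs)
  rw [show csize z = csize (decide (z < 0), Bin.mk z.natAbs) from rfl, h3]
  simp only
  omega

theorem size_lt_csize_int (z : ℤ) : 2 * z.natAbs.size < csize z := by
  have h1 := size_lt_csize_bin ⟨z.natAbs⟩
  have h3 := csize_prod (decide (z < 0), Bin.mk z.natAbs)
  rw [show csize z = csize (decide (z < 0), Bin.mk z.natAbs) from rfl, h3]
  simp only at h1 ⊢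
  omega

namespace PT

variable {o : Bool} {α β γ δ : Type} [Code α] [Code β] [Code γ] [Code δ]

@[fun_prop]
theorem int_isNeg {z : γ → ℤ} (hz : PT o z) : PT o (fun x => decide (z x < 0)) :=
  fst (recode (g := fun x => (decide (z x < 0), Bin.mk (z x).natAbs)) hz fun _ => rfl)

@[fun_prop]
theorem int_natAbs {z : γ → ℤ} (hz : PT o z) : PT o (fun x => Bin.mk (z x).natAbs) :=
  snd (recode (g := fun x => (decide (z x < 0), Bin.mk (z x).natAbs)) hz fun _ => rfl)

theorem int_toNat {z : γ → ℤ} (hz : PT o z) : PT o (fun x => Bin.mk (z x).toNat) :=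
  (ite (c := fun x => z x < 0) (int_isNeg hz) (const ⟨0⟩) (int_natAbs hz)).congr fun x => by
    split
    · ext; simp; omega
    · ext; simp; omega

theorem int_neg_toNat {z : γ → ℤ} (hz : PT o z) : PT o (fun x => Bin.mk (-z x).toNat) :=
  (ite (c := fun x => z x < 0) (int_isNeg hz) (int_natAbs hz) (const ⟨0⟩)).congr fun x => by
    split
    · ext; simp; omega
    · ext; simp; omega

/-- The difference of two natural numbers as an integer. -/
theorem int_sub_nat {m n : γ → Bin} (hm : PT o m) (hn : PT o n) :
    PT o (fun x => ((m x).val : ℤ) - (n x).val) :=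
  -- The absolute difference is the sum of the two truncated differences, one of which is zero.
  recode (pair (bin_decide_lt hm hn) (bin_add (bin_sub hm hn) (bin_sub hn hm))) fun x => by
    have h1 : decide (((m x).val : ℤ) - (n x).val < 0) = decide ((m x).val < (n x).val) := by
      congr 1
      exact propext (by omega)
    have h2 : (⟨(((m x).val : ℤ) - (n x).val).natAbs⟩ : Bin) = (m x - n x) + (n x - m x) := by
      ext
      simp only [Bin.val_add, Bin.val_sub]
      omega
    exact congrArg₂ (fun a b => Code.enc (a, b)) h1 h2

@[fun_prop]
-- Every integer is the difference of its positive and negative parts. Collecting the terms of each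
-- sign reduces addition, and likewise subtraction and multiplication, to natural numbers and one
-- use of `int_sub_nat`.
theorem int_add {y z : γ → ℤ} (hy : PT o y) (hz : PT o z) : PT o (fun x => y x + z x) :=
  (int_sub_nat (bin_add (int_toNat hy) (int_toNat hz))
    (bin_add (int_neg_toNat hy) (int_neg_toNat hz))).congr fun x => by
      simp only [Bin.val_add]
      omega

@[fun_prop]
theorem int_sub {y z : γ → ℤ} (hy : PT o y) (hz : PT o z) : PT o (fun x => y x - z x) :=
  (int_sub_nat (bin_add (int_toNat hy) (int_neg_toNat hz))
    (bin_add (int_neg_toNat hy) (int_toNat hz))).congr fun x => by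
      simp only [Bin.val_add]
      omega

@[fun_prop]
theorem int_mul {y z : γ → ℤ} (hy : PT o y) (hz : PT o z) : PT o (fun x => y x * z x) :=
  (int_sub_nat (bin_add (bin_mul (int_toNat hy) (int_toNat hz))
    (bin_mul (int_neg_toNat hy) (int_neg_toNat hz)))
    (bin_add (bin_mul (int_toNat hy) (int_neg_toNat hz))
    (bin_mul (int_neg_toNat hy) (int_toNat hz)))).congr fun x => by
      have h1 := Int.toNat_sub_toNat_neg (y x)
      have h2 := Int.toNat_sub_toNat_neg (z x)
      simp only [Bin.val_add, Bin.val_mul]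
      conv_lhs => rw [← h1, ← h2]
      push_cast
      ring

end PT

end ZHCount

namespace ZHCount

open Prog Polynomial

/-! ### Arithmetic of scalars -/

/-- The product of two represented scalars. -/
def Scalar.mul (p q : Scalar) : Scalar where
  a₀ := p.a₀ * q.a₀ - p.a₁ * q.a₃ - p.a₂ * q.a₂ - p.a₃ * q.a₁
  a₁ := p.a₀ * q.a₁ + p.a₁ * q.a₀ - p.a₂ * q.a₃ - p.a₃ * q.a₂
  a₂ := p.a₀ * q.a₂ + p.a₁ * q.a₁ + p.a₂ * q.a₀ - p.a₃ * q.a₃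
  a₃ := p.a₀ * q.a₃ + p.a₁ * q.a₂ + p.a₂ * q.a₁ + p.a₃ * q.a₀
  den := p.den * q.den
  den_pos := Nat.mul_pos p.den_pos q.den_pos

/-- An integer as a scalar. -/
def Scalar.ofInt (z : ℤ) : Scalar := ⟨z, 0, 0, 0, 1, one_pos⟩

theorem exp_pi_div_four_pow_four : Complex.exp (Real.pi * Complex.I / 4) ^ 4 = -1 := by
  rw [← Complex.exp_nat_mul, ← Complex.exp_pi_mul_I]
  congr 1
  push_cast
  ring

theorem Scalar.val_mul (p q : Scalar) : (p.mul q).val = p.val * q.val := by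
  have h := exp_pi_div_four_pow_four
  simp only [Scalar.val, Scalar.mul]
  set w := Complex.exp (Real.pi * Complex.I / 4)
  rw [div_mul_div_comm]
  push_cast
  congr 1
  -- The coefficients of the fourth, fifth and sixth powers of `ω` in the product, which are reduced
  -- by `ω ^ 4 = -1`.
  linear_combination (-(p.a₁ * q.a₃ + p.a₂ * q.a₂ + p.a₃ * q.a₁ : ℂ) -
    (p.a₂ * q.a₃ + p.a₃ * q.a₂) * w - p.a₃ * q.a₃ * w ^ 2) * h

theorem Scalar.val_ofInt (z : ℤ) : (Scalar.ofInt z).val = z := by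
  simp [Scalar.val, Scalar.ofInt]

/-- All parameters have less than `k` binary digits. -/
def Scalar.Bounded (p : Scalar) (k : ℕ) : Prop :=
  p.a₀.natAbs < 2 ^ k ∧ p.a₁.natAbs < 2 ^ k ∧ p.a₂.natAbs < 2 ^ k ∧ p.a₃.natAbs < 2 ^ k ∧
    p.den < 2 ^ k

/-- Each coefficient is a signed sum of four products, which costs two additional bits. -/
theorem Scalar.Bounded.mul {p q : Scalar} {j k : ℕ} (hp : p.Bounded j) (hq : q.Bounded k) :
    (p.mul q).Bounded (j + k + 2) := by
  obtain ⟨h0, h1, h2, h3, h4⟩ := hp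
  obtain ⟨g0, g1, g2, g3, g4⟩ := hq
  have key : ∀ {x y : ℤ}, x.natAbs < 2 ^ j → y.natAbs < 2 ^ k → (x * y).natAbs < 2 ^ (j + k) := by
    intro x y hx hy
    rw [Int.natAbs_mul, pow_add]
    exact Nat.mul_lt_mul'' hx hy
  have hpow : 2 ^ (j + k + 2) = 4 * 2 ^ (j + k) := by ring
  rw [Scalar.Bounded, hpow]
  refine ⟨?_, ?_, ?_, ?_, ?_⟩
  · have := key h0 g0
    have := key h1 g3
    have := key h2 g2
    have := key h3 g1
    simp only [Scalar.mul]
    omega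
  · have := key h0 g1
    have := key h1 g0
    have := key h2 g3
    have := key h3 g2
    simp only [Scalar.mul]
    omega
  · have := key h0 g2
    have := key h1 g1
    have := key h2 g0
    have := key h3 g3
    simp only [Scalar.mul]
    omega
  · have := key h0 g3
    have := key h1 g2
    have := key h2 g1
    have := key h3 g0
    simp only [Scalar.mul]
    omega
  · have : p.den * q.den < 2 ^ (j + k) := by
      rw [pow_add]
      exact Nat.mul_lt_mul'' h4 g4
    simp only [Scalar.mul]
    omega

/-- The parameters of a scalar. -/
def Scalar.params (p : Scalar) : ℤ × ℤ × ℤ × ℤ × Bin := (p.a₀, p.a₁, p.a₂, p.a₃, ⟨p.den⟩)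

instance : Code Scalar := ⟨fun p => Code.enc p.params⟩

theorem csize_scalar (p : Scalar) : csize p =
    csize p.a₀ + csize p.a₁ + csize p.a₂ + csize p.a₃ + csize (⟨p.den⟩ : Bin) + 4 := by
  rw [show csize p = csize p.params from rfl]
  simp only [csize_prod, Scalar.params]
  omega

theorem Scalar.Bounded.csize_le {p : Scalar} {k : ℕ} (h : p.Bounded k) :
    csize p ≤ 20 * k + 25 := by
  have h0 := csize_int_le h.1
  have h1 := csize_int_le h.2.1
  have h2 := csize_int_le h.2.2.1
  have h3 := csize_int_le h.2.2.2.1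
  have h4 := csize_bin_le_of_lt (n := ⟨p.den⟩) h.2.2.2.2
  rw [csize_scalar]
  omega

theorem Scalar.bounded_csize (p : Scalar) : p.Bounded (csize p) := by
  have h0 := size_lt_csize_int p.a₀
  have h1 := size_lt_csize_int p.a₁
  have h2 := size_lt_csize_int p.a₂
  have h3 := size_lt_csize_int p.a₃
  have h4 := size_lt_csize_bin ⟨p.den⟩
  simp only at h4
  have := csize_scalar p
  refine ⟨Nat.size_le.1 ?_, Nat.size_le.1 ?_, Nat.size_le.1 ?_, Nat.size_le.1 ?_,
    Nat.size_le.1 ?_⟩ <;> omega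

/-- Fractions are never cancelled, but bit lengths add under multiplication, with two more bits per
factor. So the product of a list has length linear in the size of the list. -/
theorem Scalar.Bounded.foldl_mul (l : List Scalar) {p : Scalar} {k : ℕ} (h : p.Bounded k) :
    (l.foldl Scalar.mul p).Bounded (k + 2 * csize l) := by
  induction l generalizing p k with
  | nil =>
    have : 2 ^ k ≤ 2 ^ (k + 2 * csize ([] : List Scalar)) :=
      Nat.pow_le_pow_right (by norm_num) (by omega)
    obtain ⟨h0, h1, h2, h3, h4⟩ := h
    exact ⟨h0.trans_le this, h1.trans_le this, h2.trans_le this, h3.trans_le this,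
      h4.trans_le this⟩
  | cons q l ih =>
    have h1 := ih (h.mul q.bounded_csize)
    have : 2 ^ (k + csize q + 2 + 2 * csize l) ≤ 2 ^ (k + 2 * csize (q :: l)) :=
      Nat.pow_le_pow_right (by norm_num) (by rw [csize_cons]; omega)
    obtain ⟨h0, h1, h2, h3, h4⟩ := h1
    exact ⟨h0.trans_le this, h1.trans_le this, h2.trans_le this, h3.trans_le this,
      h4.trans_le this⟩

/-- The scalar with given parameters; a denominator `0` is replaced by `1`. -/
def Scalar.ofParams (p : ℤ × ℤ × ℤ × ℤ × Bin) : Scalar where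
  a₀ := p.1
  a₁ := p.2.1
  a₂ := p.2.2.1
  a₃ := p.2.2.2.1
  den := if p.2.2.2.2.val = 0 then 1 else p.2.2.2.2.val
  den_pos := by split <;> omega

theorem Scalar.ofParams_params (p : Scalar) : Scalar.ofParams p.params = p := by
  have := p.den_pos
  obtain ⟨a, b, c, d, e, h⟩ := p
  simp only [ofParams, params, Scalar.mk.injEq, true_and]
  exact if_neg (by omega)

/-! ### Scalar arithmetic in polynomial time -/

namespace PT

variable {o : Bool} {α β γ δ : Type} [Code α] [Code β] [Code γ] [Code δ]

@[fun_prop]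
theorem scalar_params {p : γ → Scalar} (hp : PT o p) : PT o (fun x => (p x).params) :=
  recode hp fun _ => rfl

@[fun_prop]
theorem scalar_ofParams {p : γ → ℤ × ℤ × ℤ × ℤ × Bin} (hp : PT o p) :
    PT o (fun x => Scalar.ofParams (p x)) := by
  have h : PT o (fun x => ((p x).1, (p x).2.1, (p x).2.2.1, (p x).2.2.2.1,
      if (p x).2.2.2.2.val = 0 then (⟨1⟩ : Bin) else (p x).2.2.2.2)) :=
    pair (by fun_prop) (pair (by fun_prop) (pair (by fun_prop) (pair (by fun_prop)
      (ite (bin_decide_eq_zero (by fun_prop)) (by fun_prop) (by fun_prop)))))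
  refine recode h fun x => ?_
  rw [show Code.enc (Scalar.ofParams (p x)) = Code.enc (Scalar.ofParams (p x)).params from rfl]
  congr 1
  simp only [Scalar.params, Scalar.ofParams]
  split <;> rfl

@[fun_prop]
theorem scalar_ofInt {z : γ → ℤ} (hz : PT o z) : PT o (fun x => Scalar.ofInt (z x)) :=
  recode (g := fun x => Scalar.ofInt (z x))
    (pair hz (const ((0 : ℤ), (0 : ℤ), (0 : ℤ), (⟨1⟩ : Bin)))) fun _ => rfl

@[fun_prop]
theorem scalar_mul {p q : γ → Scalar} (hp : PT o p) (hq : PT o q) :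
    PT o (fun x => (p x).mul (q x)) := by
  have h : PT o (fun r : (ℤ × ℤ × ℤ × ℤ × Bin) × (ℤ × ℤ × ℤ × ℤ × Bin) =>
      ((r.1.1 * r.2.1 - r.1.2.1 * r.2.2.2.2.1 - r.1.2.2.1 * r.2.2.2.1 - r.1.2.2.2.1 * r.2.2.1,
        r.1.1 * r.2.2.1 + r.1.2.1 * r.2.1 - r.1.2.2.1 * r.2.2.2.2.1 - r.1.2.2.2.1 * r.2.2.2.1,
        r.1.1 * r.2.2.2.1 + r.1.2.1 * r.2.2.1 + r.1.2.2.1 * r.2.1 - r.1.2.2.2.1 * r.2.2.2.2.1,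
        r.1.1 * r.2.2.2.2.1 + r.1.2.1 * r.2.2.2.1 + r.1.2.2.1 * r.2.2.1 + r.1.2.2.2.1 * r.2.1,
        r.1.2.2.2.2 * r.2.2.2.2.2) : ℤ × ℤ × ℤ × ℤ × Bin)) := by
    fun_prop
  exact recode (comp h (pair (scalar_params hp) (scalar_params hq))) fun _ => rfl

@[fun_prop]
theorem scalar_prod {l : γ → List Scalar} (hl : PT o l) :
    PT o (fun x => (l x).foldl Scalar.mul (Scalar.ofInt 1)) := by
  obtain ⟨P, hP⟩ := hl.exists_bound
  refine foldl hl (const _) (s := fun _ p q => Scalar.mul p q) (by fun_prop) (40 * P + 45)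
    fun x l' h => ?_
  have h1 : (Scalar.ofInt 1).Bounded 1 := by simp [Scalar.Bounded, Scalar.ofInt]
  have h2 := (h1.foldl_mul l').csize_le
  have h3 := csize_le_of_prefix h
  have h4 := hP x
  refine h2.trans ?_
  simp only [eval_add, eval_mul, eval_ofNat]
  omega

/-! ### Writing codes -/

theorem encList_eq_flatMap {α : Type} (e : α → List Bool) (l : List α) :
    encList e l = l.flatMap (fun a => true :: e a) ++ [false] := by
  induction l with
  | nil => rfl
  | cons a l ih => simp [encList, ih]

theorem encList_map {α β : Type} (e : β → List Bool) (f : α → β) (l : List α) :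
    encList e (l.map f) = encList (fun a => e (f a)) l := by
  induction l with
  | nil => rfl
  | cons a l ih => simp [encList, ih]

theorem encList {e : γ → α → List Bool} {l : γ → List α} (hl : PT o l)
    (he : PT o (fun p : γ × α => e p.1 p.2)) : PT o (fun x => encList (e x) (l x)) :=
  (append (flatMap hl (cons (const true) he)) (const [false])).congr fun _ => encList_eq_flatMap ..

@[fun_prop]
theorem encUnary {n : γ → ℕ} (hn : PT o n) : PT o (fun x => encUnary (n x)) :=
  append (repeatD hn (const true)) (const [false])

/-- The code of a binary number. -/
theorem encNat {n : γ → Bin} (hn : PT o n) : PT o (fun x => encNat (n x).val) :=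
  encList (e := fun _ b => [b]) (bits hn) (by fun_prop)

@[fun_prop]
theorem encInt {z : γ → ℤ} (hz : PT o z) : PT o (fun x => encInt (z x)) :=
  cons (int_isNeg hz) (encNat (int_natAbs hz))

@[fun_prop]
theorem scalar_encode {p : γ → Scalar} (hp : PT o p) : PT o (fun x => (p x).encode) :=
  have h := scalar_params hp
  append (encInt (fst h)) (append (encInt (fst (snd h))) (append (encInt (fst (snd (snd h))))
    (append (encInt (fst (snd (snd (snd h))))) (encNat (snd (snd (snd (snd h))))))))

end PT

/-! ### Reading codes -/

/-- `p` reads a prefix of the form `e a` and returns `f a` and the remaining word; the size of the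
result on an arbitrary word is linear in the number of bits read. -/
structure Reads (o : Bool) {α β : Type} [Code β] (e : α → List Bool) (f : α → β)
    (p : List Bool → β × List Bool) (d : ℕ) : Prop where
  pt : PT o p
  eq : ∀ a s, p (e a ++ s) = (f a, s)
  le : ∀ s, csize (p s).1 + 100 * (p s).2.length ≤ 100 * s.length + d

def readBit (s : List Bool) : Bool × List Bool := (s.headD false, s.tail)

def readUnit (s : List Bool) : Unit × List Bool := ((), s)

def readPair {β β' : Type} (p : List Bool → β × List Bool) (q : List Bool → β' × List Bool)
    (s : List Bool) : (β × β') × List Bool :=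
  (((p s).1, (q (p s).2).1), (q (p s).2).2)

/-- The first component records that the end marker has been read; from then on the state no longer
changes. -/
def readListStep {β : Type} (p : List Bool → β × List Bool) (t : Bool × List Bool × List β) :
    Bool × List Bool × List β :=
  if t.1 = true then t
  else if t.2.1.headD false = true then (false, (p t.2.1.tail).2, (p t.2.1.tail).1 :: t.2.2)
  else (true, t.2.1.tail, t.2.2)

/-- The word itself serves as a clock. It has enough symbols, since each entry is announced by one
symbol and the end marker takes another. -/
def readList {β : Type} (p : List Bool → β × List Bool) (s : List Bool) : List β × List Bool :=
  let t := s.foldl (fun t _ => readListStep p t) (false, s, [])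
  (t.2.2.reverse, t.2.1)

def readNat (s : List Bool) : ℕ × List Bool :=
  ((readList readUnit s).1.length, (readList readUnit s).2)

namespace Reads

variable {o : Bool} {α α' β β' : Type} [Code β] [Code β']

theorem bit : Reads o (fun b : Bool => [b]) (fun b => b) readBit 3 where
  pt := by
    unfold readBit
    fun_prop
  eq _ _ := rfl
  le s := by
    have := csize_bool_le (s.headD false)
    simp only [readBit, List.length_tail]
    omega

theorem unit : Reads o (fun _ : Unit => []) (fun b => b) readUnit 1 where
  pt := by
    unfold readUnit
    fun_prop
  eq _ _ := rfl
  le s := by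
    have : csize () = 1 := rfl
    simp only [readUnit, this]
    omega

theorem pair {e : α → List Bool} {f : α → β} {p : List Bool → β × List Bool} {d : ℕ}
    {e' : α' → List Bool} {f' : α' → β'} {q : List Bool → β' × List Bool} {d' : ℕ}
    (hp : Reads o e f p d) (hq : Reads o e' f' q d') :
    Reads o (encPair e e') (Prod.map f f') (readPair p q) (d + d' + 1) where
  pt := by
    have h1 := hp.pt
    have h2 := hq.pt
    unfold readPair
    fun_prop
  eq a s := by
    obtain ⟨a, b⟩ := a
    simp [encPair, readPair, hp.eq, hq.eq]
  le s := by
    have h1 := hp.le s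
    have h2 := hq.le (p s).2
    simp only [csize_prod, readPair]
    omega

/-- The size of the output plus `100` for each unread bit is a potential that never increases: the
bit announcing an entry pays for the constant `d` of its reader and for the list node. This bounds
all intermediate results, even on malformed words, as `PT.foldl` demands. -/
theorem readListStep_le {e : α → List Bool} {f : α → β} {p : List Bool → β × List Bool} {d : ℕ}
    (hp : Reads o e f p d) (hd : d < 100) (t : Bool × List Bool × List β) :
    csize (readListStep p t).2.2 + 100 * (readListStep p t).2.1.length ≤
      csize t.2.2 + 100 * t.2.1.length := by
  obtain ⟨b, w, out⟩ := t
  have h1 := hp.le w.tail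
  rcases b with _ | _
  · rcases w with _ | ⟨_ | _, w⟩
    · simp [readListStep]
    · simp [readListStep]
    · simp only [List.tail_cons] at h1
      simp [readListStep, csize_cons]
      omega
  · simp [readListStep]

theorem foldl_readListStep_le {e : α → List Bool} {f : α → β} {p : List Bool → β × List Bool}
    {d : ℕ} (hp : Reads o e f p d) (hd : d < 100) (c : List Bool) (t : Bool × List Bool × List β) :
    csize (c.foldl (fun t _ => readListStep p t) t).2.2 +
      100 * (c.foldl (fun t _ => readListStep p t) t).2.1.length ≤
      csize t.2.2 + 100 * t.2.1.length := by
  induction c generalizing t with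
  | nil => exact le_rfl
  | cons b c ih => exact (ih _).trans (readListStep_le hp hd t)

theorem foldl_readListStep_eq {α β : Type} {e : α → List Bool} {f : α → β}
    {p : List Bool → β × List Bool}
    (hp : ∀ a s, p (e a ++ s) = (f a, s)) (l : List α) (s : List Bool) (c : List Bool)
    (hc : l.length < c.length) (out : List β) :
    c.foldl (fun t _ => readListStep p t) (false, encList e l ++ s, out) =
      (true, s, (l.map f).reverse ++ out) := by
  induction l generalizing c out with
  | nil =>
    obtain ⟨v, c, rfl⟩ := List.exists_cons_of_length_pos hc
    have : ∀ c : List Bool, c.foldl (fun t _ => readListStep p t) (true, s, out) =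
        (true, s, out) := by
      intro c
      induction c with
      | nil => rfl
      | cons v c ih => exact ih
    exact this c
  | cons a l ih =>
    obtain ⟨v, c, rfl⟩ := List.exists_cons_of_length_pos (Nat.zero_lt_of_lt hc)
    have h1 : readListStep p (false, encList e (a :: l) ++ s, out) =
        (false, encList e l ++ s, f a :: out) := by
      simp [readListStep, encList, hp]
    rw [List.foldl_cons, h1, ih c (by simpa using hc)]
    simp

/-- The constant drops back to `1`, the size of the empty list, so readers of nested lists remain
below `100`. -/
theorem list {e : α → List Bool} {f : α → β} {p : List Bool → β × List Bool} {d : ℕ}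
    (hp : Reads o e f p d) (hd : d < 100) : Reads o (encList e) (List.map f) (readList p) 1 where
  pt := by
    have h1 := hp.pt
    have h2 : PT o (fun s : List Bool => s.foldl (fun t _ => readListStep p t)
        (false, s, ([] : List β))) := by
      refine PT.foldl PT.id (by fun_prop) (s := fun _ t _ => readListStep p t) ?_
        (100 * X + (400 * X + 10)) fun s l' h => ?_
      · exact PT.cond (by fun_prop) (by fun_prop) (PT.cond (by fun_prop) (by fun_prop)
          (by fun_prop))
      · have h1 := foldl_readListStep_le hp hd l' (false, s, [])
        have h2 := csize_word_le (l'.foldl (fun t _ => readListStep p t)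
          (false, s, ([] : List β))).2.1
        have h3 := csize_bool_le (l'.foldl (fun t _ => readListStep p t)
          (false, s, ([] : List β))).1
        have h4 := length_lt_csize s
        simp only [csize_nil] at h1
        simp only [csize_prod, eval_add, eval_mul, eval_X, eval_ofNat]
        omega
    unfold readList
    fun_prop
  eq l s := by
    have : l.length < (encList e l ++ s).length := by
      have : l.length < (encList e l).length := by
        induction l with
        | nil => simp [encList]
        | cons a l ih => simp [encList]; omega
      rw [List.length_append]
      omega
    simp [readList, foldl_readListStep_eq hp.eq l s _ this]
  le s := by
    have h1 := foldl_readListStep_le hp hd s (false, s, [])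
    simp only [readList, csize_reverse]
    rw [csize_nil] at h1
    simp only at h1
    omega

theorem nat : Reads o encUnary (fun n => n) readNat 1 where
  pt := by
    have h := (list (o := o) unit (by norm_num)).pt
    unfold readNat
    fun_prop
  eq n s := by
    -- A number in unary is a list whose entries carry no bits.
    have h1 : encUnary n = encList (fun _ : Unit => []) (List.replicate n ()) := by
      induction n with
      | zero => rfl
      | succ n ih => simpa [encUnary, encList, List.replicate_succ] using ih
    have h := (list (o := o) unit (by norm_num)).eq (List.replicate n ()) s
    rw [h1, readNat, h]
    simp
  le s := by
    have h := (list (o := o) unit (by norm_num)).le s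
    have h2 : ∀ l : List Unit, csize l.length = csize l := by
      intro l
      induction l with
      | nil => rfl
      | cons a l ih =>
        rw [csize_nat] at ih ⊢
        rw [csize_cons, ← ih]
        have : csize a = 1 := rfl
        rw [List.length_cons]
        omega
    simp only [readNat, h2]
    exact h

theorem fin {n : ℕ} : Reads o (encFin (n := n)) Fin.val readNat 1 where
  pt := nat.pt
  eq i s := (nat (o := o)).eq i s
  le := (nat (o := o)).le

theorem bits : Reads o encNat Nat.bits (readList readBit) 1 where
  pt := (list bit (by norm_num)).pt
  eq n s := by
    have := (list (o := o) bit (by norm_num)).eq n.bits s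
    rwa [List.map_id'] at this
  le := (list (o := o) bit (by norm_num)).le

end Reads

/-- An integer as read: sign and digits of the absolute value. -/
abbrev RawInt : Type := Bool × List Bool

theorem Reads.int {o : Bool} :
    Reads o encInt (fun z => ((decide (z < 0), z.natAbs.bits) : RawInt))
      (readPair readBit (readList readBit)) 5 where
  pt := (bit.pair bits).pt
  eq z s := (bit.pair (bits (o := o))).eq (decide (z < 0), z.natAbs) s
  le := (bit.pair (bits (o := o))).le

/-- A scalar as read. -/
abbrev RawScalar : Type := RawInt × RawInt × RawInt × RawInt × List Bool

/-- The integer that was read. -/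
def RawInt.toInt (z : RawInt) : ℤ := if z.1 = true then -(ofBits z.2 : ℤ) else ofBits z.2

/-- The scalar that was read. -/
def RawScalar.toScalar (p : RawScalar) : Scalar :=
  Scalar.ofParams (RawInt.toInt p.1, RawInt.toInt p.2.1, RawInt.toInt p.2.2.1,
    RawInt.toInt p.2.2.2.1, ⟨ofBits p.2.2.2.2⟩)

/-- The raw form of a scalar. -/
def Scalar.raw (p : Scalar) : RawScalar :=
  ((decide (p.a₀ < 0), p.a₀.natAbs.bits), (decide (p.a₁ < 0), p.a₁.natAbs.bits),
    (decide (p.a₂ < 0), p.a₂.natAbs.bits), (decide (p.a₃ < 0), p.a₃.natAbs.bits), p.den.bits)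

theorem Scalar.toScalar_raw (p : Scalar) : p.raw.toScalar = p := by
  have h : ∀ z : ℤ, RawInt.toInt (decide (z < 0), z.natAbs.bits) = z := by
    intro z
    simp only [RawInt.toInt, ofBits_bits, decide_eq_true_eq]
    split <;> omega
  conv_rhs => rw [← p.ofParams_params]
  simp only [RawScalar.toScalar, raw, h, ofBits_bits]
  rfl

def readScalar : List Bool → RawScalar × List Bool :=
  readPair (readPair readBit (readList readBit)) (readPair (readPair readBit (readList readBit))
    (readPair (readPair readBit (readList readBit)) (readPair (readPair readBit (readList readBit))
      (readList readBit))))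

theorem Reads.scalar {o : Bool} : Reads o Scalar.encode Scalar.raw readScalar 25 where
  pt := (int.pair (int.pair (int.pair (int.pair bits)))).pt
  eq p s := (int.pair (int.pair (int.pair (int.pair (bits (o := o)))))).eq
    (p.a₀, p.a₁, p.a₂, p.a₃, p.den) s
  le := (int.pair (int.pair (int.pair (int.pair (bits (o := o)))))).le

theorem PT.rawInt_toInt {o : Bool} {γ : Type} [Code γ] {z : γ → RawInt} (hz : PT o z) :
    PT o (fun x => (z x).toInt) :=
  (cond (fst hz) (int_sub_nat (const ⟨0⟩) (ofBits (snd hz)))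
    (int_sub_nat (ofBits (snd hz)) (const ⟨0⟩))).congr fun x => by
      simp [RawInt.toInt]

@[fun_prop]
theorem PT.rawScalar_toScalar {o : Bool} {γ : Type} [Code γ] {p : γ → RawScalar} (hp : PT o p) :
    PT o (fun x => (p x).toScalar) :=
  scalar_ofParams (pair (rawInt_toInt (by fun_prop)) (pair (rawInt_toInt (by fun_prop))
    (pair (rawInt_toInt (by fun_prop)) (pair (rawInt_toInt (by fun_prop)) (ofBits (by fun_prop))))))

end ZHCount

namespace ZHCount

/-! ### Sequences of definitions of variables -/

/-- An assignment to the first `n` variables, extended by `false`. -/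
def extend {n : ℕ} (x : Fin n → Bool) (i : ℕ) : Bool := if h : i < n then x ⟨i, h⟩ else false

theorem extend_val {n : ℕ} (x : Fin n → Bool) (i : Fin n) : extend x i = x i := by
  simp [extend]

/-- Summation over the assignments to `n + 1` variables. -/
theorem sum_extend_succ {R : Type} [AddCommMonoid R] (n : ℕ) (G : (ℕ → Bool) → R) :
    ∑ x : Fin (n + 1) → Bool, G (extend x) =
      ∑ x : Fin n → Bool, ∑ b : Bool, G (Function.update (extend x) n b) := by
  rw [← (Fin.snocEquiv fun _ => Bool).sum_comp, Fintype.sum_prod_type, Finset.sum_comm]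
  refine Finset.sum_congr rfl fun x _ => Finset.sum_congr rfl fun b _ => congrArg G ?_
  funext i
  simp only [Fin.snocEquiv, Equiv.coe_fn_mk, extend, Function.update_apply]
  by_cases h1 : i < n
  · rw [dif_pos (by omega), if_neg (by omega), dif_pos h1]
    exact Fin.snoc_castSucc (α := fun _ => Bool) (n := n) b x ⟨i, h1⟩
  · by_cases h2 : i = n
    · subst h2
      rw [dif_pos (by omega), if_pos rfl]
      exact Fin.snoc_last (α := fun _ => Bool) (n := i) b x
    · rw [dif_neg (by omega), if_neg h2, dif_neg h1]

/-- The sign of a bit. -/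
def bitSign (b : Bool) : ℤ := if b then -1 else 1

/-- The introduction of a new variable `x_N`: a variable `x_b`, the phase of the new variable, and
the list of the forbidden values of `(x_{N-1}, x_b, x_N)`. -/
abbrev Instr : Type := ℕ × Bool × List (Bool × Bool × Bool)

namespace Instr

/-- The constraint on the new variable `x_N`. -/
def Holds (i : Instr) (N : ℕ) (x : ℕ → Bool) : Prop := (x (N - 1), x i.1, x N) ∉ i.2.2

instance (i : Instr) (N : ℕ) (x : ℕ → Bool) : Decidable (i.Holds N x) :=
  inferInstanceAs (Decidable (_ ∉ _))

/-- The sum of the signs over all values of the new variables. -/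
def signedSum : List Instr → ℕ → (ℕ → Bool) → ℤ
  | [], _, _ => 1
  | i :: L, N, x => ∑ b : Bool, if i.Holds N (Function.update x N b) then
      bitSign (i.2.1 && b) * signedSum L (N + 1) (Function.update x N b) else 0

/-- The sum of the values of `F` over all values of the new variables. -/
def sumOver : List Instr → ℕ → (ℕ → Bool) → ((ℕ → Bool) → ℤ) → ℤ
  | [], _, x, F => F x
  | i :: L, N, x, F => ∑ b : Bool, if i.Holds N (Function.update x N b) then
      sumOver L (N + 1) (Function.update x N b) F else 0

/-- All constraints hold. -/
def HoldAll : List Instr → ℕ → (ℕ → Bool) → Prop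
  | [], _, _ => True
  | i :: L, N, x => i.Holds N x ∧ HoldAll L (N + 1) x

/-- Only variables that have been introduced before are used. -/
def WellFormed : List Instr → ℕ → Prop
  | [], _ => True
  | i :: L, N => i.1 ≤ N ∧ WellFormed L (N + 1)

theorem wellFormed_of_le {L : List Instr} {N : ℕ} (h : ∀ i ∈ L, i.1 ≤ N) : WellFormed L N := by
  induction L generalizing N with
  | nil => trivial
  | cons i L ih => exact ⟨h i (by simp), ih fun j hj => (h j (by simp [hj])).trans (by omega)⟩

theorem wellFormed_append {L K : List Instr} {N : ℕ} (hL : WellFormed L N)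
    (hK : WellFormed K (N + L.length)) : WellFormed (L ++ K) N := by
  induction L generalizing N with
  | nil => exact hK
  | cons i L ih =>
    exact ⟨hL.1, ih hL.2 (by rwa [List.length_cons, add_comm L.length, ← add_assoc] at hK)⟩

/-- The definitions introduce only variables from `N` on, so every assignment at which `F` is
evaluated agrees with `x` below `N`. -/
theorem sumOver_congr {L : List Instr} {N : ℕ} {x : ℕ → Bool} {F G : (ℕ → Bool) → ℤ}
    (h : ∀ y, (∀ j < N, y j = x j) → F y = G y) : sumOver L N x F = sumOver L N x G := by
  induction L generalizing N x with
  | nil => exact h x fun _ _ => rfl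
  | cons i L ih =>
    refine Finset.sum_congr rfl fun b _ => ?_
    rw [ih fun y hy => h y fun j hj => ?_]
    rw [hy j (by omega), Function.update_of_ne (by omega)]

theorem sumOver_mul (L : List Instr) (N : ℕ) (x : ℕ → Bool) (c : ℤ) (F : (ℕ → Bool) → ℤ) :
    sumOver L N x (fun y => c * F y) = c * sumOver L N x F := by
  induction L generalizing N x with
  | nil => rfl
  | cons i L ih => simp only [sumOver, ih, Finset.mul_sum, mul_ite, mul_zero]

theorem sumOver_sub (L : List Instr) (N : ℕ) (x : ℕ → Bool) (F G : (ℕ → Bool) → ℤ) :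
    sumOver L N x (fun y => F y - G y) = sumOver L N x F - sumOver L N x G := by
  induction L generalizing N x with
  | nil => rfl
  | cons i L ih =>
    simp only [sumOver, ih, ← Finset.sum_sub_distrib]
    refine Finset.sum_congr rfl fun b _ => ?_
    split <;> simp

theorem sumOver_append (L K : List Instr) (N : ℕ) (x : ℕ → Bool) (F : (ℕ → Bool) → ℤ) :
    sumOver (L ++ K) N x F = sumOver L N x fun y => sumOver K (N + L.length) y F := by
  induction L generalizing N x with
  | nil => rfl
  | cons i L ih =>
    simp only [List.cons_append, sumOver, ih, List.length_cons]
    rw [show N + (L.length + 1) = N + 1 + L.length by omega]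

theorem Holds.congr {i : Instr} {N : ℕ} {x y : ℕ → Bool} (hi : i.1 ≤ N)
    (h : ∀ j < N + 1, y j = x j) : i.Holds N y ↔ i.Holds N x := by
  rw [Holds, Holds, h _ (by omega), h _ (by omega), h _ (by omega)]

open Classical in
-- This links counting over all variables at once with the nested sums, in which variables are
-- introduced one after another. In the induction the first constraint is absorbed into the summand;
-- as it involves only variables up to `N`, it is unaffected by the later ones and can be taken out
-- of the inner sum.
theorem sum_holdAll (L : List Instr) {N M : ℕ} (hM : M = N + L.length) (hL : WellFormed L N)
    (F : (ℕ → Bool) → ℤ) :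
    (∑ x : Fin M → Bool, if HoldAll L N (extend x) then F (extend x) else 0) =
      ∑ x : Fin N → Bool, sumOver L N (extend x) F := by
  induction L generalizing N F with
  | nil =>
    subst hM
    simp [HoldAll, sumOver]
  | cons i L ih =>
    -- The new variable `N` counts as free for the remaining definitions.
    have h1 := ih (N := N + 1) (by rw [hM, List.length_cons]; omega) hL.2
      fun y => if i.Holds N y then F y else 0
    rw [sum_extend_succ N fun y => sumOver L (N + 1) y fun y => if i.Holds N y then F y else 0]
      at h1
    refine Eq.trans ?_ (h1.trans ?_)
    · refine Finset.sum_congr rfl fun x _ => ?_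
      by_cases h2 : i.Holds N (extend x) <;> simp [HoldAll, h2]
    · refine Finset.sum_congr rfl fun x _ => Finset.sum_congr rfl fun b _ => ?_
      by_cases h2 : i.Holds N (Function.update (extend x) N b)
      · rw [if_pos h2]
        exact sumOver_congr fun y hy => if_pos ((Holds.congr hL.1 hy).2 h2)
      · rw [if_neg h2]
        refine (sumOver_congr (G := fun y => 0 * F y) fun y hy => ?_).trans
          ((sumOver_mul ..).trans (zero_mul _))
        rw [if_neg (fun h => h2 ((Holds.congr hL.1 hy).1 h)), zero_mul]

/-- The variables with phase `π`. -/
def phased (L : List Instr) (N : ℕ) : List ℕ :=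
  ((L.zipIdx N).filter fun p => p.1.2.1).map Prod.snd

/-- The sign of an assignment. -/
def sign (L : List Instr) (N : ℕ) (x : ℕ → Bool) : ℤ :=
  ((phased L N).map fun k => bitSign (x k)).prod

theorem sign_cons (i : Instr) (L : List Instr) (N : ℕ) (x : ℕ → Bool) :
    sign (i :: L) N x = bitSign (i.2.1 && x N) * sign L (N + 1) x := by
  obtain ⟨b, p, f⟩ := i
  cases p <;> simp [sign, phased, List.zipIdx_cons, bitSign]

theorem signedSum_eq_sumOver (L : List Instr) (N : ℕ) (x : ℕ → Bool) :
    signedSum L N x = sumOver L N x (sign L N) := by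
  induction L generalizing N x with
  | nil => simp [signedSum, sumOver, sign, phased]
  | cons i L ih =>
    refine Finset.sum_congr rfl fun b _ => ?_
    rw [ih, ← sumOver_mul]
    congr 1
    refine sumOver_congr fun y hy => ?_
    rw [sign_cons, hy N (by omega), Function.update_self]

/-- The forbidden values for a given relation. -/
def forbid (R : Bool → Bool → Bool → Bool) : List (Bool × Bool × Bool) :=
  [(false, false, false), (false, false, true), (false, true, false), (false, true, true),
    (true, false, false), (true, false, true), (true, true, false), (true, true, true)].filter
    fun t => !R t.1 t.2.1 t.2.2

theorem holds_forbid (b : ℕ) (p : Bool) (R : Bool → Bool → Bool → Bool) (N : ℕ) (x : ℕ → Bool) :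
    Holds (b, p, forbid R) N x ↔ R (x (N - 1)) (x b) (x N) = true := by
  simp only [Holds, forbid, List.mem_filter]
  cases x (N - 1) <;> cases x b <;> cases x N <;> simp

/-! ### The parity of the signs -/

/-- Definitions of the partial parities of some variables, where the last one shall be `c`. -/
def parityInstrs (c : Bool) (ks : List ℕ) : List Instr :=
  (0, false, forbid fun _ _ n => n == false) ::
    (ks.map (fun k => (k, false, forbid fun q b n => n == (q ^^ b))) ++
      [(0, false, forbid fun q _ n => (n == q) && (q == c))])

/-- Each new variable is forced to be the xor of its predecessor and one of the given variables, so
there is at most one extension; the last constraint admits it only if the total parity is `c`. The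
given variables lie below all new ones and are not overwritten. -/
theorem sumOver_parity_aux (c : Bool) (ks : List ℕ) (M N : ℕ) (hN : M < N) (hk : ∀ k ∈ ks, k < M)
    (x : ℕ → Bool) :
    sumOver (ks.map (fun k => (k, false, forbid fun q b n => n == (q ^^ b))) ++
      [(0, false, forbid fun q _ n => (n == q) && (q == c))]) N x (fun _ => 1) =
      if ks.foldl (fun s k => s ^^ x k) (x (N - 1)) = c then 1 else 0 := by
  induction ks generalizing N x with
  | nil =>
    simp only [List.map_nil, List.nil_append, sumOver, Fintype.sum_bool, holds_forbid,
      Function.update_self, List.foldl_nil]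
    rw [Function.update_of_ne (by omega), Function.update_of_ne (by omega)]
    cases x (N - 1) <;> cases c <;> simp
  | cons k ks ih =>
    have hk' := hk k (by simp)
    have key : ∀ b s, List.foldl (fun s k => s ^^ Function.update x N b k) s ks =
        List.foldl (fun s k => s ^^ x k) s ks := by
      intro b s
      refine List.foldl_ext _ _ _ fun s k hk2 => ?_
      have := hk k (by simp [hk2])
      rw [Function.update_of_ne (by omega)]
    simp only [List.map_cons, List.cons_append, sumOver, holds_forbid, Fintype.sum_bool,
      Function.update_self]
    rw [ih (N + 1) (by omega) (fun k h => hk k (by simp [h])),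
      ih (N + 1) (by omega) (fun k h => hk k (by simp [h]))]
    simp only [key, Nat.add_sub_cancel, Function.update_self, List.foldl_cons]
    rw [Function.update_of_ne (by omega), Function.update_of_ne (by omega),
      Function.update_of_ne (by omega), Function.update_of_ne (by omega)]
    rcases Bool.eq_false_or_eq_true (x (N - 1)) with h1 | h1 <;>
      rcases Bool.eq_false_or_eq_true (x k) with h2 | h2 <;> simp [h1, h2]

theorem sumOver_parityInstrs (c : Bool) (ks : List ℕ) (N : ℕ) (hk : ∀ k ∈ ks, k < N)
    (x : ℕ → Bool) : sumOver (parityInstrs c ks) N x (fun _ => 1) =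
      if ks.foldl (fun s k => s ^^ x k) false = c then 1 else 0 := by
  have key : ks.foldl (fun s k => s ^^ Function.update x N false k) false =
      ks.foldl (fun s k => s ^^ x k) false := by
    refine List.foldl_ext _ _ _ fun s k hk2 => ?_
    have := hk k hk2
    rw [Function.update_of_ne (by omega)]
  rw [parityInstrs, sumOver, Fintype.sum_bool]
  simp only [holds_forbid, Function.update_self]
  rw [sumOver_parity_aux c ks N (N + 1) (by omega) hk (Function.update x N false)]
  simp [key]

theorem bitSign_parity (ks : List ℕ) (x : ℕ → Bool) (s : Bool) :
    bitSign (ks.foldl (fun s k => s ^^ x k) s) =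
      bitSign s * (ks.map fun k => bitSign (x k)).prod := by
  induction ks generalizing s with
  | nil => simp
  | cons k ks ih =>
    rw [List.foldl_cons, ih, List.map_cons, List.prod_cons, ← mul_assoc]
    congr 1
    cases s <;> cases x k <;> rfl

theorem lt_of_mem_phased {L : List Instr} {N k : ℕ} (h : k ∈ phased L N) : k < N + L.length := by
  obtain ⟨⟨i, k⟩, h1, rfl⟩ := List.mem_map.1 h
  have := List.snd_lt_add_of_mem_zipIdx (List.mem_of_mem_filter h1)
  omega

/-- The definitions that count the assignments of sign `+` (for `c = false`) or `-`. -/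
def withParity (c : Bool) (L : List Instr) (N : ℕ) : List Instr :=
  L ++ parityInstrs c (phased L N)

/-- The sign of an assignment is the indicator of even parity minus that of odd parity of its phased
variables, and the appended parity definitions contribute exactly these indicators as factors. -/
theorem signedSum_eq_sub (L : List Instr) (N : ℕ) (x : ℕ → Bool) : signedSum L N x =
    sumOver (withParity false L N) N x (fun _ => 1) -
      sumOver (withParity true L N) N x (fun _ => 1) := by
  rw [signedSum_eq_sumOver, withParity, withParity, sumOver_append, sumOver_append, ← sumOver_sub]
  congr 1
  funext y
  rw [sumOver_parityInstrs _ _ _ fun k => lt_of_mem_phased,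
    sumOver_parityInstrs _ _ _ fun k => lt_of_mem_phased]
  have := bitSign_parity (phased L N) y false
  rw [sign]
  rw [show bitSign false = 1 from rfl, one_mul] at this
  rw [← this]
  cases (phased L N).foldl (fun s k => s ^^ y k) false <;> simp [bitSign]

theorem wellFormed_withParity {L : List Instr} {N : ℕ} (hL : WellFormed L N) (c : Bool) :
    WellFormed (withParity c L N) N := by
  refine wellFormed_append hL (wellFormed_of_le fun i hi => ?_)
  simp only [parityInstrs, List.mem_cons, List.mem_append, List.mem_map, List.not_mem_nil,
    or_false] at hi
  rcases hi with rfl | ⟨k, hk, rfl⟩ | rfl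
  · exact Nat.zero_le _
  · exact (lt_of_mem_phased hk).le
  · exact Nat.zero_le _

/-! ### Clauses -/

/-- The clauses that express the constraints. -/
def clauses (L : List Instr) (N : ℕ) : List (List (ℕ × Bool)) :=
  (L.zipIdx N).flatMap fun p =>
    p.1.2.2.map fun t => [(p.2 - 1, !t.1), (p.1.1, !t.2.1), (p.2, !t.2.2)]

/-- A forbidden triple of values is excluded by the clause that negates each of them. -/
theorem holdAll_iff (L : List Instr) (N : ℕ) (x : ℕ → Bool) :
    HoldAll L N x ↔ ∀ C ∈ clauses L N, ∃ l ∈ C, x l.1 = l.2 := by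
  induction L generalizing N with
  | nil => simp [HoldAll, clauses]
  | cons i L ih =>
    have h1 : clauses (i :: L) N =
        (i.2.2.map fun t => [(N - 1, !t.1), (i.1, !t.2.1), (N, !t.2.2)]) ++ clauses L (N + 1) := by
      simp [clauses, List.zipIdx_cons]
    rw [HoldAll, ih, h1]
    simp only [List.forall_mem_append, List.forall_mem_map]
    refine and_congr_left fun _ => ?_
    rw [Holds]
    constructor
    · intro h t ht
      by_contra h2
      refine h ?_
      obtain ⟨t1, t2, t3⟩ := t
      simp only [List.mem_cons, List.not_mem_nil, or_false, exists_eq_or_imp, exists_eq_left,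
        not_or, Bool.eq_not_iff, not_not] at h2
      rwa [h2.1, h2.2.1, h2.2.2]
    · intro h ht
      have := h _ ht
      simp at this

theorem mem_clauses_lt {L : List Instr} {N : ℕ} (hL : WellFormed L N) : ∀ C ∈ clauses L N,
    ∀ l ∈ C, l.1 < N + L.length := by
  induction L generalizing N with
  | nil => simp [clauses]
  | cons i L ih =>
    have h1 : clauses (i :: L) N =
        (i.2.2.map fun t => [(N - 1, !t.1), (i.1, !t.2.1), (N, !t.2.2)]) ++ clauses L (N + 1) := by
      simp [clauses, List.zipIdx_cons]
    have h2 := hL.1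
    rw [h1, List.length_cons]
    intro C hC l hl
    rcases List.mem_append.1 hC with hC | hC
    · obtain ⟨t, _, rfl⟩ := List.mem_map.1 hC
      simp only [List.mem_cons, List.not_mem_nil, or_false] at hl
      rcases hl with rfl | rfl | rfl <;> simp only <;> omega
    · have := ih hL.2 C hC l hl
      omega

theorem length_of_mem_clauses {L : List Instr} {N : ℕ} {C : List (ℕ × Bool)}
    (h : C ∈ clauses L N) : C.length = 3 := by
  obtain ⟨p, _, h⟩ := List.mem_flatMap.1 h
  obtain ⟨t, _, rfl⟩ := List.mem_map.1 h
  rfl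

end Instr

/-! ### Formulas whose variables are given by numbers -/

namespace CNF

/-- A literal whose variable is given by a number. -/
def litOfNat (n : ℕ) (l : ℕ × Bool) : Option (Fin n × Bool) :=
  if h : l.1 < n then some (⟨l.1, h⟩, l.2) else none

/-- A formula whose variables are given by numbers. -/
def ofNat (n : ℕ) (cl : List (List (ℕ × Bool))) : CNF :=
  ⟨n, cl.map fun C => C.filterMap (litOfNat n)⟩

/-- The code of a formula whose variables are given by numbers. -/
def encodeNat (n : ℕ) (cl : List (List (ℕ × Bool))) : List Bool :=
  encUnary n ++ encList (encList (encPair encUnary fun b => [b])) cl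

theorem encList_congr {α : Type} {e e' : α → List Bool} {l : List α} (h : ∀ a ∈ l, e a = e' a) :
    encList e l = encList e' l := by
  induction l with
  | nil => rfl
  | cons a l ih => rw [encList, encList, h a (by simp), ih fun b hb => h b (by simp [hb])]

/-- If all variables are in range then no literal is discarded. A program can therefore write the
code from plain numbers, without types that depend on `n`. -/
theorem encode_ofNat {n : ℕ} {cl : List (List (ℕ × Bool))} (h : ∀ C ∈ cl, ∀ l ∈ C, l.1 < n) :
    (ofNat n cl).encode = encodeNat n cl := by
  rw [encode, encodeNat, ofNat]
  simp only [PT.encList_map]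
  congr 1
  refine encList_congr fun C hC => ?_
  replace hC := h C hC
  induction C with
  | nil => rfl
  | cons l C ih =>
    have h1 : litOfNat n l = some (⟨l.1, hC l (by simp)⟩, l.2) := dif_pos _
    rw [List.filterMap_cons_some h1, encList, encList, ih fun l hl => hC l (by simp [hl])]
    rfl

theorem sat_ofNat {n : ℕ} {cl : List (List (ℕ × Bool))} (h : ∀ C ∈ cl, ∀ l ∈ C, l.1 < n)
    (x : Fin n → Bool) : (ofNat n cl).Sat x ↔ ∀ C ∈ cl, ∃ l ∈ C, extend x l.1 = l.2 := by
  change (∀ C ∈ cl.map fun C => C.filterMap (litOfNat n), ∃ l ∈ C, x l.1 = l.2) ↔ _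
  rw [List.forall_mem_map]
  refine forall₂_congr fun C hC => ?_
  constructor
  · rintro ⟨l, hl, hx⟩
    obtain ⟨m, hm, hml⟩ := List.mem_filterMap.1 hl
    refine ⟨m, hm, ?_⟩
    have h1 := h C hC m hm
    rw [litOfNat, dif_pos h1, Option.some.injEq] at hml
    subst hml
    simpa [extend, h1] using hx
  · rintro ⟨m, hm, hx⟩
    have h1 := h C hC m hm
    refine ⟨(⟨m.1, h1⟩, m.2), List.mem_filterMap.2 ⟨m, hm, dif_pos h1⟩, ?_⟩
    simpa [extend, h1] using hx

end CNF

namespace Instr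

/-- The formula in `N` free and all defined variables. -/
def toCNF (L : List Instr) (N : ℕ) : CNF := CNF.ofNat (N + L.length) (clauses L N)

theorem sat_toCNF {L : List Instr} {N : ℕ} (hL : WellFormed L N)
    (x : Fin (N + L.length) → Bool) : (toCNF L N).Sat x ↔ HoldAll L N (extend x) :=
  (CNF.sat_ofNat (mem_clauses_lt hL) x).trans (holdAll_iff L N _).symm

theorem is3CNF_toCNF (L : List Instr) (N : ℕ) : (toCNF L N).Is3CNF := by
  intro C hC
  obtain ⟨C', hC', rfl⟩ := List.mem_map.1 hC
  exact (List.length_filterMap_le _ _).trans (length_of_mem_clauses hC').le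

theorem count_toCNF {L : List Instr} {N : ℕ} (hL : WellFormed L N) :
    ((toCNF L N).count : ℤ) = ∑ x : Fin N → Bool, sumOver L N (extend x) fun _ => 1 := by
  classical
  rw [← sum_holdAll L rfl hL, CNF.count, Finset.card_filter]
  push_cast
  exact Finset.sum_congr rfl fun x _ => if_congr (sat_toCNF hL x) rfl rfl

/-- The phases of all variables. -/
def phases (L : List Instr) (N : ℕ) : List Bool :=
  List.replicate N false ++ L.map fun i => i.2.1

/-- The formula with the phases. -/
def toPhasedCNF (L : List Instr) (N : ℕ) : PhasedCNF :=
  ⟨toCNF L N, fun i => (phases L N).getD i.val false⟩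

theorem prod_phases (L : List Instr) (N : ℕ) (x : ℕ → Bool) :
    ∏ k ∈ Finset.range (N + L.length), bitSign ((phases L N).getD k false && x k) =
      sign L N x := by
  have h : ∀ (L : List Instr) N, ∏ k ∈ Finset.range L.length,
      bitSign ((L.map fun i => i.2.1).getD k false && x (N + k)) = sign L N x := by
    intro L
    induction L with
    | nil => intro N; simp [sign, phased]
    | cons i L ih =>
      intro N
      rw [List.length_cons, Finset.prod_range_succ', sign_cons, ← ih (N + 1), mul_comm]
      congr 1
      refine Finset.prod_congr rfl fun k _ => ?_
      rw [show N + 1 + k = N + (k + 1) by omega]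
      rfl
  rw [Finset.prod_range_add, ← h]
  have h1 : ∏ k ∈ Finset.range N, bitSign ((phases L N).getD k false && x k) = 1 := by
    refine Finset.prod_eq_one fun k hk => ?_
    rw [phases, List.getD_append _ _ _ _ (by simpa using hk),
      List.getD_replicate _ (by simpa using hk)]
    rfl
  rw [h1, one_mul]
  refine Finset.prod_congr rfl fun k _ => ?_
  rw [phases, List.getD_append_right _ _ _ _ (by simp)]
  simp

theorem count_toPhasedCNF {L : List Instr} {N : ℕ} (hL : WellFormed L N) :
    (toPhasedCNF L N).count = ∑ x : Fin N → Bool, signedSum L N (extend x) := by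
  classical
  simp only [signedSum_eq_sumOver]
  rw [← sum_holdAll L rfl hL, PhasedCNF.count, Finset.sum_filter]
  refine Finset.sum_congr rfl fun x _ => if_congr (sat_toCNF hL x) ?_ rfl
  rw [← prod_phases, Finset.prod_range]
  refine Finset.prod_congr rfl fun i _ => ?_
  exact (congrArg (fun b => bitSign ((phases L N).getD i false && b)) (extend_val x i)).symm

theorem encode_toPhasedCNF {L : List Instr} {N : ℕ} (hL : WellFormed L N) :
    (toPhasedCNF L N).encode = CNF.encodeNat (N + L.length) (clauses L N) ++
      encList (fun b => [b]) (phases L N) := by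
  rw [PhasedCNF.encode]
  congr 1
  · exact CNF.encode_ofNat (mem_clauses_lt hL)
  · congr 1
    refine List.ext_getElem (by simp [phases, toPhasedCNF, toCNF, CNF.ofNat]) fun k h1 h2 => ?_
    rw [List.getElem_ofFn]
    exact List.getD_eq_getElem _ _ h2

end Instr

end ZHCount

namespace ZHCount

/-! ### From diagrams to definitions of variables -/

/-- The raw form of the scalar `1`. -/
def RawScalar.one : RawScalar :=
  ((false, [true]), (false, []), (false, []), (false, []), [true])

theorem RawScalar.toScalar_one : RawScalar.one.toScalar = Scalar.ofInt 1 := rfl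

/-- A generator as read: the tag (kind and phase), the legs, and the label of a scalar. -/
abbrev RawGen : Type := (Bool × Bool × Bool) × List ℕ × RawScalar

/-- The raw form of a generator. -/
def Generator.raw {n : ℕ} : Generator n → RawGen
  | zSpider p l => ((false, false, p), l.map Fin.val, RawScalar.one)
  | xSpider p l => ((false, true, p), l.map Fin.val, RawScalar.one)
  | hBox l => ((true, false, true), l.map Fin.val, RawScalar.one)
  | zeroBox l => ((true, false, false), l.map Fin.val, RawScalar.one)
  | scalarBox a => ((true, true, false), [], a.raw)

namespace RawGen

/-- The first variable of a gadget. -/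
def startRel (t₀ t₁ p : Bool) (_ _ n : Bool) : Bool :=
  if t₀ then n == true else if t₁ then n == p else true

/-- The variable of a gadget that belongs to a leg. -/
def stepRel (t₀ t₁ : Bool) (q b n : Bool) : Bool :=
  if t₀ then n == (q && b) else if t₁ then n == (q ^^ b) else (n == q) && (b == q)

/-- The last variable of a gadget. -/
def endRel (t₀ t₁ p : Bool) (q _ n : Bool) : Bool :=
  if t₀ ^^ t₁ then (n == q) && (q == (t₀ && p && q)) else n == q

/-- The definitions for a generator with legs. -/
def gadget (t₀ t₁ p : Bool) (legs : List ℕ) : List Instr :=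
  (0, false, Instr.forbid (startRel t₀ t₁ p)) ::
    (legs.map (fun k => (k, false, Instr.forbid (stepRel t₀ t₁))) ++
      [(0, p && !t₁, Instr.forbid (endRel t₀ t₁ p))])

/-- The definitions for a generator. -/
def instrs (g : RawGen) : List Instr :=
  if (g.1.1 && g.1.2.1) = true then [] else gadget g.1.1 g.1.2.1 g.1.2.2 g.2.1

/-- The sum over the last variables of a gadget, if the value of the previous variable is `q`. -/
def tailSum (t₀ t₁ p : Bool) : Bool → List Bool → ℤ
  | q, [] => ∑ n : Bool, if endRel t₀ t₁ p q false n = true then bitSign ((p && !t₁) && n) else 0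
  | q, b :: l => ∑ n : Bool, if stepRel t₀ t₁ q b n = true then tailSum t₀ t₁ p n l else 0

/-- The sum over all variables of a gadget. -/
def gadgetSum (t₀ t₁ p : Bool) (l : List Bool) : ℤ :=
  ∑ n : Bool, if startRel t₀ t₁ p false false n = true then tailSum t₀ t₁ p n l else 0

/-- The later definitions `K` look back only at the wires below `m`, so their sum is a constant
factor `c`. The hypothesis on `K` is needed at every position `N`, because this gadget shifts them.
The predecessor variable `N - 1` is the state of the automaton. -/
theorem signedSum_tail (t₀ t₁ p : Bool) {m : ℕ} {x : ℕ → Bool} {K : List Instr} {c : ℤ}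
    (hK : ∀ N ≥ m, ∀ y : ℕ → Bool, (∀ i < m, y i = x i) → Instr.signedSum K N y = c)
    (legs : List ℕ) (hl : ∀ k ∈ legs, k < m) (N : ℕ) (hN : m < N) (y : ℕ → Bool)
    (hy : ∀ i < m, y i = x i) :
    Instr.signedSum (legs.map (fun k => (k, false, Instr.forbid (stepRel t₀ t₁))) ++
      (0, p && !t₁, Instr.forbid (endRel t₀ t₁ p)) :: K) N y =
      tailSum t₀ t₁ p (y (N - 1)) (legs.map x) * c := by
  induction legs generalizing N y with
  | nil =>
    simp only [List.map_nil, List.nil_append, Instr.signedSum, tailSum, Finset.sum_mul]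
    refine Finset.sum_congr rfl fun b _ => ?_
    simp only [Instr.holds_forbid]
    rw [Function.update_self, Function.update_of_ne (by omega),
      hK (N + 1) (by omega) _ fun i hi => by rw [Function.update_of_ne (by omega), hy i hi],
      ite_mul, zero_mul]
    rfl
  | cons k legs ih =>
    have hk := hl k (by simp)
    simp only [List.map_cons, List.cons_append, Instr.signedSum, tailSum, Finset.sum_mul]
    refine Finset.sum_congr rfl fun b _ => ?_
    simp only [Instr.holds_forbid]
    rw [Function.update_self, Function.update_of_ne (by omega),
      Function.update_of_ne (by omega), hy k hk,
      ih (fun k hk => hl k (by simp [hk])) (N + 1) (by omega) _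
        (fun i hi => by rw [Function.update_of_ne (by omega), hy i hi]),
      Nat.add_sub_cancel, Function.update_self, ite_mul, zero_mul]
    simp [bitSign]

theorem signedSum_gadget (t₀ t₁ p : Bool) {m : ℕ} {x : ℕ → Bool} {K : List Instr} {c : ℤ}
    (hK : ∀ N ≥ m, ∀ y : ℕ → Bool, (∀ i < m, y i = x i) → Instr.signedSum K N y = c)
    (legs : List ℕ) (hl : ∀ k ∈ legs, k < m) (N : ℕ) (hN : m ≤ N) (y : ℕ → Bool)
    (hy : ∀ i < m, y i = x i) :
    Instr.signedSum (gadget t₀ t₁ p legs ++ K) N y = gadgetSum t₀ t₁ p (legs.map x) * c := by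
  rw [gadget, List.cons_append, List.append_assoc]
  simp only [Instr.signedSum, gadgetSum, Finset.sum_mul]
  refine Finset.sum_congr rfl fun b _ => ?_
  simp only [Instr.holds_forbid]
  rw [Function.update_self, List.singleton_append,
    signedSum_tail t₀ t₁ p hK legs hl (N + 1) (by omega) _
      (fun i hi => by rw [Function.update_of_ne (by omega), hy i hi]),
    Nat.add_sub_cancel, Function.update_self, ite_mul, zero_mul]
  simp [bitSign, startRel]

/-- The guessed bit `q` is passed on unchanged and compared with every leg; the last variable
repeats it and carries the phase. -/
theorem tailSum_z (p q : Bool) (l : List Bool) :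
    tailSum false false p q l = if ∀ v ∈ l, v = q then bitSign (p && q) else 0 := by
  induction l generalizing q with
  | nil => cases q <;> simp [tailSum, endRel]
  | cons b l ih => cases q <;> cases b <;> simp [tailSum, stepRel, ih]

/-- The state is the running parity, and the last constraint demands that it be `false`. The phase
enters only through the first state, so the result does not depend on `p`. -/
theorem tailSum_x (p q : Bool) (l : List Bool) :
    tailSum false true p q l = if l.foldr xor q = false then 1 else 0 := by
  have h : ∀ (l : List Bool) (q b : Bool), l.foldr xor (q ^^ b) = (b ^^ l.foldr xor q) := by
    intro l q b
    induction l with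
    | nil => simp [Bool.xor_comm]
    | cons c l ih => simp [ih, Bool.xor_left_comm]
  induction l generalizing q with
  | nil => cases q <;> cases p <;> simp [tailSum, endRel, bitSign]
  | cons b l ih =>
    rw [List.foldr_cons, ← h]
    cases q <;> cases b <;> simp [tailSum, stepRel, ih]

/-- The state is the running conjunction. At the end a true conjunction is either weighted by `-1`,
if `p` holds, or forbidden; a false one always contributes `1`. -/
theorem tailSum_h (p q : Bool) (l : List Bool) :
    tailSum true false p q l =
      if (q = true ∧ ∀ v ∈ l, v = true) then (if p = true then -1 else 0) else 1 := by
  induction l generalizing q with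
  | nil => cases q <;> cases p <;> simp [tailSum, endRel, bitSign]
  | cons b l ih => cases q <;> cases b <;> simp [tailSum, stepRel, ih]

/-- The first variable of this gadget is unconstrained, and its two values give the two summands of
the tensor. -/
theorem gadgetSum_z (p : Bool) (l : List Bool) :
    (gadgetSum false false p l : ℂ) = zTensor (phaseFactor p) l := by
  have : (phaseFactor p : ℂ) = (bitSign p : ℤ) := by cases p <;> simp [phaseFactor, bitSign]
  rw [gadgetSum, zTensor, this]
  simp only [Fintype.sum_bool, startRel, tailSum_z]
  rw [add_comm]
  push_cast
  congr 1
  · simp [bitSign]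
  · simp

theorem gadgetSum_x (p : Bool) (l : List Bool) :
    (gadgetSum false true p l : ℂ) = xTensor p l := by
  rw [gadgetSum, xTensor]
  simp only [Fintype.sum_bool, startRel, tailSum_x]
  cases p <;> simp

theorem gadgetSum_h (p : Bool) (l : List Bool) :
    (gadgetSum true false p l : ℂ) = hTensor (if p = true then -1 else 0) l := by
  rw [gadgetSum, hTensor]
  simp only [Fintype.sum_bool, startRel, tailSum_h]
  cases p <;> simp

end RawGen

/-! ### The definitions and scalars of a whole diagram -/

/-- The definitions for all generators of a diagram. -/
def instrsOf (gens : List RawGen) : List Instr := gens.flatMap RawGen.instrs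

/-- The product of all scalars of a diagram. -/
def scalarOf (gens : List RawGen) : Scalar :=
  (gens.map fun g => RawScalar.toScalar g.2.2).foldl Scalar.mul (Scalar.ofInt 1)

theorem val_foldl_mul (l : List Scalar) (p : Scalar) :
    (l.foldl Scalar.mul p).val = p.val * (l.map Scalar.val).prod := by
  induction l generalizing p with
  | nil => simp
  | cons q l ih => rw [List.foldl_cons, ih, Scalar.val_mul, List.map_cons, List.prod_cons,
      mul_assoc]

theorem val_scalarOf (gens : List RawGen) :
    (scalarOf gens).val = (gens.map fun g => (RawScalar.toScalar g.2.2).val).prod := by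
  rw [scalarOf, val_foldl_mul, Scalar.val_ofInt, List.map_map]
  simp [Function.comp_def]

theorem map_extend {n : ℕ} (x : Fin n → Bool) (l : List (Fin n)) :
    (l.map Fin.val).map (extend x) = l.map x := by
  rw [List.map_map]
  exact List.map_congr_left fun i _ => extend_val x i

/-- The value of a diagram at an assignment. -/
theorem prod_tensor {n : ℕ} (gens : List (Generator n)) (x : Fin n → Bool) :
    ∃ c : ℤ, (gens.map (Generator.tensor x)).prod = (scalarOf (gens.map Generator.raw)).val * c ∧
      ∀ N ≥ n, ∀ y : ℕ → Bool, (∀ i < n, y i = extend x i) →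
        Instr.signedSum (instrsOf (gens.map Generator.raw)) N y = c := by
  simp only [val_scalarOf]
  induction gens with
  | nil => exact ⟨1, by simp, fun _ _ _ _ => rfl⟩
  | cons g gens ih =>
    obtain ⟨c, h1, h2⟩ := ih
    -- Every generator other than a scalar box carries the filler `1` as its scalar, so all entries
    -- may be multiplied.
    have hone : RawScalar.one.toScalar.val = 1 := by
      rw [RawScalar.toScalar_one, Scalar.val_ofInt]
      simp
    have key : ∀ (t₀ t₁ p : Bool) (l : List (Fin n)),
        ∀ N ≥ n, ∀ y : ℕ → Bool, (∀ i < n, y i = extend x i) →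
        Instr.signedSum (RawGen.gadget t₀ t₁ p (l.map Fin.val) ++
          instrsOf (gens.map Generator.raw)) N y = RawGen.gadgetSum t₀ t₁ p (l.map x) * c := by
      intro t₀ t₁ p l N hN y hy
      rw [RawGen.signedSum_gadget t₀ t₁ p h2 _ (by simp) N hN y hy, map_extend]
    have hcons : instrsOf (List.map Generator.raw (g :: gens)) =
        g.raw.instrs ++ instrsOf (gens.map Generator.raw) := by simp [instrsOf]
    rw [hcons, List.map_cons, List.prod_cons, h1, List.map_cons, List.map_cons, List.prod_cons]
    cases g with
    | zSpider p l =>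
      refine ⟨RawGen.gadgetSum false false p (l.map x) * c, ?_, key false false p l⟩
      push_cast
      rw [RawGen.gadgetSum_z]
      simp only [Generator.tensor, Generator.raw, hone]
      ring
    | xSpider p l =>
      refine ⟨RawGen.gadgetSum false true p (l.map x) * c, ?_, key false true p l⟩
      push_cast
      rw [RawGen.gadgetSum_x]
      simp only [Generator.tensor, Generator.raw, hone]
      ring
    | hBox l =>
      refine ⟨RawGen.gadgetSum true false true (l.map x) * c, ?_, key true false true l⟩
      push_cast
      rw [RawGen.gadgetSum_h]
      simp only [Generator.tensor, Generator.raw, hone, if_true]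
      ring
    | zeroBox l =>
      refine ⟨RawGen.gadgetSum true false false (l.map x) * c, ?_, key true false false l⟩
      push_cast
      rw [RawGen.gadgetSum_h]
      simp only [Generator.tensor, Generator.raw, hone]
      simp
      ring
    | scalarBox a =>
      refine ⟨c, ?_, h2⟩
      simp only [Generator.tensor, Generator.raw, Scalar.toScalar_raw]
      simp [hTensor]
      ring

/-- The definitions of variables for a diagram. -/
def Diagram.instrs (D : Diagram) : List Instr := instrsOf (D.gens.map Generator.raw)

/-- The product of the scalars of a diagram. -/
def Diagram.scalar (D : Diagram) : Scalar := scalarOf (D.gens.map Generator.raw)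

/-- The scalar boxes do not depend on the wires and come out of the sum; what remains is an integer
for each assignment. -/
theorem Diagram.value_eq (D : Diagram) : D.value = D.scalar.val *
    ((∑ x : Fin D.numWires → Bool, Instr.signedSum D.instrs D.numWires (extend x) : ℤ) : ℂ) := by
  rw [Diagram.value]
  push_cast
  rw [Finset.mul_sum]
  refine Finset.sum_congr rfl fun x _ => ?_
  obtain ⟨c, h1, h2⟩ := prod_tensor D.gens x
  rw [h1, instrs, h2 _ le_rfl _ fun _ _ => rfl]
  rfl

theorem Diagram.wellFormed_instrs (D : Diagram) : Instr.WellFormed D.instrs D.numWires := by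
  refine Instr.wellFormed_of_le fun i hi => ?_
  obtain ⟨r, hr, hi⟩ := List.mem_flatMap.1 hi
  obtain ⟨g, _, rfl⟩ := List.mem_map.1 hr
  have key : ∀ (t₀ t₁ p : Bool) (l : List (Fin D.numWires)),
      i ∈ RawGen.gadget t₀ t₁ p (l.map Fin.val) → i.1 ≤ D.numWires := by
    intro t₀ t₁ p l h
    simp only [RawGen.gadget, List.mem_cons, List.mem_append, List.mem_map, List.not_mem_nil,
      or_false] at h
    rcases h with rfl | ⟨k, ⟨j, _, rfl⟩, rfl⟩ | rfl
    -- The start and end of a gadget name the variable `0` as a dummy that their relations ignore.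
    -- This is legitimate even without wires, since the new variable itself is admitted by `≤`.
    · exact Nat.zero_le _
    · exact j.isLt.le
    · exact Nat.zero_le _
  cases g with
  | zSpider p l => exact key _ _ _ l hi
  | xSpider p l => exact key _ _ _ l hi
  | hBox l => exact key _ _ _ l hi
  | zeroBox l => exact key _ _ _ l hi
  | scalarBox a => simp [RawGen.instrs, Generator.raw] at hi

/-- The counting reduction to 3-CNF formulas. -/
def Diagram.toCNFs (D : Diagram) : Scalar × CNF × CNF :=
  (D.scalar, Instr.toCNF (Instr.withParity false D.instrs D.numWires) D.numWires,
    Instr.toCNF (Instr.withParity true D.instrs D.numWires) D.numWires)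

theorem Diagram.value_eq_toCNFs (D : Diagram) : D.value = D.toCNFs.1.val *
    ((D.toCNFs.2.1.count : ℂ) - (D.toCNFs.2.2.count : ℂ)) := by
  have h : ∀ c, ((Instr.toCNF (Instr.withParity c D.instrs D.numWires) D.numWires).count : ℤ) =
      _ := fun c => Instr.count_toCNF (Instr.wellFormed_withParity D.wellFormed_instrs c)
  have h2 : (∑ x : Fin D.numWires → Bool, Instr.signedSum D.instrs D.numWires (extend x)) =
      (D.toCNFs.2.1.count : ℤ) - (D.toCNFs.2.2.count : ℤ) := by
    simp only [toCNFs, h, Instr.signedSum_eq_sub, Finset.sum_sub_distrib]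
  rw [D.value_eq, h2]
  push_cast
  rfl

/-- The reduction to formulas with phases. -/
def Diagram.toPhased (D : Diagram) : Scalar × PhasedCNF :=
  (D.scalar, Instr.toPhasedCNF D.instrs D.numWires)

theorem Diagram.value_eq_toPhased (D : Diagram) :
    D.value = D.toPhased.1.val * (D.toPhased.2.count : ℂ) := by
  rw [D.value_eq, toPhased, Instr.count_toPhasedCNF D.wellFormed_instrs]

end ZHCount

namespace ZHCount

open Prog Polynomial

/-! ### The reductions from diagrams run in polynomial time -/

/-- The code of a scalar box has two tag bits, the others have three. The first two bits decide
which reader continues, and the missing tag bit is filled up with `false`. -/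
def readGen (s : List Bool) : RawGen × List Bool :=
  let r := readPair readBit readBit s
  let q := readPair readBit (readList readNat) r.2
  if (r.1.1 && r.1.2) = true then
    (((true, true, false), [], (readScalar r.2).1), (readScalar r.2).2)
  else (((r.1.1, r.1.2, q.1.1), q.1.2, RawScalar.one), q.2)

theorem PT.raw_gen {o : Bool} {p : List Bool → (Bool × Bool) × List Bool}
    {q : List Bool → (Bool × List ℕ) × List Bool} {r : List Bool → RawScalar × List Bool}
    (hp : PT o p) (hq : PT o q) (hr : PT o r) :
    PT o (fun s => if ((p s).1.1 && (p s).1.2) = true then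
      ((((true, true, false), [], (r (p s).2).1), (r (p s).2).2) : RawGen × List Bool)
    else ((((p s).1.1, (p s).1.2, (q (p s).2).1.1), (q (p s).2).1.2, RawScalar.one),
      (q (p s).2).2)) :=
  cond (by fun_prop) (by fun_prop) (by fun_prop)

theorem Reads.gen {o : Bool} {n : ℕ} :
    -- The constant covers the tag and the filler `RawScalar.one`, and stays below the `100`
    -- required by `Reads.list`.
    Reads o (Generator.encode (n := n)) Generator.raw readGen 90 where
  pt := by
    have h1 : PT o (readPair readBit readBit) := (bit.pair bit).pt
    have h2 : PT o (readPair readBit (readList readNat)) := (bit.pair (nat.list (by norm_num))).pt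
    have h3 : PT o readScalar := scalar.pt
    exact PT.raw_gen h1 h2 h3
  eq g s := by
    have h := (fin (o := o) (n := n).list (by norm_num)).eq
    have h2 := (scalar (o := o)).eq
    cases g with
    | zSpider p l => simp [Generator.encode, readGen, readPair, readBit, Generator.raw, h]
    | xSpider p l => simp [Generator.encode, readGen, readPair, readBit, Generator.raw, h]
    | hBox l => simp [Generator.encode, readGen, readPair, readBit, Generator.raw, h]
    | zeroBox l => simp [Generator.encode, readGen, readPair, readBit, Generator.raw, h]
    | scalarBox a => simp [Generator.encode, readGen, readPair, readBit, Generator.raw, h2]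
  le s := by
    have h1 := (bit.pair (bit (o := o))).le s
    have h2 := (bit.pair ((nat (o := o)).list (by norm_num))).le (readPair readBit readBit s).2
    have h3 := (scalar (o := o)).le (readPair readBit readBit s).2
    have h4 : csize RawScalar.one = 25 := rfl
    have h5 : csize (true, true, false) = 9 := rfl
    have h6 := csize_nil (α := ℕ)
    unfold readGen
    dsimp only
    split
    · simp only [csize_prod] at *
      omega
    · simp only [csize_prod] at *
      omega

/-- The number of wires and the generators of the diagram with the given code. -/
def readDiagram (s : List Bool) : ℕ × List RawGen :=
  ((readNat s).1, (readList readGen (readNat s).2).1)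

theorem readDiagram_encode (D : Diagram) :
    readDiagram D.encode = (D.numWires, D.gens.map Generator.raw) := by
  have h1 := (Reads.gen (o := false) (n := D.numWires).list (by norm_num)).eq D.gens []
  rw [List.append_nil] at h1
  rw [readDiagram, Diagram.encode, (Reads.nat (o := false)).eq, h1]

namespace PT

variable {o : Bool} {α β γ δ : Type} [Code α] [Code β] [Code γ] [Code δ]

@[fun_prop]
theorem readDiagram {s : γ → List Bool} (hs : PT o s) : PT o (fun x => readDiagram (s x)) := by
  have h1 : PT o readNat := Reads.nat.pt
  have h2 : PT o (readList readGen) := (Reads.gen (n := 0).list (by norm_num)).pt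
  exact comp (pair (fst h1) (fst (comp h2 (snd h1)))) hs

/-- The relations depend on three tag bits only, so their tables of forbidden values are constants
chosen by case distinction. -/
theorem rawGen_instrs : PT o RawGen.instrs := by
  have h (R : Bool → Bool → Bool → Bool → Bool → Bool → Bool) : PT o (fun g : RawGen =>
      Instr.forbid (R g.1.1 g.1.2.1 g.1.2.2)) :=
    comp_bool₃ (fun t₀ t₁ p => Instr.forbid (R t₀ t₁ p)) (by fun_prop) (by fun_prop) (by fun_prop)
  have h1 := h RawGen.startRel
  have h2 := h fun t₀ t₁ _ => RawGen.stepRel t₀ t₁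
  have h3 := h RawGen.endRel
  have h4 : PT o (fun g : RawGen => g.2.1.map
      (fun k => ((k, false, Instr.forbid (RawGen.stepRel g.1.1 g.1.2.1)) : Instr))) :=
    map (by fun_prop) (pair (by fun_prop) (pair (by fun_prop)
      (comp (g := fun g : RawGen => Instr.forbid (RawGen.stepRel g.1.1 g.1.2.1))
        (f := fun p : RawGen × ℕ => p.1) h2 (by fun_prop))))
  have h5 : PT o (fun g : RawGen => RawGen.gadget g.1.1 g.1.2.1 g.1.2.2 g.2.1) := by
    unfold RawGen.gadget
    fun_prop
  exact cond (by fun_prop) (by fun_prop) h5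

@[fun_prop]
theorem instrsOf {l : γ → List RawGen} (hl : PT o l) : PT o (fun x => instrsOf (l x)) :=
  flatMap hl (g := fun _ g => RawGen.instrs g) (comp rawGen_instrs (by fun_prop))

@[fun_prop]
theorem scalarOf {l : γ → List RawGen} (hl : PT o l) : PT o (fun x => scalarOf (l x)) :=
  scalar_prod (map hl (g := fun _ g => RawScalar.toScalar g.2.2) (by fun_prop))

@[fun_prop]
theorem phased {L : γ → List Instr} {N : γ → ℕ} (hL : PT o L) (hN : PT o N) :
    PT o (fun x => Instr.phased (L x) (N x)) :=
  map (g := fun (_ : γ) (p : Instr × ℕ) => p.2)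
    (filter (zipIdx hL hN) (g := fun (_ : γ) (p : Instr × ℕ) => p.1.2.1) (by fun_prop))
    (by fun_prop)

@[fun_prop]
theorem withParity (c : Bool) {L : γ → List Instr} {N : γ → ℕ} (hL : PT o L) (hN : PT o N) :
    PT o (fun x => Instr.withParity c (L x) (N x)) :=
  append hL (cons (const _) (append (map (phased hL hN)
    (g := fun _ k => ((k, false, Instr.forbid fun q b n => n == (q ^^ b)) : Instr)) (by fun_prop))
    (const _)))

@[fun_prop]
theorem clauses {L : γ → List Instr} {N : γ → ℕ} (hL : PT o L) (hN : PT o N) :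
    PT o (fun x => Instr.clauses (L x) (N x)) :=
  flatMap (zipIdx hL hN) (g := fun (_ : γ) (p : Instr × ℕ) => p.1.2.2.map
    fun t => [(p.2 - 1, !t.1), (p.1.1, !t.2.1), (p.2, !t.2.2)])
    (map (l := fun q : γ × Instr × ℕ => q.2.1.2.2) (by fun_prop)
      (g := fun (q : γ × Instr × ℕ) (t : Bool × Bool × Bool) =>
        [(q.2.2 - 1, !t.1), (q.2.1.1, !t.2.1), (q.2.2, !t.2.2)]) (by fun_prop))

@[fun_prop]
theorem encodeNat {n : γ → ℕ} {cl : γ → List (List (ℕ × Bool))} (hn : PT o n) (hcl : PT o cl) :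
    PT o (fun x => CNF.encodeNat (n x) (cl x)) := by
  refine append (encUnary hn) (encList (e := fun _ =>
    ZHCount.encList (encPair ZHCount.encUnary fun b => [b])) hcl ?_)
  refine encList (e := fun _ => encPair ZHCount.encUnary fun b => [b]) (by fun_prop) ?_
  unfold encPair
  fun_prop

@[fun_prop]
theorem phases {L : γ → List Instr} {N : γ → ℕ} (hL : PT o L) (hN : PT o N) :
    PT o (fun x => Instr.phases (L x) (N x)) :=
  append (repeatD hN (const false)) (map hL (g := fun _ i => i.2.1) (by fun_prop))

end PT

/-- The code of the formula with the given definitions. -/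
def Instr.encodeCNF (L : List Instr) (N : ℕ) : List Bool :=
  CNF.encodeNat (N + L.length) (Instr.clauses L N)

theorem Instr.encode_toCNF {L : List Instr} {N : ℕ} (hL : WellFormed L N) :
    (toCNF L N).encode = encodeCNF L N := CNF.encode_ofNat (mem_clauses_lt hL)

@[fun_prop]
theorem PT.encodeCNF {o : Bool} {γ : Type} [Code γ] {L : γ → List Instr} {N : γ → ℕ} (hL : PT o L)
    (hN : PT o N) : PT o (fun x => Instr.encodeCNF (L x) (N x)) :=
  encodeNat (add hN (length hL)) (clauses hL hN)

theorem polyTime_toCNFs : PolyTime Diagram.encode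
    (encPair Scalar.encode (encPair CNF.encode CNF.encode)) Diagram.toCNFs := by
  have h : PT false (fun p : ℕ × List RawGen => (scalarOf p.2).encode ++
      (Instr.encodeCNF (Instr.withParity false (instrsOf p.2) p.1) p.1 ++
      Instr.encodeCNF (Instr.withParity true (instrsOf p.2) p.1) p.1)) := by fun_prop
  refine PT.polyTime (PT.comp h (PT.readDiagram PT.id)) fun D => ?_
  rw [readDiagram_encode]
  simp only [encPair, Diagram.toCNFs,
    Instr.encode_toCNF (Instr.wellFormed_withParity D.wellFormed_instrs _)]
  rfl

theorem polyTime_toPhased : PolyTime Diagram.encode (encPair Scalar.encode PhasedCNF.encode)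
    Diagram.toPhased := by
  have h : PT false (fun p : ℕ × List RawGen => encList (fun b => [b])
      (Instr.phases (instrsOf p.2) p.1)) :=
    PT.encList (e := fun _ b => [b]) (by fun_prop) (by fun_prop)
  have h' : PT false (fun p : ℕ × List RawGen => (scalarOf p.2).encode ++
      (Instr.encodeCNF (instrsOf p.2) p.1 ++
        encList (fun b => [b]) (Instr.phases (instrsOf p.2) p.1))) := by fun_prop
  refine PT.polyTime (PT.comp h' (PT.readDiagram PT.id)) fun D => ?_
  rw [readDiagram_encode]
  simp only [encPair, Diagram.toPhased, Instr.encode_toPhasedCNF D.wellFormed_instrs]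
  rfl

/-! ### Exact evaluation with two oracle calls -/

/-- The exact value of a diagram. -/
def Diagram.exactValue (D : Diagram) : Scalar :=
  D.toCNFs.1.mul (Scalar.ofInt (D.toCNFs.2.1.count - D.toCNFs.2.2.count))

theorem Diagram.val_exactValue (D : Diagram) : D.exactValue.val = D.value := by
  rw [exactValue, Scalar.val_mul, Scalar.val_ofInt, D.value_eq_toCNFs]
  push_cast
  rfl

/-- The exact value, for a diagram as read and with an oracle for the counting problem. -/
noncomputable def exactValueOf (p : ℕ × List RawGen) : Scalar :=
  (scalarOf p.2).mul (Scalar.ofInt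
    (((⟨ofBits (sharpSAT (Instr.encodeCNF (Instr.withParity false (instrsOf p.2) p.1) p.1))⟩ :
      Bin).val : ℤ) -
    (⟨ofBits (sharpSAT (Instr.encodeCNF (Instr.withParity true (instrsOf p.2) p.1) p.1))⟩ :
      Bin).val))

theorem exactValueOf_eq (D : Diagram) :
    exactValueOf (D.numWires, D.gens.map Generator.raw) = D.exactValue := by
  have h (c : Bool) : ofBits (sharpSAT (Instr.encodeCNF (Instr.withParity c
      (instrsOf (D.gens.map Generator.raw)) D.numWires) D.numWires)) =
      (Instr.toCNF (Instr.withParity c D.instrs D.numWires) D.numWires).count := by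
    rw [← ofBits_bits (CNF.count _), ← sharpSAT_encode,
      Instr.encode_toCNF (Instr.wellFormed_withParity D.wellFormed_instrs _)]
    rfl
  rw [exactValueOf, h, h]
  rfl

theorem pt_bin_count (c : Bool) : PT true (fun p : ℕ × List RawGen => Bin.mk (ofBits (sharpSAT
    (Instr.encodeCNF (Instr.withParity c (instrsOf p.2) p.1) p.1)))) :=
  PT.ofBits (PT.comp PT.sharpSAT (by fun_prop))

theorem inFPSharpP_value : InFPSharpP Diagram.encode Diagram.value := by
  refine ⟨Diagram.exactValue, Diagram.val_exactValue, PT.polyTimeWithOracle (o := true)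
    (g := fun s => (exactValueOf (readDiagram s)).encode) ?_ fun D => ?_⟩
  · have h : PT true exactValueOf :=
      PT.scalar_mul (by fun_prop)
        (PT.scalar_ofInt (PT.int_sub_nat (pt_bin_count false) (pt_bin_count true)))
    exact PT.scalar_encode (PT.comp h (PT.readDiagram PT.id))
  · rw [readDiagram_encode, exactValueOf_eq]

end ZHCount

namespace ZHCount

/-! ### From formulas with phases to diagrams -/

/-- A numbered literal of a formula: the literal and the index of its clause. -/
abbrev Occurrence (n : ℕ) : Type := (Fin n × Bool) × ℕ

namespace Occurrence

variable {n : ℕ} (L : List (Occurrence n))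

/-- The legs of the spider of a variable. -/
def varLegs (v : Fin n) : List (Fin (L.length + L.length)) :=
  ((List.finRange L.length).filter fun k => L[k].1.1 = v).map (Fin.castAdd _)

/-- The legs of the H-box of a clause. -/
def clauseLegs (i : ℕ) : List (Fin (L.length + L.length)) :=
  ((List.finRange L.length).filter fun k => L[k].2 = i).map (Fin.natAdd _)

/-- The spider of a literal. -/
def litSpider (k : Fin L.length) : Generator (L.length + L.length) :=
  .xSpider L[k].1.2 [Fin.castAdd _ k, Fin.natAdd _ k]

/-- A Z-spider for each variable, an X-spider for each literal, and an H-box with label `0` for each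
clause. -/
def gens (m : ℕ) (phase : Fin n → Bool) : List (Generator (L.length + L.length)) :=
  List.ofFn (fun v => .zSpider (phase v) (varLegs L v)) ++ (List.ofFn (litSpider L) ++
    List.ofFn fun i : Fin m => .zeroBox (clauseLegs L i))

theorem count_finRange_filter {K : ℕ} (p : Fin K → Prop) [DecidablePred p] (k : Fin K) :
    ((List.finRange K).filter fun k => p k).count k = if p k then 1 else 0 := by
  split_ifs with h
  · rw [List.count_filter (by simpa using h)]
    exact List.count_eq_one_of_mem (List.nodup_finRange K) (List.mem_finRange k)
  · exact List.count_eq_zero_of_not_mem (by simp [h])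

theorem count_map_castAdd {K : ℕ} (l : List (Fin K)) (k : Fin K) :
    (l.map (Fin.castAdd K)).count (Fin.castAdd K k) = l.count k :=
  List.count_map_of_injective _ _ (Fin.castAdd_injective K K) _

theorem count_map_natAdd {K : ℕ} (l : List (Fin K)) (k : Fin K) :
    (l.map (Fin.natAdd K)).count (Fin.natAdd K k) = l.count k :=
  List.count_map_of_injective _ _ (Fin.natAdd_injective K K) _

theorem castAdd_ne_natAdd {K : ℕ} (j k : Fin K) : Fin.castAdd K j ≠ Fin.natAdd K k := by
  intro h
  have := congrArg Fin.val h
  simp at this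
  omega

/-- The `k`-th wire of the first half joins the spider of a variable to the `k`-th literal spider,
and that of the second half joins this literal spider to the box of its clause. By `hL` the box
exists. -/
theorem count_gens (m : ℕ) (phase : Fin n → Bool) (hL : ∀ p ∈ L, p.2 < m)
    (w : Fin (L.length + L.length)) :
    ((gens L m phase).flatMap Generator.legs).count w = 2 := by
  have h1 (j k : Fin L.length) := castAdd_ne_natAdd j k
  have h2 (j k : Fin L.length) := (castAdd_ne_natAdd j k).symm
  rw [gens, List.flatMap_append, List.flatMap_append, List.count_append, List.count_append,
    List.count_flatMap, List.count_flatMap, List.count_flatMap, List.map_ofFn, List.map_ofFn,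
    List.map_ofFn, List.sum_ofFn, List.sum_ofFn, List.sum_ofFn]
  induction w using Fin.addCases with
  | left k =>
    have h0 (i : ℕ) : (clauseLegs L i).count (Fin.castAdd _ k) = 0 :=
      List.count_eq_zero_of_not_mem (by simp [clauseLegs, h2, -Fin.natAdd_eq_addNat])
    simp [Generator.legs, litSpider, h0, varLegs, count_map_castAdd, count_finRange_filter,
      List.count_cons, h2, -Fin.natAdd_eq_addNat]
  | right k =>
    have h0 (v : Fin n) : (varLegs L v).count (Fin.natAdd _ k) = 0 :=
      List.count_eq_zero_of_not_mem (by simp [varLegs, h1, -Fin.natAdd_eq_addNat])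
    have hk : L[k].2 < m := hL _ (List.getElem_mem _)
    have h3 : ∀ i : Fin m, L[k].2 = i ↔ (⟨L[k].2, hk⟩ : Fin m) = i := fun i => by
      rw [Fin.ext_iff]
    simp only [Function.comp_def, Generator.legs, h0, clauseLegs, count_map_natAdd,
      count_finRange_filter, h3, litSpider]
    simp [List.count_cons, h1, -Fin.natAdd_eq_addNat]

/-- The diagram of a formula with phases, in terms of its literals. -/
def toDiagram (m : ℕ) (phase : Fin n → Bool) (hL : ∀ p ∈ L, p.2 < m) : Diagram where
  numWires := L.length + L.length
  gens := gens L m phase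
  wires_closed w := .inl (count_gens L m phase hL w)

/-- A Z-spider sums over one bit that is copied to all legs; this bit is the value of the variable.
For a spider without legs both values count, as they should for a variable that does not occur. -/
theorem zTensor_eq_sum (e : ℂ) (b : List Bool) :
    zTensor e b = ∑ y : Bool, if ∀ v ∈ b, v = y then (if y = true then e else 1) else 0 := by
  simp [zTensor, add_comm]

theorem xTensor_pair (p u w : Bool) : xTensor p [u, w] = if w = (u ^^ p) then 1 else 0 := by
  cases p <;> cases u <;> cases w <;> simp [xTensor]

theorem prod_ite_one_zero {ι : Type} [Fintype ι] (p : ι → Prop) [DecidablePred p]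
    [Decidable (∀ i, p i)] :
    ∏ i, (if p i then (1 : ℂ) else 0) = if ∀ i, p i then 1 else 0 := by
  split_ifs with h
  · exact Finset.prod_eq_one fun i _ => if_pos (h i)
  · obtain ⟨i, hi⟩ := not_forall.1 h
    exact Finset.prod_eq_zero (Finset.mem_univ i) (if_neg hi)

/-- Here `u` and `w` are the bits on the two halves of the wires. The Z-spiders make `u` the values
of the variables of an assignment, the X-spiders make `w` the negations of the literals, and a box
with label `0` is `0` exactly if all its literals are false, in particular for an empty clause. -/
theorem value_toDiagram (m : ℕ) (phase : Fin n → Bool) (hL : ∀ p ∈ L, p.2 < m) :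
    (toDiagram L m phase hL).value = ∑ y : Fin n → Bool,
      if ∀ i : Fin m, ∃ p ∈ L, p.2 = i ∧ y p.1.1 = p.1.2 then
        ∏ v, (if y v = true then phaseFactor (phase v) else 1) else 0 := by
  have hz (u w : Fin L.length → Bool) (v : Fin n) :
      Generator.tensor (Fin.append u w) (.zSpider (phase v) (varLegs L v)) =
        ∑ y : Bool, if ∀ k : Fin L.length, L[k].1.1 = v → u k = y then
          (if y = true then phaseFactor (phase v) else 1) else 0 := by
    rw [Generator.tensor, zTensor_eq_sum]
    simp [varLegs]
  have hx (u w : Fin L.length → Bool) (k : Fin L.length) :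
      Generator.tensor (Fin.append u w) (litSpider L k) =
      if w k = (u k ^^ L[k].1.2) then 1 else 0 := by
    simp [litSpider, Generator.tensor, xTensor_pair, -Fin.natAdd_eq_addNat]
  have hh (u w : Fin L.length → Bool) (i : ℕ) :
      Generator.tensor (Fin.append u w) (.zeroBox (clauseLegs L i)) =
        if ∃ k : Fin L.length, L[k].2 = i ∧ w k = false then 1 else 0 := by
    rw [Generator.tensor, hTensor]
    simp only [clauseLegs, List.map_map, List.mem_map, List.mem_filter, List.mem_finRange,
      true_and, decide_eq_true_eq, forall_exists_index, and_imp, Function.comp_apply,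
      Fin.append_right, forall_apply_eq_imp_iff₂]
    by_cases h : ∃ k : Fin L.length, L[k].2 = i ∧ w k = false
    · rw [if_pos h, if_neg]
      obtain ⟨k, hk, hw⟩ := h
      intro h'
      simp [h' k hk] at hw
    · rw [if_neg h, if_pos]
      intro k hk
      by_contra hw
      exact h ⟨k, hk, by simpa using hw⟩
  have hval : (toDiagram L m phase hL).value = ∑ u : Fin L.length → Bool, ∑ w : Fin L.length → Bool,
      (∏ v, ∑ y : Bool, if ∀ k : Fin L.length, L[k].1.1 = v → u k = y then
          (if y = true then phaseFactor (phase v) else 1) else 0) *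
        ((∏ k : Fin L.length, if w k = (u k ^^ L[k].1.2) then 1 else 0) *
          ∏ i : Fin m, if ∃ k : Fin L.length, L[k].2 = i ∧ w k = false then 1 else 0) := by
    rw [← Fintype.sum_prod_type']
    refine ((Fin.appendEquiv (α := Bool) L.length L.length).sum_comp _).symm.trans ?_
    refine Finset.sum_congr rfl fun x _ => ?_
    change ((gens L m phase).map (Generator.tensor _)).prod = _
    simp only [gens, List.map_append, List.prod_append, List.map_ofFn, List.prod_ofFn,
      Function.comp_apply]
    have h : Fin.appendEquiv (α := Bool) L.length L.length x = Fin.append x.1 x.2 := rfl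
    simp only [h, hz, hx, hh]
  rw [hval]
  have hw (u : Fin L.length → Bool) (c : ℂ) : ∑ w : Fin L.length → Bool,
      c * ((∏ k : Fin L.length, if w k = (u k ^^ L[k].1.2) then 1 else 0) *
          ∏ i : Fin m, if ∃ k : Fin L.length, L[k].2 = i ∧ w k = false then 1 else 0) =
      c * if ∀ i : Fin m, ∃ k : Fin L.length, L[k].2 = i ∧ u k = L[k].1.2 then 1 else 0 := by
    simp only [prod_ite_one_zero]
    -- The literal spiders leave only this `w`. A positive literal has phase `π`, so that `w k` is
    -- `false` exactly if the literal is true.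
    rw [Finset.sum_eq_single fun k => u k ^^ L[k].1.2]
    · simp
    · intro w _ hne
      rw [if_neg fun h => hne (funext h)]
      simp
    · simp
  simp only [hw]
  have hu (u : Fin L.length → Bool) : (∏ v, ∑ y : Bool,
      if ∀ k : Fin L.length, L[k].1.1 = v → u k = y then
      (if y = true then phaseFactor (phase v) else 1) else 0) = ∑ y : Fin n → Bool,
      if u = fun k => y L[k].1.1 then ∏ v, (if y v = true then phaseFactor (phase v) else 1)
        else 0 := by
    -- Expanding the product over the Z-spiders, each a sum over one bit, gives the sum over all
    -- assignments to the variables.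
    rw [Fintype.prod_sum]
    refine Finset.sum_congr rfl fun y _ => ?_
    split_ifs with h
    · refine Finset.prod_congr rfl fun v _ => if_pos fun k hk => ?_
      rw [h, ← hk]
    · obtain ⟨k, hk⟩ := Function.ne_iff.1 h
      exact Finset.prod_eq_zero (Finset.mem_univ L[k].1.1) (if_neg fun h' => hk (h' k rfl))
  simp only [hu, Finset.sum_mul]
  rw [Finset.sum_comm]
  refine Finset.sum_congr rfl fun y _ => ?_
  simp only [ite_mul, zero_mul, Finset.sum_ite_eq', Finset.mem_univ, if_true]
  have : (∀ i : Fin m, ∃ k : Fin L.length, L[k].2 = i ∧ y L[k].1.1 = L[k].1.2) ↔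
      ∀ i : Fin m, ∃ p ∈ L, p.2 = i ∧ y p.1.1 = p.1.2 := by
    refine forall_congr' fun i => ⟨?_, ?_⟩
    · rintro ⟨k, hk⟩
      exact ⟨L[k], List.getElem_mem _, hk⟩
    · rintro ⟨p, hp, h⟩
      obtain ⟨k, hk, rfl⟩ := List.mem_iff_getElem.1 hp
      exact ⟨⟨k, hk⟩, h⟩
  simp only [this, mul_ite, mul_one, mul_zero]

end Occurrence

/-! ### The diagram of a phased formula -/

/-- The literals of a list of clauses, with the indices of their clauses. -/
def numberLits {α : Type} (cl : List (List α)) : List (α × ℕ) :=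
  cl.zipIdx.flatMap fun p => p.1.map fun l => (l, p.2)

theorem mem_numberLits {α : Type} {cl : List (List α)} {p : α × ℕ} :
    p ∈ numberLits cl ↔ ∃ h : p.2 < cl.length, p.1 ∈ cl[p.2] := by
  simp only [numberLits, List.mem_flatMap, List.mem_map, Prod.exists, List.mem_zipIdx_iff_getElem?,
    List.getElem?_eq_some_iff]
  constructor
  · rintro ⟨C, i, ⟨h, hC⟩, l, hl, rfl⟩
    exact ⟨h, hC ▸ hl⟩
  · rintro ⟨h, hl⟩
    exact ⟨_, _, ⟨h, rfl⟩, _, hl, rfl⟩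

namespace PhasedCNF

/-- The diagram of a formula with phases. -/
def toDiagram (φ : PhasedCNF) : Diagram :=
  Occurrence.toDiagram (numberLits φ.formula.clauses) φ.formula.clauses.length φ.phase
    fun _ hp => (mem_numberLits.1 hp).1

theorem value_toDiagram (φ : PhasedCNF) : φ.toDiagram.value = φ.count := by
  have h (y : Fin φ.formula.numVars → Bool) :
      (∀ i : Fin φ.formula.clauses.length, ∃ p ∈ numberLits φ.formula.clauses,
        p.2 = i ∧ y p.1.1 = p.1.2) ↔ φ.formula.Sat y := by
    rw [CNF.Sat, List.forall_mem_iff_getElem]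
    constructor
    · intro h i hi
      obtain ⟨p, hp, hpi, hy⟩ := h ⟨i, hi⟩
      obtain ⟨_, hp⟩ := mem_numberLits.1 hp
      simp only at hpi
      subst hpi
      exact ⟨_, hp, hy⟩
    · rintro h ⟨i, hi⟩
      obtain ⟨l, hl, hy⟩ := h i hi
      exact ⟨(l, i), mem_numberLits.2 ⟨hi, hl⟩, rfl, hy⟩
  rw [toDiagram, Occurrence.value_toDiagram, count, Finset.sum_filter]
  push_cast
  refine Finset.sum_congr rfl fun y _ => ?_
  simp only [h]
  refine if_congr Iff.rfl (Finset.prod_congr rfl fun v _ => ?_) rfl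
  cases φ.phase v <;> cases y v <;> simp [phaseFactor]

end PhasedCNF

end ZHCount

/-! ### The reduction to diagrams runs in polynomial time -/

namespace ZHCount

open Prog Polynomial

/-- The legs of the spider of the variable `v`, for numbered literals as read. -/
def rawVarLegs (I : List (((ℕ × Bool) × ℕ) × ℕ)) (v : ℕ) : List ℕ :=
  (I.filter fun p => decide (p.1.1.1 = v)).map fun p => p.2

/-- The legs of the H-box of the clause `i`, for numbered literals as read. -/
def rawClauseLegs (I : List (((ℕ × Bool) × ℕ) × ℕ)) (i : ℕ) : List ℕ :=
  (I.filter fun p => decide (p.1.2 = i)).map fun p => I.length + p.2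

/-- The codes of the generators of the diagram of a formula with phases, as read. -/
def rawGens (I : List (((ℕ × Bool) × ℕ) × ℕ)) (m : ℕ) (ph : List Bool) : List (List Bool) :=
  (ph.zipIdx.map fun q => [false, false, q.1] ++ encList encUnary (rawVarLegs I q.2)) ++
    ((I.map fun p => [false, true, p.1.1.2] ++ encList encUnary [p.2, I.length + p.2]) ++
      (List.range m).map fun i => [true, false, false] ++ encList encUnary (rawClauseLegs I i))

namespace Occurrence

variable {n : ℕ} (L : List (Occurrence n))

/-- The raw forms of the literals, with their positions. -/
def raw : List (((ℕ × Bool) × ℕ) × ℕ) :=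
  (List.finRange L.length).map fun k => (((L[k].1.1.val, L[k].1.2), L[k].2), k.val)

theorem map_zipIdx : (L.map fun p => ((p.1.1.val, p.1.2), p.2)).zipIdx = raw L := by
  refine List.ext_getElem (by simp [raw]) fun i h₁ h₂ => ?_
  simp [raw]

theorem encList_encFin {N : ℕ} (l : List (Fin N)) :
    encList encFin l = encList encUnary (l.map Fin.val) := (PT.encList_map encUnary Fin.val l).symm

theorem map_varLegs (v : Fin n) : (varLegs L v).map Fin.val = rawVarLegs (raw L) v := by
  simp [varLegs, rawVarLegs, raw, List.filter_map, Function.comp_def, Fin.ext_iff]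

theorem map_clauseLegs (i : ℕ) : (clauseLegs L i).map Fin.val = rawClauseLegs (raw L) i := by
  simp [clauseLegs, rawClauseLegs, raw, List.filter_map, Function.comp_def,
    -Fin.natAdd_eq_addNat]

theorem ofFn_eq_map_zipIdx {β : Type} (f : Fin n → Bool) (F : Bool → ℕ → β) :
    List.ofFn (fun v => F (f v) v) = (List.ofFn f).zipIdx.map fun q => F q.1 q.2 := by
  refine List.ext_getElem (by simp) fun i h₁ h₂ => ?_
  simp

/-- The construction is repeated on plain numbers, which a program can handle: the wires of the
first half become positions of literals, those of the second half are shifted by the number of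
literals. -/
theorem encode_gens (m : ℕ) (phase : Fin n → Bool) :
    (gens L m phase).map Generator.encode = rawGens (raw L) m (List.ofFn phase) := by
  have hI : (raw L).length = L.length := by simp [raw]
  rw [gens, rawGens, List.map_append, List.map_append]
  congr 1
  · rw [List.map_ofFn, ← ofFn_eq_map_zipIdx phase fun b v =>
      [false, false, b] ++ encList encUnary (rawVarLegs (raw L) v)]
    congr 1
    funext v
    simp [Generator.encode, encList_encFin, map_varLegs]
  congr 1
  · rw [List.map_ofFn, hI, raw, List.map_map, List.ofFn_eq_map]
    refine List.map_congr_left fun k _ => ?_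
    simp [litSpider, Generator.encode, encList_encFin, -Fin.natAdd_eq_addNat]
  · rw [List.map_ofFn, ← List.map_coe_finRange_eq_range, List.map_map, List.ofFn_eq_map]
    refine List.map_congr_left fun k _ => ?_
    simp [Generator.encode, encList_encFin, map_clauseLegs]

end Occurrence

/-- The code of the diagram of a formula with phases, for clauses and phases as read. -/
def encodeDiagram (cl : List (List (ℕ × Bool))) (ph : List Bool) : List Bool :=
  encUnary ((numberLits cl).length + (numberLits cl).length) ++
    encList (fun w => w) (rawGens (numberLits cl).zipIdx cl.length ph)

theorem map_numberLits {α β : Type} (f : α → β) (cl : List (List α)) :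
    numberLits (cl.map (List.map f)) = (numberLits cl).map fun p => (f p.1, p.2) := by
  simp [numberLits, List.zipIdx_map, List.flatMap_map, List.map_flatMap, Function.comp_def]

theorem PhasedCNF.encode_toDiagram (φ : PhasedCNF) : φ.toDiagram.encode =
    encodeDiagram (φ.formula.clauses.map (List.map fun l => (l.1.val, l.2)))
      (List.ofFn φ.phase) := by
  rw [encodeDiagram, map_numberLits, Occurrence.map_zipIdx, List.length_map, List.length_map,
    ← Occurrence.encode_gens, PT.encList_map]
  rfl

/-- The clauses and phases of the formula with the given code. -/
def readPhased (s : List Bool) : List (List (ℕ × Bool)) × List Bool :=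
  ((readList (readList (readPair readNat readBit)) (readNat s).2).1,
    (readList readBit (readList (readList (readPair readNat readBit)) (readNat s).2).2).1)

theorem readPhased_encode (φ : PhasedCNF) : readPhased φ.encode =
    (φ.formula.clauses.map (List.map fun l => (l.1.val, l.2)), List.ofFn φ.phase) := by
  -- The reader of variable names is the same for every number of variables, so a single program
  -- reads all formulas.
  have h1 := ((((Reads.fin (o := false) (n := φ.formula.numVars)).pair Reads.bit).list
    (by norm_num)).list (by norm_num)).eq φ.formula.clauses
  have h2 := ((Reads.bit (o := false)).list (by norm_num)).eq (List.ofFn φ.phase) []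
  rw [List.append_nil] at h2
  rw [readPhased, PhasedCNF.encode, CNF.encode, List.append_assoc, (Reads.nat (o := false)).eq, h1,
    h2, List.map_id']
  rfl

namespace PT

variable {o : Bool} {α γ : Type} [Code α] [Code γ]

theorem readPhased : PT o readPhased := by
  have h1 : PT o readNat := Reads.nat.pt
  have h2 : PT o (readList (readList (readPair readNat readBit))) :=
    (((Reads.nat.pair Reads.bit).list (by norm_num)).list (by norm_num)).pt
  have h3 : PT o (readList readBit) := (Reads.bit.list (by norm_num)).pt
  have h4 := comp h2 (snd h1)
  exact pair (fst h4) (fst (comp h3 (snd h4)))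

@[fun_prop]
theorem numberLits {cl : γ → List (List α)} (hcl : PT o cl) :
    PT o (fun x => numberLits (cl x)) :=
  flatMap (zipIdx hcl (const 0)) (g := fun (_ : γ) (p : List α × ℕ) => p.1.map fun l => (l, p.2))
    (map (l := fun q : γ × List α × ℕ => q.2.1) (by fun_prop)
      (g := fun (q : γ × List α × ℕ) (l : α) => (l, q.2.2)) (by fun_prop))

@[fun_prop]
theorem encList_encUnary {l : γ → List ℕ} (hl : PT o l) :
    PT o (fun x => ZHCount.encList ZHCount.encUnary (l x)) :=
  encList (e := fun _ => ZHCount.encUnary) hl (encUnary (by fun_prop))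

@[fun_prop]
theorem rawVarLegs {I : γ → List (((ℕ × Bool) × ℕ) × ℕ)} {v : γ → ℕ} (hI : PT o I) (hv : PT o v) :
    PT o (fun x => rawVarLegs (I x) (v x)) :=
  map (g := fun (_ : γ) (p : ((ℕ × Bool) × ℕ) × ℕ) => p.2)
    (filter hI (g := fun (x : γ) (p : ((ℕ × Bool) × ℕ) × ℕ) => decide (p.1.1.1 = v x))
      (decide_eq (by fun_prop) (by fun_prop))) (by fun_prop)

@[fun_prop]
theorem rawClauseLegs {I : γ → List (((ℕ × Bool) × ℕ) × ℕ)} {i : γ → ℕ} (hI : PT o I)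
    (hi : PT o i) : PT o (fun x => rawClauseLegs (I x) (i x)) :=
  map (g := fun (x : γ) (p : ((ℕ × Bool) × ℕ) × ℕ) => (I x).length + p.2)
    (filter hI (g := fun (x : γ) (p : ((ℕ × Bool) × ℕ) × ℕ) => decide (p.1.2 = i x))
      (decide_eq (by fun_prop) (by fun_prop))) (by fun_prop)

@[fun_prop]
theorem rawGens {I : γ → List (((ℕ × Bool) × ℕ) × ℕ)} {m : γ → ℕ} {ph : γ → List Bool}
    (hI : PT o I) (hm : PT o m) (hph : PT o ph) : PT o (fun x => rawGens (I x) (m x) (ph x)) := by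
  refine append ?_ (append ?_ ?_)
  · exact map (zipIdx hph (const 0)) (g := fun (x : γ) (q : Bool × ℕ) =>
      [false, false, q.1] ++ ZHCount.encList ZHCount.encUnary (ZHCount.rawVarLegs (I x) q.2))
      (by fun_prop)
  · exact map hI (g := fun (x : γ) (p : ((ℕ × Bool) × ℕ) × ℕ) => [false, true, p.1.1.2] ++
      ZHCount.encList ZHCount.encUnary [p.2, (I x).length + p.2]) (by fun_prop)
  · exact map (range hm) (g := fun (x : γ) (i : ℕ) => [true, false, false] ++
      ZHCount.encList ZHCount.encUnary (ZHCount.rawClauseLegs (I x) i)) (by fun_prop)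

@[fun_prop]
theorem encodeDiagram {cl : γ → List (List (ℕ × Bool))} {ph : γ → List Bool} (hcl : PT o cl)
    (hph : PT o ph) : PT o (fun x => encodeDiagram (cl x) (ph x)) :=
  append (encUnary (by fun_prop)) (encList (e := fun _ w => w)
    (rawGens (zipIdx (numberLits hcl) (const 0)) (length hcl) hph) (by fun_prop))

end PT

theorem polyTime_toDiagram : PolyTime PhasedCNF.encode Diagram.encode PhasedCNF.toDiagram := by
  have h : PT false (fun p : List (List (ℕ × Bool)) × List Bool => encodeDiagram p.1 p.2) := by
    fun_prop
  refine PT.polyTime (PT.comp h PT.readPhased) fun φ => ?_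
  rw [readPhased_encode, PhasedCNF.encode_toDiagram]

end ZHCount

/-! ### The theorem -/

theorem mainTheorem5 :
    (∃ r : ZHCount.Diagram → ZHCount.Scalar × ZHCount.CNF × ZHCount.CNF,
      ZHCount.PolyTime ZHCount.Diagram.encode
        (ZHCount.encPair ZHCount.Scalar.encode
          (ZHCount.encPair ZHCount.CNF.encode ZHCount.CNF.encode)) r ∧
      ∀ D : ZHCount.Diagram,
        (r D).2.1.Is3CNF ∧ (r D).2.2.Is3CNF ∧
          D.value = (r D).1.val * (((r D).2.1.count : ℂ) - ((r D).2.2.count : ℂ))) ∧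
    ZHCount.InFPSharpP ZHCount.Diagram.encode ZHCount.Diagram.value ∧
    (∃ r : ZHCount.Diagram → ZHCount.Scalar × ZHCount.PhasedCNF,
      ZHCount.PolyTime ZHCount.Diagram.encode
        (ZHCount.encPair ZHCount.Scalar.encode ZHCount.PhasedCNF.encode) r ∧
      ∀ D : ZHCount.Diagram, D.value = (r D).1.val * ((r D).2.count : ℂ)) ∧
    (∃ r : ZHCount.PhasedCNF → ZHCount.Diagram,
      ZHCount.PolyTime ZHCount.PhasedCNF.encode ZHCount.Diagram.encode r ∧
      ∀ φ : ZHCount.PhasedCNF, (r φ).value = (φ.count : ℂ)) := by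
  refine ⟨⟨ZHCount.Diagram.toCNFs, ZHCount.polyTime_toCNFs, fun D => ⟨?_, ?_, ?_⟩⟩,
    ZHCount.inFPSharpP_value,
    ⟨ZHCount.Diagram.toPhased, ZHCount.polyTime_toPhased, ZHCount.Diagram.value_eq_toPhased⟩,
    ⟨ZHCount.PhasedCNF.toDiagram, ZHCount.polyTime_toDiagram,
      ZHCount.PhasedCNF.value_toDiagram⟩⟩
  · exact ZHCount.Instr.is3CNF_toCNF _ _
  · exact ZHCount.Instr.is3CNF_toCNF _ _
  · exact D.value_eq_toCNFs
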